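/- Work over $\mathbb{C}$ with complete convex bornological vector spaces; $\hat\otimes$ denotes the completed bornological tensor product (universal for bounded bilinear maps into complete spaces) and $M(A)$ the algebra of bounded two-sided multipliers of a bornological algebra $A$. A bornological algebra $H \neq 0$ (not necessarily unital) is essential if multiplication induces a bornological isomorphism $H \hat\otimes_H H \cong H$. A homomorphism $f : H \to M(K)$ is a bounded multiplicative linear map; it is essential if it induces bornological isomorphisms $H \hat\otimes_H K \cong K \cong K \hat\otimes_H H$. A bornological quantum group is an essential bornological algebra $H$ with the approximation property, together with a coassociative essential homomorphism $\Delta : H \to M(H \hat\otimes H)$ such that the four Galois maps $$\gamma_l(f \otimes g) = \Delta(f)(g \otimes 1),\quad \gamma_r(f \otimes g) = \Delta(f)(1 \otimes g),\quad \rho_l(f \otimes g) = (f \otimes 1)\Delta(g),\quad \rho_r(f \otimes g) = (1 \otimes f)\Delta(g)$$ are bornological isomorphisms of $H \hat\otimes H$ onto itself, and a faithful left invariant bounded linear functional $\phi : H \to \mathbb{C}$ (a left Haar functional). Here $\phi$ is faithful if $\phi(fg) = 0$ for all $g$ implies $f = 0$ and $\phi(fg) = 0$ for all $f$ implies $g =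 0$; a bounded linear functional $\phi$ is left invariant if $(\mathrm{id} \hat\otimes \phi)\Delta(f) = \phi(f) 1$ in $M(H)$ for all $f$, that is, $(\mathrm{id}\hat\otimes\phi)\gamma_l(f \otimes g) = \phi(f) g = (\mathrm{id}\hat\otimes\phi)\rho_l(g \otimes f)$ for all $f, g$; and $\psi$ is right invariant if $(\psi \hat\otimes \mathrm{id})\Delta(f) = \psi(f) 1$, that is, $(\psi\hat\otimes\mathrm{id})\gamma_r(f \otimes g) = \psi(f) g = (\psi\hat\otimes\mathrm{id})\rho_r(g \otimes f)$ for all $f, g$. Theorem. Let $H$ be a bornological quantum group with left Haar functional $\phi$. (1) The left Haar functional is unique up to a scalar: every left invariant bounded linear functional $\phi'$ on $H$ is of the form $\phi' = c\,\phi$ with $c \in \mathbb{C}$, and $c \neq 0$ if $\phi'$ is faithful. (2) If $\phi_1$ is any faithful left invariant functional and $\psi$ any faithful right invariant functional on $H$, then there is a bornological isomorphism (a linear bijection bounded in both directions) $\nu : H \to H$ with $\psi(hf) = \phi_1(h\,\nu(f))$ for all $f, h \in H$. -/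

import Mathlib

universe u

namespace BornQG

open Filter Topology Bornology Pointwise

section Spaces

variable {V : Type u} [AddCommGroup V] [Module ℂ V]

/-- A disk is a circled convex subset. -/
structure IsDisk (S : Set V) : Prop where
  balanced : Balanced ℂ S
  convex : Convex ℝ S

/-- A disk `S` is completant if its linear span, with the Minkowski functional of `S` as
semi-norm, is a Banach space. -/
structure IsCompletant (S : Set V) : Prop extends IsDisk S where
  eq_zero : ∀ x ∈ Submodule.span ℂ S, gauge S x = 0 → x = 0
  complete : ∀ x : ℕ → V, (∀ n, x n ∈ Submodule.span ℂ S) →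
    (∀ ε > 0, ∃ N, ∀ m ≥ N, ∀ n ≥ N, gauge S (x m - x n) < ε) →
    ∃ y ∈ Submodule.span ℂ S, Tendsto (fun n => gauge S (x n - y)) atTop (𝓝 0)

/-- A complete (convex) bornological vector space over `ℂ`; the small sets are the sets `S` with
`IsBounded S`. -/
class CompleteBornSpace (V : Type u) [AddCommGroup V] [Module ℂ V] [Bornology V] : Prop where
  isBounded_add : ∀ S T : Set V, IsBounded S → IsBounded T → IsBounded (S + T)
  isBounded_smul : ∀ (c : ℂ) (S : Set V), IsBounded S → IsBounded (c • S)
  isBounded_hull : ∀ S : Set V, IsBounded S → IsBounded (convexHull ℝ (balancedHull ℂ S))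
  exists_completant : ∀ S : Set V, IsBounded S → ∃ T, S ⊆ T ∧ IsBounded T ∧ IsCompletant T

theorem IsDisk.exists_mem_smul {S : Set V} (hS : IsDisk S) (hne : S.Nonempty) {x : V}
    (hx : x ∈ Submodule.span ℂ S) : ∃ r : ℝ, 0 < r ∧ x ∈ r • S := by
  induction hx using Submodule.span_induction with
  | mem x h => exact ⟨1, one_pos, by simpa using h⟩
  | zero =>
    obtain ⟨s, hs⟩ := hne
    refine ⟨1, one_pos, ?_⟩
    have := hS.balanced.smul_mem (a := (0 : ℂ)) (by simp) hs
    simpa using this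
  | add x y _ _ hx hy =>
    obtain ⟨r, hr, hx⟩ := hx
    obtain ⟨t, ht, hy⟩ := hy
    refine ⟨r + t, by positivity, ?_⟩
    rw [hS.convex.add_smul hr.le ht.le]
    exact Set.add_mem_add hx hy
  | smul c x _ hx =>
    obtain ⟨r, hr, s, hs, rfl⟩ := hx
    have h1 : (0 : ℝ) < ‖c‖ + 1 := by positivity
    refine ⟨(‖c‖ + 1) * r, by positivity, (c / ((‖c‖ + 1 : ℝ) : ℂ)) • s,
      hS.balanced.smul_mem ?_ hs, ?_⟩
    · rw [norm_div, Complex.norm_real, Real.norm_of_nonneg h1.le, div_le_one h1]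
      linarith
    · have h2 : ((‖c‖ + 1 : ℝ) : ℂ) ≠ 0 := by exact_mod_cast h1.ne'
      simp only [← Complex.coe_smul, smul_smul]
      congr 1
      push_cast at h2 ⊢
      field_simp

theorem IsDisk.zero_mem {S : Set V} (hS : IsDisk S) (hne : S.Nonempty) : (0 : V) ∈ S := by
  obtain ⟨s, hs⟩ := hne
  have := hS.balanced.smul_mem (a := (0 : ℂ)) (by simp) hs
  simpa using this

theorem gauge_coe_span (S : Set V) (x : Submodule.span ℂ S) :
    gauge ((↑) ⁻¹' S : Set (Submodule.span ℂ S)) x = gauge S (x : V) := by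
  have hc : ∀ (r : ℝ) (z : Submodule.span ℂ S), ((r • z : Submodule.span ℂ S) : V) = r • (z : V) :=
    fun r z => rfl
  rw [gauge_def', gauge_def']
  simp only [Set.mem_preimage, hc]

theorem IsDisk.preimage_span {S : Set V} (hS : IsDisk S) :
    IsDisk ((↑) ⁻¹' S : Set (Submodule.span ℂ S)) where
  balanced := by
    intro a ha y hy
    obtain ⟨z, hz, rfl⟩ := hy
    exact hS.balanced.smul_mem ha hz
  convex := by
    intro x hx y hy a b ha hb hab
    exact hS.convex hx hy ha hb hab

theorem IsDisk.absorbent_span {S : Set V} (hS : IsDisk S) (hne : S.Nonempty) :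
    Absorbent ℝ ((↑) ⁻¹' S : Set (Submodule.span ℂ S)) := by
  rintro ⟨x, hx⟩
  obtain ⟨r, hr, s, hs, rfl⟩ := hS.exists_mem_smul hne hx
  rw [absorbs_iff_norm]
  refine ⟨r, fun c hc => ?_⟩
  have hc0 : c ≠ 0 := by
    rintro rfl
    simp at hc
    linarith
  rintro _ rfl
  rw [Set.mem_smul_set_iff_inv_smul_mem₀ hc0]
  change c⁻¹ • (r • s) ∈ S
  rw [smul_smul, ← Complex.coe_smul]
  refine hS.balanced.smul_mem ?_ hs
  rw [Complex.norm_real, norm_mul, norm_inv, Real.norm_of_nonneg hr.le]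
  rw [inv_mul_le_iff₀ (by linarith)]
  linarith

theorem IsDisk.gauge_add_le {S : Set V} (hS : IsDisk S) (hne : S.Nonempty) {x y : V}
    (hx : x ∈ Submodule.span ℂ S) (hy : y ∈ Submodule.span ℂ S) :
    gauge S (x + y) ≤ gauge S x + gauge S y := by
  have h := _root_.gauge_add_le hS.preimage_span.convex (hS.absorbent_span hne)
    (⟨x, hx⟩ : Submodule.span ℂ S) ⟨y, hy⟩
  rw [gauge_coe_span, gauge_coe_span, gauge_coe_span] at h
  exact h

theorem IsDisk.gauge_smul {S : Set V} (hS : IsDisk S) (c : ℂ) (x : V) :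
    gauge S (c • x) = ‖c‖ * gauge S x := _root_.gauge_smul hS.balanced c x

theorem IsDisk.gauge_neg {S : Set V} (hS : IsDisk S) (x : V) :
    gauge S (-x) = gauge S x := by
  have := hS.gauge_smul (-1) x
  simpa using this

theorem IsDisk.mem_smul_of_gauge_lt {S : Set V} (hS : IsDisk S) (hne : S.Nonempty) {x : V}
    (hx : x ∈ Submodule.span ℂ S) {r : ℝ} (h : gauge S x < r) : x ∈ r • S := by
  rw [← gauge_coe_span S ⟨x, hx⟩] at h
  obtain ⟨b, hb, hbr, s, hs, hs'⟩ := exists_lt_of_gauge_lt (hS.absorbent_span hne) h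
  have h3 : x = b • (s : V) := congrArg Subtype.val hs'.symm
  have hr : 0 < r := hb.trans hbr
  rw [h3, Set.mem_smul_set_iff_inv_smul_mem₀ hr.ne', smul_smul, ← Complex.coe_smul]
  refine hS.balanced.smul_mem ?_ hs
  rw [Complex.norm_real, norm_mul, norm_inv, Real.norm_of_nonneg hr.le, Real.norm_of_nonneg hb.le,
    inv_mul_le_iff₀ hr]
  linarith

theorem mem_span_of_mem_smul {S : Set V} {x : V} {r : ℝ} (h : x ∈ r • S) :
    x ∈ Submodule.span ℂ S := by
  obtain ⟨s, hs, rfl⟩ := h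
  change r • s ∈ _
  rw [← Complex.coe_smul]
  exact Submodule.smul_mem _ _ (Submodule.subset_span hs)

theorem IsDisk.gauge_le_mul_of_subset {S T : Set V} (hS : IsDisk S) (hne : S.Nonempty)
    (h : S ⊆ T) {x : V} (hx : x ∈ Submodule.span ℂ S) : gauge T x ≤ gauge S x := by
  refine le_of_forall_pos_lt_add fun ε hε => ?_
  have h1 := hS.mem_smul_of_gauge_lt hne hx (r := gauge S x + ε / 2) (by linarith)
  have h2 := gauge_le_of_mem (a := gauge S x + ε / 2) (by have := gauge_nonneg (s := S) x; linarith)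
    (Set.smul_set_mono h h1)
  linarith

theorem CompleteBornSpace.isBounded_real_smul [Bornology V] [CompleteBornSpace V] (r : ℝ)
    {S : Set V} (h : IsBounded S) : IsBounded (r • S) := by
  have := CompleteBornSpace.isBounded_smul (r : ℂ) S h
  have h2 : r • S = (r : ℂ) • S := by
    ext x
    simp only [Set.mem_smul_set, Complex.coe_smul]
  rwa [h2]

/-- Absolutely convergent series in the Banach space spanned by a completant disk converge. -/
theorem IsCompletant.exists_sum {S : Set V} (hS : IsCompletant S) (hne : S.Nonempty) {ι : Type u}
    (a : ι → ℂ) (d : ι → V) (hd : ∀ i, a i ≠ 0 → d i ∈ S) (ha : Summable fun i => ‖a i‖) :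
    ∃ y ∈ Submodule.span ℂ S, gauge S y ≤ ∑' i, ‖a i‖ ∧
      Tendsto (fun s : Finset ι => gauge S ((∑ i ∈ s, a i • d i) - y)) atTop (𝓝 0) := by
  classical
  let N : AddGroupNorm (Submodule.span ℂ S) :=
    { toFun := fun x => gauge S (x : V)
      map_zero' := gauge_zero
      add_le' := fun x y => hS.toIsDisk.gauge_add_le hne x.2 y.2
      neg' := fun x => hS.toIsDisk.gauge_neg x
      eq_zero_of_map_eq_zero' := fun x hx => Subtype.ext (hS.eq_zero x x.2 hx) }
  let _ : NormedAddCommGroup (Submodule.span ℂ S) := N.toNormedAddCommGroup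
  have hN : ∀ x : Submodule.span ℂ S, ‖x‖ = gauge S (x : V) := fun x => rfl
  have : CompleteSpace (Submodule.span ℂ S) := by
    refine Metric.complete_of_cauchySeq_tendsto fun x hx => ?_
    rw [Metric.cauchySeq_iff] at hx
    obtain ⟨y, hy, hy'⟩ := hS.complete (fun n => (x n : V)) (fun n => (x n).2) (by
      intro ε hε
      obtain ⟨M, hM⟩ := hx ε hε
      refine ⟨M, fun m hm n hn => ?_⟩
      have := hM m hm n hn
      rwa [dist_eq_norm, hN] at this)
    refine ⟨⟨y, hy⟩, ?_⟩
    rw [tendsto_iff_norm_sub_tendsto_zero]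
    exact hy'
  have hmem : ∀ i, a i • d i ∈ Submodule.span ℂ S := fun i => by
    by_cases h : a i = 0
    · simp [h]
    · exact Submodule.smul_mem _ _ (Submodule.subset_span (hd i h))
  let f : ι → Submodule.span ℂ S := fun i => ⟨a i • d i, hmem i⟩
  have hf : ∀ i, ‖f i‖ ≤ ‖a i‖ := fun i => by
    rw [hN]
    change gauge S (a i • d i) ≤ _
    rw [hS.toIsDisk.gauge_smul]
    by_cases h : a i = 0
    · simp [h]
    · exact mul_le_of_le_one_right (norm_nonneg _) (gauge_le_one_of_mem (hd i h))
  have hsum : Summable f := Summable.of_norm_bounded ha hf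
  refine ⟨(∑' i, f i : Submodule.span ℂ S), Subtype.property _, ?_, ?_⟩
  · rw [← hN]
    exact tsum_of_norm_bounded ha.hasSum hf
  · have := hsum.hasSum
    rw [HasSum, tendsto_iff_norm_sub_tendsto_zero] at this
    simp only [SummationFilter.unconditional_filter] at this
    refine this.congr fun s => ?_
    rw [hN]
    simp [f]

/-- The image of an open ball of a Banach space under a linear map with closed kernel is
completant. -/
theorem isCompletant_image_ball {E : Type u} [NormedAddCommGroup E] [NormedSpace ℂ E]
    [CompleteSpace E] (f : E →ₗ[ℂ] V) (hf : IsClosed (LinearMap.ker f : Set E)) {r : ℝ}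
    (hr : 0 < r) : IsCompletant (f '' Metric.ball 0 r) := by
  have := hf
  let g : (E ⧸ LinearMap.ker f) →ₗ[ℂ] V := (LinearMap.ker f).liftQ f le_rfl
  have hg : Function.Injective g := by
    rw [← LinearMap.ker_eq_bot]
    exact Submodule.ker_liftQ_eq_bot _ _ _ le_rfl
  have hgr : ∀ (c : ℝ) z, g (c • z) = c • g z := fun c z => by
    rw [← Complex.coe_smul, map_smul, Complex.coe_smul]
  have himg : f '' Metric.ball 0 r = g '' Metric.ball 0 r := by
    ext y
    constructor
    · rintro ⟨x, hx, rfl⟩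
      refine ⟨Submodule.Quotient.mk x, ?_, rfl⟩
      rw [mem_ball_zero_iff] at hx ⊢
      exact (Submodule.Quotient.norm_mk_le _ x).trans_lt hx
    · rintro ⟨z, hz, rfl⟩
      rw [mem_ball_zero_iff] at hz
      obtain ⟨x, rfl, hx⟩ := Submodule.Quotient.norm_mk_lt z (sub_pos.2 hz)
      refine ⟨x, ?_, rfl⟩
      rw [mem_ball_zero_iff]
      linarith
  have hgauge : ∀ z, gauge (f '' Metric.ball 0 r) (g z) = ‖z‖ / r := fun z => by
    rw [himg, ← gauge_ball hr.le z, gauge_def', gauge_def']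
    simp only [← hgr, hg.mem_set_image]
  have hspan : ∀ y ∈ Submodule.span ℂ (f '' Metric.ball 0 r), ∃ z, g z = y := fun y hy => by
    have : Submodule.span ℂ (f '' Metric.ball 0 r) ≤ LinearMap.range g := by
      rw [Submodule.span_le, himg]
      rintro _ ⟨z, _, rfl⟩
      exact ⟨z, rfl⟩
    exact this hy
  have hspan' : ∀ z, g z ∈ Submodule.span ℂ (f '' Metric.ball 0 r) := fun z => by
    have h1 : (0 : ℝ) < r / (‖z‖ + 1) := by positivity
    have h2 : g ((r / (‖z‖ + 1)) • z) ∈ f '' Metric.ball 0 r := by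
      rw [himg]
      refine ⟨_, ?_, rfl⟩
      rw [mem_ball_zero_iff, norm_smul, Real.norm_of_nonneg h1.le, div_mul_eq_mul_div,
        div_lt_iff₀ (by positivity)]
      nlinarith [norm_nonneg z]
    have h3 : g z = (r / (‖z‖ + 1))⁻¹ • g ((r / (‖z‖ + 1)) • z) := by
      rw [← hgr, smul_smul, inv_mul_cancel₀ h1.ne', one_smul]
    rw [h3, ← Complex.coe_smul]
    exact Submodule.smul_mem _ _ (Submodule.subset_span h2)
  refine ⟨⟨?_, ?_⟩, ?_, ?_⟩
  · rintro c hc _ ⟨_, ⟨x, hx, rfl⟩, rfl⟩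
    refine ⟨c • x, ?_, map_smul f c x⟩
    rw [mem_ball_zero_iff] at hx ⊢
    rw [norm_smul]
    exact (mul_le_of_le_one_left (norm_nonneg _) hc).trans_lt hx
  · exact (convex_ball (0 : E) r).linear_image (f.restrictScalars ℝ)
  · intro y hy h0
    obtain ⟨z, rfl⟩ := hspan y hy
    rw [hgauge, div_eq_zero_iff, or_iff_left hr.ne', norm_eq_zero] at h0
    rw [h0, map_zero]
  · intro x hx hc
    choose z hz using fun n => hspan (x n) (hx n)
    have hcau : CauchySeq z := by
      rw [Metric.cauchySeq_iff]
      intro ε hε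
      obtain ⟨N, hN⟩ := hc (ε / r) (by positivity)
      refine ⟨N, fun m hm n hn => ?_⟩
      have := hN m hm n hn
      rw [← hz, ← hz, ← map_sub, hgauge] at this
      rw [dist_eq_norm]
      exact (div_lt_div_iff_of_pos_right hr).1 this
    obtain ⟨w, hw⟩ := cauchySeq_tendsto_of_complete hcau
    refine ⟨g w, hspan' w, ?_⟩
    rw [tendsto_iff_norm_sub_tendsto_zero] at hw
    have := hw.div_const r
    rw [zero_div] at this
    refine this.congr fun n => ?_
    rw [← hz, ← map_sub, hgauge]

end Spaces

section Maps

variable {V W X Y : Type u} [AddCommGroup V] [Module ℂ V] [Bornology V]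
  [AddCommGroup W] [Module ℂ W] [Bornology W] [AddCommGroup X] [Module ℂ X] [Bornology X]
  [AddCommGroup Y] [Module ℂ Y] [Bornology Y]

/-- A linear map is bounded if it maps small sets to small sets. -/
def BddLin {V W : Type*} [AddCommGroup V] [Module ℂ V] [Bornology V] [AddCommGroup W] [Module ℂ W]
    [Bornology W] (f : V →ₗ[ℂ] W) : Prop :=
  ∀ S : Set V, IsBounded S → IsBounded (f '' S)

/-- Bounded bilinear maps. -/
def BddBilin (b : V →ₗ[ℂ] W →ₗ[ℂ] X) : Prop :=
  ∀ (S : Set V) (T : Set W), IsBounded S → IsBounded T → IsBounded (Set.image2 (b · ·) S T)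

/-- A bornological isomorphism: a linear bijection which is bounded in both directions. -/
def IsBornIso (e : V ≃ₗ[ℂ] W) : Prop :=
  BddLin (e : V →ₗ[ℂ] W) ∧ BddLin (e.symm : W →ₗ[ℂ] V)

end Maps

section Tensor

variable (V W : Type u) [AddCommGroup V] [Module ℂ V] [Bornology V]
  [AddCommGroup W] [Module ℂ W] [Bornology W]

/-- Absolutely summable families of coefficients supported in a product of two small sets; such a
family `a` represents the convergent series `∑ a (v, w) • (v ⊗ w)`. -/
def seriesSubmodule : Submodule ℂ (V × W → ℂ) where
  carrier := {a | (Summable fun p => ‖a p‖) ∧ ∃ (S : Set V) (T : Set W), IsBounded S ∧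
    IsBounded T ∧ ∀ p, a p ≠ 0 → p ∈ S ×ˢ T}
  zero_mem' := ⟨by simp, ∅, ∅, isBounded_empty, isBounded_empty, by simp⟩
  add_mem' := by
    rintro a b ⟨ha, S, T, hS, hT, h⟩ ⟨hb, S', T', hS', hT', h'⟩
    refine ⟨(ha.add hb).of_nonneg_of_le (fun _ => norm_nonneg _) (fun p => norm_add_le _ _),
      S ∪ S', T ∪ T', hS.union hS', hT.union hT', fun p hp => ?_⟩
    by_cases h0 : a p = 0
    · have h1 : b p ≠ 0 := by
        rintro h1
        simp [h0, h1] at hp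
      exact ⟨Or.inr (h' p h1).1, Or.inr (h' p h1).2⟩
    · exact ⟨Or.inl (h p h0).1, Or.inl (h p h0).2⟩
  smul_mem' := by
    rintro c a ⟨ha, S, T, hS, hT, h⟩
    refine ⟨by simpa [norm_mul] using ha.mul_left ‖c‖, S, T, hS, hT, fun p hp => h p ?_⟩
    rintro h0
    simp [h0] at hp

/-- The space of all such series. -/
def Series : Type u := seriesSubmodule V W

instance : AddCommGroup (Series V W) := inferInstanceAs (AddCommGroup (seriesSubmodule V W))

instance : Module ℂ (Series V W) := inferInstanceAs (Module ℂ (seriesSubmodule V W))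

variable {V W}

/-- The `ℓ¹`-norm of the coefficients. -/
noncomputable def Series.norm (a : Series V W) : ℝ := ∑' p, ‖a.1 p‖

/-- The support condition `a (v, w) = 0` for `(v, w)` outside `S × T`. -/
def Series.SuppIn (a : Series V W) (S : Set V) (T : Set W) : Prop :=
  ∀ p, a.1 p ≠ 0 → p ∈ S ×ˢ T

/-- The series consisting of the single term `v ⊗ w`. -/
noncomputable def Series.single (p : V × W) : Series V W := by
  classical
  exact Subtype.mk (p := (· ∈ seriesSubmodule V W)) (Pi.single p 1) ⟨summable_of_ne_finset_zero (s := {p}) (fun q hq => by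
      rw [Finset.mem_singleton] at hq
      simp [hq]), {p.1}, {p.2}, isBounded_singleton, isBounded_singleton,
    fun q hq => by
      by_cases h : q = p
      · subst h
        simp
      · simp [h] at hq⟩

theorem Series.single_apply [DecidableEq (V × W)] (p q : V × W) :
    (Series.single p).1 q = if q = p then 1 else 0 := by
  unfold Series.single
  simp only [Pi.single_apply]
  congr

/-- A subspace of series which is closed under convergence inside the Banach spaces `ℓ¹(S × T)`
with `S`, `T` small. -/
def IsClosedSub (M : Submodule ℂ (Series V W)) : Prop :=
  ∀ (S : Set V) (T : Set W), IsBounded S → IsBounded T → ∀ (u : ℕ → Series V W) (a : Series V W),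
    (∀ n, u n ∈ M) → (∀ n, (u n).SuppIn S T) → a.SuppIn S T →
    Tendsto (fun n => (u n - a).norm) atTop (𝓝 0) → a ∈ M

/-- The bilinearity relations, and further relations `v ⊗ w = v' ⊗ w'` prescribed by `R`. -/
inductive Relator (R : Set ((V × W) × (V × W))) : Series V W → Prop
  | add_left (v v' : V) (w : W) :
      Relator R (.single (v + v', w) - .single (v, w) - .single (v', w))
  | add_right (v : V) (w w' : W) :
      Relator R (.single (v, w + w') - .single (v, w) - .single (v, w'))
  | smul_left (c : ℂ) (v : V) (w : W) :
      Relator R (.single (c • v, w) - c • .single (v, w))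
  | smul_right (c : ℂ) (v : V) (w : W) :
      Relator R (.single (v, c • w) - c • .single (v, w))
  | rel (p q : V × W) : (p, q) ∈ R → Relator R (.single p - .single q)

/-- The smallest closed subspace containing the relations. -/
def relators (R : Set ((V × W) × (V × W))) : Submodule ℂ (Series V W) :=
  sInf {M | IsClosedSub M ∧ ∀ a, Relator R a → a ∈ M}

variable (V W) in
/-- The completed bornological tensor product of `V` and `W` modulo the closed subspace generated
by the relations in `R`. Its elements are the series `∑ aₙ • (vₙ ⊗ wₙ)` with `(aₙ)` absolutely
summable and with `(vₙ)`, `(wₙ)` contained in small sets. -/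
def BTensor (R : Set ((V × W) × (V × W))) : Type u := Series V W ⧸ relators R

variable (V W) in
/-- The completed bornological tensor product. -/
abbrev CTensor : Type u := BTensor V W ∅

variable {R : Set ((V × W) × (V × W))}

noncomputable instance : AddCommGroup (BTensor V W R) :=
  inferInstanceAs (AddCommGroup (Series V W ⧸ relators R))

noncomputable instance : Module ℂ (BTensor V W R) :=
  inferInstanceAs (Module ℂ (Series V W ⧸ relators R))

variable (R) in
noncomputable def BTensor.mk : Series V W →ₗ[ℂ] BTensor V W R := (relators R).mkQ

variable (V W) in
/-- The closed ball of radius `C` in `ℓ¹(S × T)`. -/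
def Series.ball (S : Set V) (T : Set W) (C : ℝ) : Set (Series V W) :=
  {a | a.SuppIn S T ∧ a.norm ≤ C}

theorem Series.summable (a : Series V W) : Summable fun p => ‖a.1 p‖ := a.2.1

theorem Series.norm_add_le (a b : Series V W) : (a + b).norm ≤ a.norm + b.norm := by
  unfold Series.norm
  rw [← a.summable.tsum_add b.summable]
  exact (a + b).summable.tsum_le_tsum (fun p => _root_.norm_add_le _ _)
    (a.summable.add b.summable)

theorem Series.norm_smul (c : ℂ) (a : Series V W) : (c • a).norm = ‖c‖ * a.norm := by
  unfold Series.norm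
  rw [← tsum_mul_left]
  exact tsum_congr fun p => _root_.norm_smul c (a.1 p)

theorem Series.norm_nonneg (a : Series V W) : 0 ≤ a.norm := tsum_nonneg fun _ => _root_.norm_nonneg _

theorem Series.SuppIn.mono {a : Series V W} {S S' : Set V} {T T' : Set W} (h : a.SuppIn S T)
    (hS : S ⊆ S') (hT : T ⊆ T') : a.SuppIn S' T' :=
  fun p hp => ⟨hS (h p hp).1, hT (h p hp).2⟩

theorem Series.SuppIn.add {a b : Series V W} {S : Set V} {T : Set W} (h : a.SuppIn S T)
    (h' : b.SuppIn S T) : (a + b).SuppIn S T := fun p hp => by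
  by_cases h0 : a.1 p = 0
  · refine h' p fun h1 => hp ?_
    change a.1 p + b.1 p = 0
    rw [h0, h1, add_zero]
  · exact h p h0

theorem Series.SuppIn.smul {a : Series V W} {S : Set V} {T : Set W} (c : ℂ) (h : a.SuppIn S T) :
    (c • a).SuppIn S T := fun p hp => h p fun h0 => hp (by
  change c • a.1 p = 0
  rw [h0, smul_zero])

theorem Series.SuppIn.sub {a b : Series V W} {S : Set V} {T : Set W} (h : a.SuppIn S T)
    (h' : b.SuppIn S T) : (a - b).SuppIn S T := by
  have := h.add (h'.smul (-1))
  rwa [neg_one_smul, ← sub_eq_add_neg] at this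

theorem Series.exists_suppIn (a : Series V W) :
    ∃ (S : Set V) (T : Set W), IsBounded S ∧ IsBounded T ∧ a.SuppIn S T := a.2.2

theorem Series.single_suppIn {v : V} {w : W} {S : Set V} {T : Set W} (hv : v ∈ S) (hw : w ∈ T) :
    (Series.single (v, w)).SuppIn S T := by
  classical
  intro p hp
  rw [Series.single_apply] at hp
  have : p = (v, w) := by
    by_contra h
    simp [h] at hp
  subst this
  exact ⟨hv, hw⟩

theorem Series.single_norm (p : V × W) : (Series.single p).norm = 1 := by
  classical
  unfold Series.norm
  rw [tsum_eq_single p]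
  · simp [Series.single_apply]
  · intro q hq
    simp [Series.single_apply, hq]

theorem Series.ball_mono {S S' : Set V} {T T' : Set W} {C C' : ℝ} (hS : S ⊆ S') (hT : T ⊆ T')
    (hC : C ≤ C') : Series.ball V W S T C ⊆ Series.ball V W S' T' C' :=
  fun _ h => ⟨h.1.mono hS hT, h.2.trans hC⟩

/-- A subset of the tensor product is small if it is contained in the image of a ball of
`ℓ¹(S × T)` for some small sets `S`, `T`. -/
instance : Bornology (BTensor V W R) :=
  Bornology.ofBounded {B | ∃ (S : Set V) (T : Set W) (C : ℝ), IsBounded S ∧ IsBounded T ∧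
      B ⊆ BTensor.mk R '' Series.ball V W S T C}
    ⟨∅, ∅, 0, isBounded_empty, isBounded_empty, Set.empty_subset _⟩
    (by
      rintro B ⟨S, T, C, hS, hT, h⟩ B' h'
      exact ⟨S, T, C, hS, hT, h'.trans h⟩)
    (by
      rintro B ⟨S, T, C, hS, hT, h⟩ B' ⟨S', T', C', hS', hT', h'⟩
      refine ⟨S ∪ S', T ∪ T', max C C', hS.union hS', hT.union hT', Set.union_subset
        (h.trans (Set.image_mono (Series.ball_mono ?_ ?_ ?_)))
        (h'.trans (Set.image_mono (Series.ball_mono ?_ ?_ ?_)))⟩ <;> simp)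
    (by
      intro x
      obtain ⟨a, rfl⟩ := (relators R).mkQ_surjective x
      obtain ⟨S, T, hS, hT, h⟩ := a.exists_suppIn
      exact ⟨S, T, a.norm, hS, hT, by
        rintro _ rfl
        exact ⟨a, ⟨h, le_rfl⟩, rfl⟩⟩)

theorem BTensor.isBounded_iff {B : Set (BTensor V W R)} :
    IsBounded B ↔ ∃ (S : Set V) (T : Set W) (C : ℝ), IsBounded S ∧ IsBounded T ∧
      B ⊆ BTensor.mk R '' Series.ball V W S T C := by
  exact Bornology.isBounded_ofBounded_iff _

theorem isClosedSub_relators : IsClosedSub (relators R) := by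
  intro S T hS hT u a hu hus has hlim
  rw [relators, Submodule.mem_sInf]
  intro M hM
  exact hM.1 S T hS hT u a (fun n => (Submodule.mem_sInf.1 (hu n)) M hM) hus has hlim

theorem Relator.mem {a : Series V W} (h : Relator R a) : a ∈ relators R := by
  rw [relators, Submodule.mem_sInf]
  exact fun M hM => hM.2 a h

theorem relators_le {M : Submodule ℂ (Series V W)} (hM : IsClosedSub M)
    (h : ∀ a, Relator R a → a ∈ M) : relators R ≤ M := sInf_le ⟨hM, h⟩

theorem BTensor.mk_eq_zero {a : Series V W} : BTensor.mk R a = 0 ↔ a ∈ relators R :=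
  Submodule.Quotient.mk_eq_zero _

theorem BTensor.mk_surjective : Function.Surjective (BTensor.mk (V := V) (W := W) R) :=
  (relators R).mkQ_surjective

variable (R) in
/-- The canonical bilinear map `(v, w) ↦ v ⊗ w`. -/
noncomputable def BTensor.tmul : V →ₗ[ℂ] W →ₗ[ℂ] BTensor V W R :=
  LinearMap.mk₂ ℂ (fun v w => BTensor.mk R (.single (v, w)))
    (fun v v' w => by
      rw [← sub_eq_zero, ← sub_sub, ← map_sub, ← map_sub, BTensor.mk_eq_zero]
      exact (Relator.add_left v v' w).mem)
    (fun c v w => by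
      rw [← sub_eq_zero, ← map_smul, ← map_sub, BTensor.mk_eq_zero]
      exact (Relator.smul_left c v w).mem)
    (fun v w w' => by
      rw [← sub_eq_zero, ← sub_sub, ← map_sub, ← map_sub, BTensor.mk_eq_zero]
      exact (Relator.add_right v w w').mem)
    (fun c v w => by
      rw [← sub_eq_zero, ← map_smul, ← map_sub, BTensor.mk_eq_zero]
      exact (Relator.smul_right c v w).mem)

theorem BTensor.tmul_def (v : V) (w : W) :
    BTensor.tmul R v w = BTensor.mk R (.single (v, w)) := rfl

theorem BTensor.bddBilin_tmul : BddBilin (BTensor.tmul (V := V) (W := W) R) := by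
  intro S T hS hT
  refine BTensor.isBounded_iff.2 ⟨S, T, 1, hS, hT, ?_⟩
  rintro _ ⟨v, hv, w, hw, rfl⟩
  exact ⟨_, ⟨Series.single_suppIn hv hw, (Series.single_norm _).le⟩, rfl⟩

theorem BTensor.tmul_rel {p q : V × W} (h : (p, q) ∈ R) :
    BTensor.tmul R p.1 p.2 = BTensor.tmul R q.1 q.2 := by
  rw [← sub_eq_zero, BTensor.tmul_def, BTensor.tmul_def, ← map_sub, BTensor.mk_eq_zero]
  exact (Relator.rel p q h).mem

/-- The closed subspace of `ℓ¹(V × W)` of families supported in `S × T`. -/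
def ellOne (S : Set V) (T : Set W) : Submodule ℂ (lp (fun _ : V × W => ℂ) 1) where
  carrier := {a | ∀ p, p ∉ S ×ˢ T → a p = 0}
  zero_mem' := fun _ _ => rfl
  add_mem' := by
    intro a b ha hb p hp
    rw [lp.coeFn_add, Pi.add_apply, ha p hp, hb p hp, add_zero]
  smul_mem' := by
    intro c a ha p hp
    rw [lp.coeFn_smul, Pi.smul_apply, ha p hp, smul_zero]

theorem isClosed_ellOne (S : Set V) (T : Set W) :
    IsClosed (ellOne S T : Set (lp (fun _ : V × W => ℂ) 1)) := by
  have : (ellOne S T : Set (lp (fun _ : V × W => ℂ) 1)) =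
      ⋂ p : V × W, ⋂ _ : p ∉ S ×ˢ T, {a | a p = 0} := by
    ext a
    simp only [Set.mem_iInter]
    rfl
  rw [this]
  refine isClosed_iInter fun p => isClosed_iInter fun _ => ?_
  refine isClosed_eq ?_ continuous_const
  have h1 : LipschitzWith 1 fun a : lp (fun _ : V × W => ℂ) 1 => a p := by
    refine LipschitzWith.of_dist_le_mul fun a b => ?_
    rw [dist_eq_norm, dist_eq_norm, NNReal.coe_one, one_mul]
    exact lp.norm_apply_le_norm one_ne_zero (a - b) p
  exact h1.continuous

/-- Elements of `ℓ¹(S × T)` as series. -/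
noncomputable def ofEllOne {S : Set V} {T : Set W} (hS : IsBounded S) (hT : IsBounded T) :
    ellOne S T →ₗ[ℂ] Series V W where
  toFun a := Subtype.mk (p := (· ∈ seriesSubmodule V W)) (fun p => a.1 p) ⟨by
    have := (memℓp_gen_iff (p := 1) (by simp)).1 (lp.memℓp a.1)
    simpa using this, S, T, hS, hT, fun p hp => by
      by_contra h
      exact hp (a.2 p h)⟩
  map_add' _ _ := rfl
  map_smul' _ _ := rfl

theorem norm_ofEllOne {S : Set V} {T : Set W} (hS : IsBounded S) (hT : IsBounded T)
    (a : ellOne S T) : (ofEllOne hS hT a).norm = ‖a‖ := by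
  have : ‖a‖ = ‖a.1‖ := rfl
  rw [this, lp.norm_eq_tsum_rpow (by simp)]
  simp only [ENNReal.toReal_one, Real.rpow_one, div_one]
  rfl

theorem suppIn_ofEllOne {S : Set V} {T : Set W} (hS : IsBounded S) (hT : IsBounded T)
    (a : ellOne S T) : (ofEllOne hS hT a).SuppIn S T := fun p hp => by
  by_contra h
  exact hp (a.2 p h)

theorem exists_ofEllOne {S : Set V} {T : Set W} (hS : IsBounded S) (hT : IsBounded T)
    (a : Series V W) (h : a.SuppIn S T) : ∃ x, ofEllOne hS hT x = a := by
  refine ⟨⟨⟨a.1, ?_⟩, fun p hp => ?_⟩, rfl⟩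
  · exact memℓp_gen (by simpa using a.summable)
  · by_contra h0
    exact hp (h p h0)

theorem isCompletant_mk_image {S : Set V} {T : Set W} (hS : IsBounded S) (hT : IsBounded T)
    {r : ℝ} (hr : 0 < r) :
    IsCompletant ((BTensor.mk R ∘ₗ ofEllOne hS hT) '' Metric.ball 0 r) := by
  have : IsClosed (ellOne S T : Set (lp (fun _ : V × W => ℂ) 1)) := isClosed_ellOne S T
  have : CompleteSpace (ellOne S T) := this.completeSpace_coe
  refine isCompletant_image_ball _ ?_ hr
  rw [← isSeqClosed_iff_isClosed]
  intro u a hu hlim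
  have hu' : ∀ n, ofEllOne hS hT (u n) ∈ relators R := fun n => BTensor.mk_eq_zero.1 (hu n)
  refine BTensor.mk_eq_zero.2 (isClosedSub_relators S T hS hT _ _ hu'
    (fun n => suppIn_ofEllOne hS hT _) (suppIn_ofEllOne hS hT _) ?_)
  rw [tendsto_iff_norm_sub_tendsto_zero] at hlim
  refine hlim.congr fun n => ?_
  rw [← map_sub, norm_ofEllOne]

theorem Series.isDisk_ball (S : Set V) (T : Set W) (C : ℝ) : IsDisk (Series.ball V W S T C) where
  balanced := by
    rintro c hc _ ⟨a, ha, rfl⟩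
    refine ⟨ha.1.smul c, ?_⟩
    change (c • a).norm ≤ C
    rw [Series.norm_smul]
    exact (mul_le_of_le_one_left a.norm_nonneg hc).trans ha.2
  convex := by
    intro a ha b hb s t hs ht hst
    have h1 : ∀ (r : ℝ) (c : Series V W), r • c = (r : ℂ) • c := fun r c =>
      (Complex.coe_smul r c).symm
    rw [h1, h1]
    refine ⟨(ha.1.smul _).add (hb.1.smul _), (Series.norm_add_le _ _).trans ?_⟩
    rw [Series.norm_smul, Series.norm_smul, Complex.norm_real, Complex.norm_real,
      Real.norm_of_nonneg hs, Real.norm_of_nonneg ht]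
    calc s * a.norm + t * b.norm ≤ s * C + t * C := by
          gcongr
          exacts [ha.2, hb.2]
      _ = C := by rw [← add_mul, hst, one_mul]

theorem IsDisk.image {X Y : Type u} [AddCommGroup X] [Module ℂ X] [AddCommGroup Y] [Module ℂ Y]
    {S : Set X} (hS : IsDisk S) (f : X →ₗ[ℂ] Y) : IsDisk (f '' S) where
  balanced := by
    rintro c hc _ ⟨_, ⟨x, hx, rfl⟩, rfl⟩
    exact ⟨c • x, hS.balanced.smul_mem hc hx, map_smul f c x⟩
  convex := hS.convex.linear_image (f.restrictScalars ℝ)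

instance : CompleteBornSpace (BTensor V W R) where
  isBounded_add B B' hB hB' := by
    obtain ⟨S, T, C, hS, hT, h⟩ := BTensor.isBounded_iff.1 hB
    obtain ⟨S', T', C', hS', hT', h'⟩ := BTensor.isBounded_iff.1 hB'
    refine BTensor.isBounded_iff.2 ⟨S ∪ S', T ∪ T', C + C', hS.union hS', hT.union hT', ?_⟩
    rintro _ ⟨x, hx, y, hy, rfl⟩
    obtain ⟨a, ha, rfl⟩ := h hx
    obtain ⟨b, hb, rfl⟩ := h' hy
    refine ⟨a + b, ⟨(ha.1.mono ?_ ?_).add (hb.1.mono ?_ ?_),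
      (Series.norm_add_le _ _).trans (add_le_add ha.2 hb.2)⟩, map_add _ _ _⟩ <;> simp
  isBounded_smul c B hB := by
    obtain ⟨S, T, C, hS, hT, h⟩ := BTensor.isBounded_iff.1 hB
    refine BTensor.isBounded_iff.2 ⟨S, T, ‖c‖ * C, hS, hT, ?_⟩
    rintro _ ⟨x, hx, rfl⟩
    obtain ⟨a, ha, rfl⟩ := h hx
    refine ⟨c • a, ⟨ha.1.smul c, ?_⟩, map_smul _ _ _⟩
    rw [Series.norm_smul]
    exact mul_le_mul_of_nonneg_left ha.2 (norm_nonneg c)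
  isBounded_hull B hB := by
    obtain ⟨S, T, C, hS, hT, h⟩ := BTensor.isBounded_iff.1 hB
    have hd := (Series.isDisk_ball S T C).image (BTensor.mk R)
    exact BTensor.isBounded_iff.2 ⟨S, T, C, hS, hT,
      convexHull_min (hd.balanced.balancedHull_subset_of_subset h) hd.convex⟩
  exists_completant B hB := by
    obtain ⟨S, T, C, hS, hT, h⟩ := BTensor.isBounded_iff.1 hB
    have hr : 0 < |C| + 1 := by positivity
    refine ⟨_, ?_, ?_, isCompletant_mk_image (R := R) hS hT hr⟩
    · intro x hx
      obtain ⟨a, ha, rfl⟩ := h hx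
      obtain ⟨y, rfl⟩ := exists_ofEllOne hS hT a ha.1
      refine ⟨y, ?_, rfl⟩
      rw [mem_ball_zero_iff, ← norm_ofEllOne hS hT]
      linarith [ha.2, le_abs_self C]
    · refine BTensor.isBounded_iff.2 ⟨S, T, |C| + 1, hS, hT, ?_⟩
      rintro _ ⟨y, hy, rfl⟩
      refine ⟨ofEllOne hS hT y, ⟨suppIn_ofEllOne hS hT y, ?_⟩, rfl⟩
      rw [norm_ofEllOne]
      exact (mem_ball_zero_iff.1 hy).le

end Tensor

section Lift

variable {V W X : Type u} [AddCommGroup V] [Module ℂ V] [Bornology V]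
  [AddCommGroup W] [Module ℂ W] [Bornology W] [AddCommGroup X] [Module ℂ X] [Bornology X]

/-- The series `∑ a (v, w) • b v w` converges to `x` in the Banach space spanned by some small
completant disk of `X`. -/
def SeriesSum (b : V →ₗ[ℂ] W →ₗ[ℂ] X) (a : Series V W) (x : X) : Prop :=
  ∃ D : Set X, IsBounded D ∧ D.Nonempty ∧ IsCompletant D ∧ x ∈ Submodule.span ℂ D ∧
    (∀ p, a.1 p ≠ 0 → b p.1 p.2 ∈ Submodule.span ℂ D) ∧
    Tendsto (fun s : Finset (V × W) => gauge D ((∑ p ∈ s, a.1 p • b p.1 p.2) - x)) atTop (𝓝 0)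

theorem sum_mem_span {b : V →ₗ[ℂ] W →ₗ[ℂ] X} {a : Series V W} {D : Set X}
    (h : ∀ p, a.1 p ≠ 0 → b p.1 p.2 ∈ Submodule.span ℂ D) (s : Finset (V × W)) :
    ∑ p ∈ s, a.1 p • b p.1 p.2 ∈ Submodule.span ℂ D :=
  Submodule.sum_mem _ fun p _ => by
    by_cases h0 : a.1 p = 0
    · simp [h0]
    · exact Submodule.smul_mem _ _ (h p h0)

variable [CompleteBornSpace X]

theorem CompleteBornSpace.exists_completant' {S : Set X} (hS : IsBounded S) :
    ∃ T, S ⊆ T ∧ T.Nonempty ∧ IsBounded T ∧ IsCompletant T := by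
  obtain ⟨T, h1, h2, h3⟩ := CompleteBornSpace.exists_completant (S ∪ {0})
    (hS.union isBounded_singleton)
  exact ⟨T, Set.subset_union_left.trans h1, ⟨0, h1 (by simp)⟩, h2, h3⟩

theorem SeriesSum.mono {b : V →ₗ[ℂ] W →ₗ[ℂ] X} {a : Series V W} {x : X} {D D' : Set X}
    (hD : D.Nonempty) (hDc : IsCompletant D) (hDD : D ⊆ D')
    (hx : x ∈ Submodule.span ℂ D) (h : ∀ p, a.1 p ≠ 0 → b p.1 p.2 ∈ Submodule.span ℂ D)
    (hl : Tendsto (fun s : Finset (V × W) => gauge D ((∑ p ∈ s, a.1 p • b p.1 p.2) - x)) atTop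
      (𝓝 0)) :
    Tendsto (fun s : Finset (V × W) => gauge D' ((∑ p ∈ s, a.1 p • b p.1 p.2) - x)) atTop
      (𝓝 0) :=
  squeeze_zero (fun _ => gauge_nonneg _) (fun s => hDc.toIsDisk.gauge_le_mul_of_subset hD hDD
    (Submodule.sub_mem _ (sum_mem_span h s) hx)) hl

theorem SeriesSum.unique {b : V →ₗ[ℂ] W →ₗ[ℂ] X} {a : Series V W} {x y : X}
    (hx : SeriesSum b a x) (hy : SeriesSum b a y) : x = y := by
  obtain ⟨D, hD, hDn, hDc, hxD, hb, hl⟩ := hx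
  obtain ⟨D', hD', hDn', hDc', hyD, hb', hl'⟩ := hy
  obtain ⟨E, hDE, hEn, hE, hEc⟩ := CompleteBornSpace.exists_completant' (hD.union hD')
  have h1 := Set.subset_union_left.trans hDE
  have h2 := Set.subset_union_right.trans hDE
  have m := SeriesSum.mono hDn hDc h1 hxD hb hl
  have m' := SeriesSum.mono hDn' hDc' h2 hyD hb' hl'
  have hxE := Submodule.span_mono (R := ℂ) h1 hxD
  have hyE := Submodule.span_mono (R := ℂ) h2 hyD
  rw [← sub_eq_zero]
  refine hEc.eq_zero _ (Submodule.sub_mem _ hxE hyE) ?_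
  refine le_antisymm ?_ (gauge_nonneg _)
  have := m.add m'
  rw [add_zero] at this
  refine ge_of_tendsto' this fun s => ?_
  have hs := Submodule.span_mono (R := ℂ) h1 (sum_mem_span hb s)
  have e : x - y = -((∑ p ∈ s, a.1 p • b p.1 p.2) - x) + ((∑ p ∈ s, a.1 p • b p.1 p.2) - y) := by
    abel
  rw [e]
  refine (hEc.toIsDisk.gauge_add_le hEn ?_ ?_).trans ?_
  · exact Submodule.neg_mem _ (Submodule.sub_mem _ hs hxE)
  · exact Submodule.sub_mem _ hs hyE
  · rw [hEc.toIsDisk.gauge_neg]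

theorem SeriesSum.exists_of_subset {b : V →ₗ[ℂ] W →ₗ[ℂ] X} {a : Series V W} {S : Set V}
    {T : Set W} (ha : a.SuppIn S T) {D : Set X} (hD : IsBounded D) (hDn : D.Nonempty)
    (hDc : IsCompletant D) (h : ∀ v ∈ S, ∀ w ∈ T, b v w ∈ D) :
    ∃ x, SeriesSum b a x ∧ x ∈ Submodule.span ℂ D ∧ gauge D x ≤ a.norm := by
  have h' : ∀ p, a.1 p ≠ 0 → b p.1 p.2 ∈ D := fun p hp => h _ (ha p hp).1 _ (ha p hp).2
  obtain ⟨y, hy, hy', hl⟩ := hDc.exists_sum hDn a.1 (fun p => b p.1 p.2) h' a.summable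
  exact ⟨y, ⟨D, hD, hDn, hDc, hy, fun p hp => Submodule.subset_span (h' p hp), hl⟩, hy, hy'⟩

theorem SeriesSum.exists {b : V →ₗ[ℂ] W →ₗ[ℂ] X} (hb : BddBilin b) (a : Series V W) :
    ∃ x, SeriesSum b a x := by
  obtain ⟨S, T, hS, hT, h⟩ := a.exists_suppIn
  obtain ⟨D, hD1, hD2, hD3, hD4⟩ := CompleteBornSpace.exists_completant' (hb S T hS hT)
  obtain ⟨x, hx, _⟩ := SeriesSum.exists_of_subset h hD3 hD2 hD4
    (fun v hv w hw => hD1 ⟨v, hv, w, hw, rfl⟩)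
  exact ⟨x, hx⟩

theorem SeriesSum.add {b : V →ₗ[ℂ] W →ₗ[ℂ] X} {a a' : Series V W} {x x' : X}
    (hx : SeriesSum b a x) (hx' : SeriesSum b a' x') : SeriesSum b (a + a') (x + x') := by
  obtain ⟨D, hD, hDn, hDc, hxD, hb, hl⟩ := hx
  obtain ⟨D', hD', hDn', hDc', hyD, hb', hl'⟩ := hx'
  obtain ⟨E, hDE, hEn, hE, hEc⟩ := CompleteBornSpace.exists_completant' (hD.union hD')
  have h1 := Set.subset_union_left.trans hDE
  have h2 := Set.subset_union_right.trans hDE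
  have m := SeriesSum.mono hDn hDc h1 hxD hb hl
  have m' := SeriesSum.mono hDn' hDc' h2 hyD hb' hl'
  have hxE := Submodule.span_mono (R := ℂ) h1 hxD
  have hyE := Submodule.span_mono (R := ℂ) h2 hyD
  refine ⟨E, hE, hEn, hEc, Submodule.add_mem _ hxE hyE, fun p hp => ?_, ?_⟩
  · by_cases h0 : a.1 p = 0
    · refine Submodule.span_mono (R := ℂ) h2 (hb' p fun h3 => hp ?_)
      change a.1 p + a'.1 p = 0
      rw [h0, h3, add_zero]
    · exact Submodule.span_mono (R := ℂ) h1 (hb p h0)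
  · have := m.add m'
    rw [add_zero] at this
    refine squeeze_zero (fun _ => gauge_nonneg _) (fun s => ?_) this
    have e : (∑ p ∈ s, (a + a').1 p • b p.1 p.2) - (x + x') =
        ((∑ p ∈ s, a.1 p • b p.1 p.2) - x) + ((∑ p ∈ s, a'.1 p • b p.1 p.2) - x') := by
      have : ∀ p, (a + a').1 p = a.1 p + a'.1 p := fun p => rfl
      simp only [this, add_smul, Finset.sum_add_distrib]
      abel
    rw [e]
    exact hEc.toIsDisk.gauge_add_le hEn
      (Submodule.sub_mem _ (Submodule.span_mono (R := ℂ) h1 (sum_mem_span hb s)) hxE)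
      (Submodule.sub_mem _ (Submodule.span_mono (R := ℂ) h2 (sum_mem_span hb' s)) hyE)

theorem SeriesSum.smul {b : V →ₗ[ℂ] W →ₗ[ℂ] X} {a : Series V W} {x : X} (c : ℂ)
    (hx : SeriesSum b a x) : SeriesSum b (c • a) (c • x) := by
  obtain ⟨D, hD, hDn, hDc, hxD, hb, hl⟩ := hx
  have e : ∀ p, (c • a).1 p = c * a.1 p := fun p => rfl
  refine ⟨D, hD, hDn, hDc, Submodule.smul_mem _ _ hxD, fun p hp => hb p fun h0 => hp ?_, ?_⟩
  · rw [e, h0, mul_zero]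
  · have := hl.const_mul ‖c‖
    rw [mul_zero] at this
    refine this.congr fun s => ?_
    rw [← hDc.toIsDisk.gauge_smul, smul_sub, Finset.smul_sum]
    simp only [e, mul_smul]

theorem SeriesSum.single (b : V →ₗ[ℂ] W →ₗ[ℂ] X) (p : V × W) :
    SeriesSum b (Series.single p) (b p.1 p.2) := by
  classical
  obtain ⟨D, hD1, hD2, hD3, hD4⟩ := CompleteBornSpace.exists_completant'
    (isBounded_singleton (x := b p.1 p.2))
  have hm := Submodule.subset_span (R := ℂ) (hD1 rfl)
  refine ⟨D, hD3, hD2, hD4, hm, fun q hq => ?_, ?_⟩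
  · rw [Series.single_apply] at hq
    have : q = p := by
      by_contra h
      simp [h] at hq
    rwa [this]
  · refine tendsto_const_nhds.congr' ?_
    filter_upwards [eventually_ge_atTop {p}] with s hs
    have hp : p ∈ s := hs (by simp)
    simp [Series.single_apply, Finset.sum_ite_eq', hp]

/-- Evaluation of series on a bounded bilinear map. -/
noncomputable def preLift (b : V →ₗ[ℂ] W →ₗ[ℂ] X) (hb : BddBilin b) : Series V W →ₗ[ℂ] X where
  toFun a := (SeriesSum.exists hb a).choose
  map_add' a a' := ((SeriesSum.exists hb (a + a')).choose_spec).unique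
    (((SeriesSum.exists hb a).choose_spec).add (SeriesSum.exists hb a').choose_spec)
  map_smul' c a := ((SeriesSum.exists hb (c • a)).choose_spec).unique
    (((SeriesSum.exists hb a).choose_spec).smul c)

theorem preLift_eq {b : V →ₗ[ℂ] W →ₗ[ℂ] X} (hb : BddBilin b) {a : Series V W} {x : X}
    (h : SeriesSum b a x) : preLift b hb a = x :=
  ((SeriesSum.exists hb a).choose_spec).unique h

theorem preLift_single {b : V →ₗ[ℂ] W →ₗ[ℂ] X} (hb : BddBilin b) (p : V × W) :
    preLift b hb (.single p) = b p.1 p.2 := preLift_eq hb (SeriesSum.single b p)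

theorem preLift_mem {b : V →ₗ[ℂ] W →ₗ[ℂ] X} (hb : BddBilin b) {a : Series V W} {S : Set V}
    {T : Set W} (ha : a.SuppIn S T) {D : Set X} (hD : IsBounded D) (hDn : D.Nonempty)
    (hDc : IsCompletant D) (h : ∀ v ∈ S, ∀ w ∈ T, b v w ∈ D) :
    preLift b hb a ∈ Submodule.span ℂ D ∧ gauge D (preLift b hb a) ≤ a.norm := by
  obtain ⟨x, hx, h1, h2⟩ := SeriesSum.exists_of_subset ha hD hDn hDc h
  rw [preLift_eq hb hx]
  exact ⟨h1, h2⟩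

/-- A linear map on series which maps the balls of `ℓ¹(S × T)` to small sets has closed kernel. -/
theorem isClosedSub_ker (f : Series V W →ₗ[ℂ] X) (hf : ∀ (S : Set V) (T : Set W), IsBounded S →
    IsBounded T → ∃ D : Set X, D.Nonempty ∧ IsCompletant D ∧
      ∀ a : Series V W, a.SuppIn S T → f a ∈ Submodule.span ℂ D ∧ gauge D (f a) ≤ a.norm) :
    IsClosedSub (LinearMap.ker f) := by
  intro S T hS hT u a hu hus has hlim
  obtain ⟨D, hDn, hDc, h⟩ := hf S T hS hT
  refine hDc.eq_zero _ (h a has).1 (le_antisymm ?_ (gauge_nonneg _))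
  refine ge_of_tendsto' hlim fun n => ?_
  have h1 := (h _ ((hus n).sub has)).2
  have h2 : f (u n) = 0 := hu n
  rwa [map_sub, h2, zero_sub, hDc.toIsDisk.gauge_neg] at h1

theorem isClosedSub_ker_preLift (b : V →ₗ[ℂ] W →ₗ[ℂ] X) (hb : BddBilin b) :
    IsClosedSub (LinearMap.ker (preLift b hb)) := by
  refine isClosedSub_ker _ fun S T hS hT => ?_
  obtain ⟨D, hD1, hD2, hD3, hD4⟩ := CompleteBornSpace.exists_completant' (hb S T hS hT)
  exact ⟨D, hD2, hD4, fun a ha => preLift_mem hb ha hD3 hD2 hD4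
    (fun v hv w hw => hD1 ⟨v, hv, w, hw, rfl⟩)⟩

variable {R : Set ((V × W) × (V × W))}

theorem relators_le_ker_preLift (b : V →ₗ[ℂ] W →ₗ[ℂ] X) (hb : BddBilin b)
    (hR : ∀ p q, (p, q) ∈ R → b p.1 p.2 = b q.1 q.2) :
    relators R ≤ LinearMap.ker (preLift b hb) := by
  refine relators_le (isClosedSub_ker_preLift b hb) fun a ha => ?_
  rw [LinearMap.mem_ker]
  cases ha with
  | rel p q h => simp [preLift_single, hR p q h]
  | _ => simp [preLift_single]

/-- The linear map on the tensor product induced by a bounded bilinear map compatible with the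
relations. -/
noncomputable def BTensor.lift (b : V →ₗ[ℂ] W →ₗ[ℂ] X) (hb : BddBilin b)
    (hR : ∀ p q, (p, q) ∈ R → b p.1 p.2 = b q.1 q.2) : BTensor V W R →ₗ[ℂ] X :=
  (relators R).liftQ (preLift b hb) (relators_le_ker_preLift b hb hR)

theorem BTensor.lift_mk {b : V →ₗ[ℂ] W →ₗ[ℂ] X} (hb : BddBilin b)
    (hR : ∀ p q, (p, q) ∈ R → b p.1 p.2 = b q.1 q.2) (a : Series V W) :
    BTensor.lift b hb hR (BTensor.mk R a) = preLift b hb a := rfl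

@[simp]
theorem BTensor.lift_tmul {b : V →ₗ[ℂ] W →ₗ[ℂ] X} (hb : BddBilin b)
    (hR : ∀ p q, (p, q) ∈ R → b p.1 p.2 = b q.1 q.2) (v : V) (w : W) :
    BTensor.lift b hb hR (BTensor.tmul R v w) = b v w :=
  preLift_single hb (v, w)

theorem BTensor.lift_mem {b : V →ₗ[ℂ] W →ₗ[ℂ] X} (hb : BddBilin b)
    (hR : ∀ p q, (p, q) ∈ R → b p.1 p.2 = b q.1 q.2) {S : Set V} {T : Set W} {C : ℝ}
    {D : Set X} (hD : IsBounded D) (hDn : D.Nonempty) (hDc : IsCompletant D)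
    (h : ∀ v ∈ S, ∀ w ∈ T, b v w ∈ D) {x : BTensor V W R}
    (hx : x ∈ BTensor.mk R '' Series.ball V W S T C) :
    BTensor.lift b hb hR x ∈ (C + 1) • D := by
  obtain ⟨a, ha, rfl⟩ := hx
  rw [BTensor.lift_mk]
  have := preLift_mem hb ha.1 hD hDn hDc h
  exact hDc.toIsDisk.mem_smul_of_gauge_lt hDn this.1 (by linarith [this.2, ha.2])

theorem BTensor.bddLin_lift {b : V →ₗ[ℂ] W →ₗ[ℂ] X} (hb : BddBilin b)
    (hR : ∀ p q, (p, q) ∈ R → b p.1 p.2 = b q.1 q.2) : BddLin (BTensor.lift b hb hR) := by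
  intro B hB
  obtain ⟨S, T, C, hS, hT, h⟩ := BTensor.isBounded_iff.1 hB
  obtain ⟨D, hD1, hD2, hD3, hD4⟩ := CompleteBornSpace.exists_completant' (hb S T hS hT)
  refine (CompleteBornSpace.isBounded_real_smul (C + 1) hD3).subset ?_
  rintro _ ⟨x, hx, rfl⟩
  exact BTensor.lift_mem hb hR hD3 hD2 hD4 (fun v hv w hw => hD1 ⟨v, hv, w, hw, rfl⟩) (h hx)

/-- The restriction of a series to a finite set of indices is a linear combination of single
terms, and these restrictions approximate the series. -/
theorem Series.exists_approx (a : Series V W) {S : Set V} {T : Set W} (ha : a.SuppIn S T) :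
    ∃ u : ℕ → Series V W, (∀ n, u n ∈ Submodule.span ℂ (Set.range Series.single)) ∧
      (∀ n, (u n).SuppIn S T) ∧ Tendsto (fun n => (u n - a).norm) atTop (𝓝 0) := by
  classical
  have key : ∀ s : Finset (V × W), ∀ q, (∑ p ∈ s, a.1 p • Series.single p : Series V W).1 q =
      if q ∈ s then a.1 q else 0 := by
    intro s q
    induction s using Finset.induction_on with
    | empty => rfl
    | insert p s hp ih =>
      rw [Finset.sum_insert hp]
      change a.1 p * (Series.single p).1 q + _ = _
      rw [ih, Series.single_apply]
      by_cases h1 : q = p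
      · subst h1
        simp [hp]
      · simp [h1]
  have hn : ∀ ε > 0, ∃ s : Finset (V × W),
      (∑ p ∈ s, a.1 p • Series.single p - a).norm < ε := by
    intro ε hε
    have h1 := a.summable.hasSum
    have h2 := (tendsto_order.1 h1).1 (∑' p, ‖a.1 p‖ - ε) (by linarith)
    obtain ⟨s, hs⟩ := h2.exists
    refine ⟨s, ?_⟩
    have h3 : (∑ p ∈ s, a.1 p • Series.single p - a).norm + ∑ p ∈ s, ‖a.1 p‖ = ∑' p, ‖a.1 p‖ := by
      have e1 : ∑ p ∈ s, ‖a.1 p‖ = ∑' p, if p ∈ s then ‖a.1 p‖ else 0 := by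
        rw [tsum_eq_sum (s := s)]
        · exact Finset.sum_congr rfl fun p hp => by simp [hp]
        · intro p hp
          simp [hp]
      rw [e1]
      unfold Series.norm
      rw [← Summable.tsum_add (Series.summable _)]
      · refine tsum_congr fun p => ?_
        change ‖(∑ p ∈ s, a.1 p • Series.single p : Series V W).1 p - a.1 p‖ + _ = _
        rw [key]
        by_cases hp : p ∈ s <;> simp [hp]
      · exact summable_of_ne_finset_zero (s := s) fun p hp => by simp [hp]
    linarith
  choose s hs using fun n : ℕ => hn (1 / ((n : ℝ) + 1)) (by positivity)
  refine ⟨fun n => ∑ p ∈ s n, a.1 p • Series.single p, fun n => ?_, fun n q hq => ?_, ?_⟩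
  · exact Submodule.sum_mem _ fun p _ => Submodule.smul_mem _ _ (Submodule.subset_span ⟨p, rfl⟩)
  · rw [key] at hq
    exact ha q fun h => hq (by simp [h])
  · exact squeeze_zero (fun n => Series.norm_nonneg _) (fun n => (hs n).le)
      tendsto_one_div_add_atTop_nhds_zero_nat

/-- Bounded linear maps on the tensor product are determined by their values on elementary
tensors. -/
theorem BTensor.ext {f g : BTensor V W R →ₗ[ℂ] X} (hf : BddLin f) (hg : BddLin g)
    (h : ∀ v w, f (BTensor.tmul R v w) = g (BTensor.tmul R v w)) : f = g := by
  have hcl : IsClosedSub (LinearMap.ker ((f - g) ∘ₗ BTensor.mk R)) := by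
    refine isClosedSub_ker _ fun S T hS hT => ?_
    have hB : IsBounded (BTensor.mk R '' Series.ball V W S T 1) :=
      BTensor.isBounded_iff.2 ⟨S, T, 1, hS, hT, subset_rfl⟩
    have hfg := CompleteBornSpace.isBounded_add _ _ (hf _ hB)
      (CompleteBornSpace.isBounded_smul (-1) _ (hg _ hB))
    obtain ⟨D, hD1, hD2, hD3, hD4⟩ := CompleteBornSpace.exists_completant' hfg
    have hD : ∀ a : Series V W, a.SuppIn S T → a.norm ≤ 1 → (f - g) (BTensor.mk R a) ∈ D := by
      intro a ha ha'
      refine hD1 ⟨_, ⟨_, ⟨a, ⟨ha, ha'⟩, rfl⟩, rfl⟩, _, ⟨_, ⟨_, ⟨a, ⟨ha, ha'⟩, rfl⟩, rfl⟩, rfl⟩, ?_⟩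
      simp [sub_eq_add_neg]
    have hr : ∀ a : Series V W, a.SuppIn S T → ∀ r : ℝ, a.norm < r →
        (f - g) (BTensor.mk R a) ∈ r • D := by
      intro a ha r hr
      have hr0 : 0 < r := a.norm_nonneg.trans_lt hr
      have hc : (r : ℂ) ≠ 0 := by exact_mod_cast hr0.ne'
      refine ⟨_, hD (((r : ℂ)⁻¹) • a) (ha.smul _) ?_, ?_⟩
      · rw [Series.norm_smul, norm_inv, Complex.norm_real, Real.norm_of_nonneg hr0.le,
          inv_mul_le_iff₀ hr0]
        linarith
      · change r • _ = _
        rw [map_smul, map_smul, ← Complex.coe_smul, smul_smul, mul_inv_cancel₀ hc, one_smul]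
    refine ⟨D, hD2, hD4, fun a ha => ⟨mem_span_of_mem_smul (hr a ha (a.norm + 1) (by linarith)),
      le_of_forall_pos_le_add fun ε hε => ?_⟩⟩
    exact gauge_le_of_mem (by linarith [a.norm_nonneg]) (hr a ha (a.norm + ε) (by linarith))
  have hs : Submodule.span ℂ (Set.range Series.single) ≤
      LinearMap.ker ((f - g) ∘ₗ BTensor.mk R) := by
    rw [Submodule.span_le]
    rintro _ ⟨p, rfl⟩
    have := h p.1 p.2
    rw [BTensor.tmul_def] at this
    simp [this]
  refine LinearMap.ext fun x => ?_
  obtain ⟨a, rfl⟩ := BTensor.mk_surjective x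
  obtain ⟨S, T, hS, hT, ha⟩ := a.exists_suppIn
  obtain ⟨u, hu, hus, hlim⟩ := a.exists_approx ha
  have := hcl S T hS hT u a (fun n => hs (hu n)) hus ha hlim
  simpa [sub_eq_zero] using this

end Lift

section Constructions

variable {A B C D P X : Type u} [AddCommGroup A] [Module ℂ A] [Bornology A]
  [AddCommGroup B] [Module ℂ B] [Bornology B] [AddCommGroup C] [Module ℂ C] [Bornology C]
  [AddCommGroup D] [Module ℂ D] [Bornology D] [AddCommGroup P] [Module ℂ P] [Bornology P]
  [AddCommGroup X] [Module ℂ X] [Bornology X]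

theorem BddLin.comp {f : A →ₗ[ℂ] B} {g : B →ₗ[ℂ] C} (hg : BddLin g) (hf : BddLin f) :
    BddLin (g ∘ₗ f) := fun S hS => by
  rw [LinearMap.coe_comp, Set.image_comp]
  exact hg _ (hf _ hS)

theorem BddLin.id : BddLin (LinearMap.id : A →ₗ[ℂ] A) := fun S hS => by simpa using hS

theorem BddBilin.left {b : A →ₗ[ℂ] B →ₗ[ℂ] X} (hb : BddBilin b) (x : A) : BddLin (b x) :=
  fun S hS => (hb {x} S isBounded_singleton hS).subset (by simp)

theorem BddBilin.right {b : A →ₗ[ℂ] B →ₗ[ℂ] X} (hb : BddBilin b) (y : B) : BddLin (b.flip y) :=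
  fun S hS => (hb S {y} hS isBounded_singleton).subset (by
    rintro _ ⟨x, hx, rfl⟩
    exact ⟨x, hx, y, rfl, rfl⟩)

theorem BddBilin.compl {b : A →ₗ[ℂ] B →ₗ[ℂ] X} (hb : BddBilin b) {f : C →ₗ[ℂ] A}
    {g : D →ₗ[ℂ] B} (hf : BddLin f) (hg : BddLin g) : BddBilin (b.compl₁₂ f g) := by
  intro S T hS hT
  refine (hb _ _ (hf S hS) (hg T hT)).subset ?_
  rintro _ ⟨x, hx, y, hy, rfl⟩
  exact ⟨f x, ⟨x, hx, rfl⟩, g y, ⟨y, hy, rfl⟩, rfl⟩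

theorem BddBilin.comp {b : A →ₗ[ℂ] B →ₗ[ℂ] X} (hb : BddBilin b) {f : X →ₗ[ℂ] P}
    (hf : BddLin f) : BddBilin (b.compr₂ f) := by
  intro S T hS hT
  refine (hf _ (hb S T hS hT)).subset ?_
  rintro _ ⟨x, hx, y, hy, rfl⟩
  exact ⟨_, ⟨x, hx, y, hy, rfl⟩, rfl⟩

/-- The elementary tensor `a ⊗ b` in the completed tensor product. -/
noncomputable abbrev tm (a : A) (b : B) : CTensor A B := BTensor.tmul ∅ a b

/-- The map `f ⊗ g` between completed tensor products. -/
noncomputable def tmap (f : A →ₗ[ℂ] C) (g : B →ₗ[ℂ] D) (hf : BddLin f) (hg : BddLin g) :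
    CTensor A B →ₗ[ℂ] CTensor C D :=
  BTensor.lift ((BTensor.tmul ∅).compl₁₂ f g) (BTensor.bddBilin_tmul.compl hf hg)
    (fun _ _ h => h.elim)

@[simp]
theorem tmap_tm (f : A →ₗ[ℂ] C) (g : B →ₗ[ℂ] D) (hf : BddLin f) (hg : BddLin g) (a : A) (b : B) :
    tmap f g hf hg (tm a b) = tm (f a) (g b) := BTensor.lift_tmul _ _ _ _

theorem bddLin_tmap (f : A →ₗ[ℂ] C) (g : B →ₗ[ℂ] D) (hf : BddLin f) (hg : BddLin g) :
    BddLin (tmap f g hf hg) := BTensor.bddLin_lift _ _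

theorem BddLin.add [CompleteBornSpace B] {f g : A →ₗ[ℂ] B} (hf : BddLin f) (hg : BddLin g) :
    BddLin (f + g) := fun S hS => by
  refine (CompleteBornSpace.isBounded_add _ _ (hf S hS) (hg S hS)).subset ?_
  rintro _ ⟨x, hx, rfl⟩
  exact ⟨f x, ⟨x, hx, rfl⟩, g x, ⟨x, hx, rfl⟩, rfl⟩

theorem BddLin.smul [CompleteBornSpace B] {f : A →ₗ[ℂ] B} (c : ℂ) (hf : BddLin f) :
    BddLin (c • f) := fun S hS => by
  refine (CompleteBornSpace.isBounded_smul c _ (hf S hS)).subset ?_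
  rintro _ ⟨x, hx, rfl⟩
  exact ⟨f x, ⟨x, hx, rfl⟩, rfl⟩

/-- Bounded trilinear maps. -/
def BddTrilin (t : A →ₗ[ℂ] B →ₗ[ℂ] P →ₗ[ℂ] X) : Prop :=
  ∀ (S : Set A) (T : Set B) (U : Set P), IsBounded S → IsBounded T → IsBounded U →
    IsBounded {x | ∃ a ∈ S, ∃ b ∈ T, ∃ p ∈ U, t a b p = x}

theorem BddTrilin.bddBilin {t : A →ₗ[ℂ] B →ₗ[ℂ] P →ₗ[ℂ] X} (ht : BddTrilin t) (p : P) :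
    BddBilin (t.compr₂ (LinearMap.applyₗ p)) := by
  intro S T hS hT
  refine (ht S T {p} hS hT isBounded_singleton).subset ?_
  rintro _ ⟨a, ha, b, hb, rfl⟩
  exact ⟨a, ha, b, hb, p, rfl, rfl⟩

variable [CompleteBornSpace X]

/-- The bilinear map `(a ⊗ b, p) ↦ t a b p` induced by a bounded trilinear map `t`. -/
noncomputable def liftTri (t : A →ₗ[ℂ] B →ₗ[ℂ] P →ₗ[ℂ] X) (ht : BddTrilin t) :
    CTensor A B →ₗ[ℂ] P →ₗ[ℂ] X :=
  LinearMap.flip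
    { toFun := fun p => BTensor.lift (t.compr₂ (LinearMap.applyₗ p)) (ht.bddBilin p)
        (fun _ _ h => h.elim)
      map_add' := fun p q => BTensor.ext (BTensor.bddLin_lift _ _)
        ((BTensor.bddLin_lift _ _).add (BTensor.bddLin_lift _ _)) (fun a b => by simp)
      map_smul' := fun c p => BTensor.ext (BTensor.bddLin_lift _ _)
        ((BTensor.bddLin_lift _ _).smul c) (fun a b => by simp) }

@[simp]
theorem liftTri_tm (t : A →ₗ[ℂ] B →ₗ[ℂ] P →ₗ[ℂ] X) (ht : BddTrilin t) (a : A) (b : B) (p : P) :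
    liftTri t ht (tm a b) p = t a b p :=
  BTensor.lift_tmul (R := ∅) (ht.bddBilin p) (fun _ _ h => h.elim) a b

theorem bddBilin_liftTri (t : A →ₗ[ℂ] B →ₗ[ℂ] P →ₗ[ℂ] X) (ht : BddTrilin t) :
    BddBilin (liftTri t ht) := by
  intro U T hU hT
  obtain ⟨S, S', c, hS, hS', h⟩ := BTensor.isBounded_iff.1 hU
  obtain ⟨D, hD1, hD2, hD3, hD4⟩ := CompleteBornSpace.exists_completant' (ht S S' T hS hS' hT)
  refine (CompleteBornSpace.isBounded_real_smul (c + 1) hD3).subset ?_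
  rintro _ ⟨x, hx, p, hp, rfl⟩
  exact BTensor.lift_mem (ht.bddBilin p) (fun _ _ h => h.elim) hD3 hD2 hD4
    (fun v hv w hw => hD1 ⟨v, hv, w, hw, p, hp, rfl⟩) (h hx)

/-- Uniform boundedness of `f ⊗ g` for `f`, `g` in equibounded sets. -/
theorem tmap_mem {S : Set A} {T : Set B} {U : Set C} {U' : Set D} {c : ℝ}
    (hU : IsBounded U) (hU' : IsBounded U') :
    ∃ E : Set (CTensor C D), IsBounded E ∧ ∀ (f : A →ₗ[ℂ] C) (g : B →ₗ[ℂ] D) (hf : BddLin f)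
      (hg : BddLin g), (∀ a ∈ S, f a ∈ U) → (∀ b ∈ T, g b ∈ U') →
      ∀ x ∈ BTensor.mk ∅ '' Series.ball A B S T c, tmap f g hf hg x ∈ E := by
  obtain ⟨E, hE1, hE2, hE3, hE4⟩ := CompleteBornSpace.exists_completant'
    (BTensor.bddBilin_tmul (R := ∅) U U' hU hU')
  refine ⟨(c + 1) • E, CompleteBornSpace.isBounded_real_smul _ hE3, fun f g hf hg h h' x hx => ?_⟩
  exact BTensor.lift_mem _ _ hE3 hE2 hE4
    (fun v hv w hw => hE1 ⟨f v, h v hv, g w, h' w hw, rfl⟩) hx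

variable (A B C) in
/-- The trilinear map `(a, b, c) ↦ a ⊗ (b ⊗ c)`. -/
noncomputable def assocTri : A →ₗ[ℂ] B →ₗ[ℂ] C →ₗ[ℂ] CTensor A (CTensor B C) :=
  LinearMap.mk₂ ℂ (fun a b => (BTensor.tmul ∅ a) ∘ₗ (BTensor.tmul ∅ b : C →ₗ[ℂ] CTensor B C))
    (fun a a' b => by ext; simp) (fun c a b => by ext; simp)
    (fun a b b' => by ext; simp) (fun c a b => by ext; simp)

theorem bddTrilin_assocTri : BddTrilin (assocTri A B C) := by
  intro S T U hS hT hU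
  refine (BTensor.bddBilin_tmul S _ hS (BTensor.bddBilin_tmul T U hT hU)).subset ?_
  rintro _ ⟨a, ha, b, hb, p, hp, rfl⟩
  exact ⟨a, ha, _, ⟨b, hb, p, hp, rfl⟩, rfl⟩

variable (A B C) in
/-- The associativity map `(a ⊗ b) ⊗ c ↦ a ⊗ (b ⊗ c)`. -/
noncomputable def assocMap : CTensor (CTensor A B) C →ₗ[ℂ] CTensor A (CTensor B C) :=
  BTensor.lift (liftTri (assocTri A B C) bddTrilin_assocTri) (bddBilin_liftTri _ _)
    (fun _ _ h => h.elim)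

@[simp]
theorem assocMap_tm (a : A) (b : B) (c : C) :
    assocMap A B C (tm (tm a b) c) = tm a (tm b c) := by
  rw [assocMap, BTensor.lift_tmul, liftTri_tm]
  rfl

theorem bddBilin_smul_right [CompleteBornSpace A] {φ : B →ₗ[ℂ] ℂ} (hφ : BddLin φ) :
    BddBilin ((LinearMap.lsmul ℂ A).flip.compl₂ φ) := by
  intro S T hS hT
  obtain ⟨r, hr⟩ := (hφ T hT).exists_norm_le
  refine (CompleteBornSpace.isBounded_smul (r : ℂ) _
    (CompleteBornSpace.isBounded_hull S hS)).subset ?_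
  rintro _ ⟨a, ha, b, hb, rfl⟩
  have hn : ‖φ b‖ ≤ r := hr _ ⟨b, hb, rfl⟩
  have hr0 : 0 ≤ r := (norm_nonneg _).trans hn
  refine ⟨(φ b / r) • a, subset_convexHull ℝ _ ?_, ?_⟩
  · refine mem_balancedHull_iff.2 ⟨φ b / r, ?_, a, ha, rfl⟩
    rw [norm_div, Complex.norm_real, Real.norm_of_nonneg hr0]
    exact div_le_one_of_le₀ hn hr0
  · change (r : ℂ) • (φ b / r) • a = φ b • a
    rw [smul_smul]
    congr 1
    rcases hr0.eq_or_lt with h | h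
    · rw [← h, norm_le_zero_iff] at hn
      simp [hn]
    · have : (r : ℂ) ≠ 0 := by exact_mod_cast h.ne'
      field_simp

theorem BddBilin.flip {b : A →ₗ[ℂ] B →ₗ[ℂ] X} (hb : BddBilin b) : BddBilin b.flip := by
  intro S T hS hT
  refine (hb T S hT hS).subset ?_
  rintro _ ⟨x, hx, y, hy, rfl⟩
  exact ⟨y, hy, x, hx, rfl⟩

/-- The slice map `id ⊗ φ : a ⊗ b ↦ φ b • a`. -/
noncomputable def sliceRight [CompleteBornSpace A] (φ : B →ₗ[ℂ] ℂ) (hφ : BddLin φ) :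
    CTensor A B →ₗ[ℂ] A :=
  BTensor.lift ((LinearMap.lsmul ℂ A).flip.compl₂ φ) (bddBilin_smul_right hφ)
    (fun _ _ h => h.elim)

/-- The slice map `φ ⊗ id : a ⊗ b ↦ φ a • b`. -/
noncomputable def sliceLeft [CompleteBornSpace B] (φ : A →ₗ[ℂ] ℂ) (hφ : BddLin φ) :
    CTensor A B →ₗ[ℂ] B :=
  BTensor.lift ((LinearMap.lsmul ℂ B).flip.compl₂ φ).flip (bddBilin_smul_right hφ).flip
    (fun _ _ h => h.elim)

@[simp]
theorem sliceRight_tm [CompleteBornSpace A] (φ : B →ₗ[ℂ] ℂ) (hφ : BddLin φ) (a : A) (b : B) :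
    sliceRight φ hφ (tm a b) = φ b • a := BTensor.lift_tmul _ _ _ _

@[simp]
theorem sliceLeft_tm [CompleteBornSpace B] (φ : A →ₗ[ℂ] ℂ) (hφ : BddLin φ) (a : A) (b : B) :
    sliceLeft φ hφ (tm a b) = φ a • b := BTensor.lift_tmul _ _ _ _

end Constructions

section Algebras

/-- A bornological algebra, not necessarily unital: a complete bornological vector space with an
associative bounded bilinear multiplication. -/
class BornAlgebra (A : Type u) [NonUnitalRing A] [Module ℂ A] [Bornology A] : Prop
    extends CompleteBornSpace A, IsScalarTower ℂ A A, SMulCommClass ℂ A A where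
  isBounded_mul : ∀ S T : Set A, IsBounded S → IsBounded T → IsBounded (S * T)

variable {A B : Type u} [NonUnitalRing A] [Module ℂ A] [Bornology A] [BornAlgebra A]
  [NonUnitalRing B] [Module ℂ B] [Bornology B] [BornAlgebra B]

theorem bddBilin_mul : BddBilin (LinearMap.mul ℂ A) := fun S T hS hT =>
  BornAlgebra.isBounded_mul S T hS hT

variable (A B) in
/-- The trilinear map `(a, b, y) ↦ (a ⊗ b) y`. -/
noncomputable def tensorMulTri : A →ₗ[ℂ] B →ₗ[ℂ] CTensor A B →ₗ[ℂ] CTensor A B :=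
  LinearMap.mk₂ ℂ
    (fun a b => tmap (LinearMap.mul ℂ A a) (LinearMap.mul ℂ B b) (bddBilin_mul.left a)
      (bddBilin_mul.left b))
    (fun a a' b => BTensor.ext (bddLin_tmap _ _ _ _)
      ((bddLin_tmap _ _ _ _).add (bddLin_tmap _ _ _ _)) (fun x y => by
        simp [LinearMap.map_add₂]))
    (fun c a b => BTensor.ext (bddLin_tmap _ _ _ _) ((bddLin_tmap _ _ _ _).smul c)
      (fun x y => by simp [LinearMap.map_smul₂]))
    (fun a b b' => BTensor.ext (bddLin_tmap _ _ _ _)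
      ((bddLin_tmap _ _ _ _).add (bddLin_tmap _ _ _ _)) (fun x y => by simp))
    (fun c a b => BTensor.ext (bddLin_tmap _ _ _ _) ((bddLin_tmap _ _ _ _).smul c)
      (fun x y => by simp))

theorem bddTrilin_tensorMulTri : BddTrilin (tensorMulTri A B) := by
  intro S T U hS hT hU
  obtain ⟨S', T', c, hS', hT', h⟩ := BTensor.isBounded_iff.1 hU
  obtain ⟨E, hE, hE'⟩ := tmap_mem (S := S') (T := T') (c := c)
    (BornAlgebra.isBounded_mul S S' hS hS') (BornAlgebra.isBounded_mul T T' hT hT')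
  refine hE.subset ?_
  rintro _ ⟨a, ha, b, hb, x, hx, rfl⟩
  exact hE' _ _ (bddBilin_mul.left a) (bddBilin_mul.left b) (fun a' ha' => Set.mul_mem_mul ha ha') (fun b' hb' => Set.mul_mem_mul hb hb')
    x (h hx)

variable (A B) in
/-- The multiplication of the completed tensor product, `(a ⊗ b) (a' ⊗ b') = a a' ⊗ b b'`. -/
noncomputable def tensorMul : CTensor A B →ₗ[ℂ] CTensor A B →ₗ[ℂ] CTensor A B :=
  liftTri (tensorMulTri A B) bddTrilin_tensorMulTri

theorem tensorMul_tm (a a' : A) (b b' : B) :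
    tensorMul A B (tm a b) (tm a' b') = tm (a * a') (b * b') := by
  rw [tensorMul, liftTri_tm]
  exact tmap_tm _ _ (bddBilin_mul.left a) (bddBilin_mul.left b) _ _

theorem bddBilin_tensorMul : BddBilin (tensorMul A B) := bddBilin_liftTri _ _

theorem tensorMul_assoc (x y z : CTensor A B) :
    tensorMul A B (tensorMul A B x y) z = tensorMul A B x (tensorMul A B y z) := by
  have h := bddBilin_tensorMul (A := A) (B := B)
  have h1 : ∀ a b a' b', tensorMul A B (tensorMul A B (tm a b) (tm a' b')) =
      tensorMul A B (tm a b) ∘ₗ tensorMul A B (tm a' b') := fun a b a' b' => by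
    refine BTensor.ext (h.left _) ((h.left _).comp (h.left _)) fun a'' b'' => ?_
    change tensorMul A B _ (tm a'' b'') = tensorMul A B (tm a b) (tensorMul A B _ (tm a'' b''))
    simp only [tensorMul_tm, mul_assoc]
  have h2 : ∀ a b z, (tensorMul A B).flip z ∘ₗ tensorMul A B (tm a b) =
      tensorMul A B (tm a b) ∘ₗ (tensorMul A B).flip z := fun a b z => by
    refine BTensor.ext ((h.right _).comp (h.left _)) ((h.left _).comp (h.right _))
      fun a' b' => ?_
    exact LinearMap.congr_fun (h1 a b a' b') z
  have h3 : (tensorMul A B).flip z ∘ₗ (tensorMul A B).flip y =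
      (tensorMul A B).flip (tensorMul A B y z) := by
    refine BTensor.ext ((h.right _).comp (h.right _)) (h.right _) fun a b => ?_
    exact LinearMap.congr_fun (h2 a b z) y
  exact LinearMap.congr_fun h3 x

noncomputable instance : NonUnitalRing (CTensor A B) :=
  { (inferInstance : AddCommGroup (CTensor A B)) with
    mul := fun x y => tensorMul A B x y
    left_distrib := fun x y z => map_add (tensorMul A B x) y z
    right_distrib := fun x y z => LinearMap.map_add₂ (tensorMul A B) x y z
    zero_mul := fun x => LinearMap.map_zero₂ (tensorMul A B) x
    mul_zero := fun x => map_zero (tensorMul A B x)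
    mul_assoc := tensorMul_assoc }

theorem tensor_mul_def (x y : CTensor A B) : x * y = tensorMul A B x y := rfl

@[simp]
theorem tm_mul_tm (a a' : A) (b b' : B) : tm a b * tm a' b' = tm (a * a') (b * b') :=
  tensorMul_tm a a' b b'

instance : BornAlgebra (CTensor A B) where
  smul_assoc c x y := LinearMap.map_smul₂ (tensorMul A B) c x y
  smul_comm c x y := (map_smul (tensorMul A B x) c y).symm
  isBounded_mul S T hS hT := bddBilin_tensorMul S T hS hT

variable (A) in
/-- Multipliers `(L, R)` of `A`: a bounded left multiplier `L` and a bounded right multiplier `R`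
with `f L(g) = R(f) g`. -/
def multiplierSubmodule : Submodule ℂ ((A →ₗ[ℂ] A) × (A →ₗ[ℂ] A)) where
  carrier := {m | BddLin m.1 ∧ BddLin m.2 ∧ (∀ f g, m.1 (f * g) = m.1 f * g) ∧
    (∀ f g, m.2 (f * g) = f * m.2 g) ∧ ∀ f g, f * m.1 g = m.2 f * g}
  zero_mem' := by
    have : BddLin (0 : A →ₗ[ℂ] A) := fun S _ => (isBounded_singleton (x := (0 : A))).subset (by
      rintro _ ⟨x, _, rfl⟩
      rfl)
    refine ⟨this, this, ?_, ?_, ?_⟩ <;> simp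
  add_mem' := by
    rintro m n ⟨h1, h2, h3, h4, h5⟩ ⟨k1, k2, k3, k4, k5⟩
    exact ⟨h1.add k1, h2.add k2, fun f g => by simp [h3, k3, add_mul],
      fun f g => by simp [h4, k4, mul_add], fun f g => by simp [h5, k5, add_mul, mul_add]⟩
  smul_mem' := by
    rintro c m ⟨h1, h2, h3, h4, h5⟩
    exact ⟨h1.smul c, h2.smul c, fun f g => by simp [h3, smul_mul_assoc],
      fun f g => by simp [h4, mul_smul_comm],
      fun f g => by simp [mul_smul_comm, smul_mul_assoc, h5]⟩

variable (A) in
/-- The multiplier algebra `M(A)`. -/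
def Multiplier : Type u := multiplierSubmodule A

namespace Multiplier

instance : AddCommGroup (Multiplier A) := inferInstanceAs (AddCommGroup (multiplierSubmodule A))

instance : Module ℂ (Multiplier A) := inferInstanceAs (Module ℂ (multiplierSubmodule A))

/-- The left multiplier `g ↦ m g`. -/
def L (m : Multiplier A) : A →ₗ[ℂ] A := m.1.1

/-- The right multiplier `g ↦ g m`. -/
def R (m : Multiplier A) : A →ₗ[ℂ] A := m.1.2

theorem bddLin_L (m : Multiplier A) : BddLin m.L := m.2.1

theorem bddLin_R (m : Multiplier A) : BddLin m.R := m.2.2.1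

theorem L_mul (m : Multiplier A) (f g : A) : m.L (f * g) = m.L f * g := m.2.2.2.1 f g

theorem R_mul (m : Multiplier A) (f g : A) : m.R (f * g) = f * m.R g := m.2.2.2.2.1 f g

theorem mul_L (m : Multiplier A) (f g : A) : f * m.L g = m.R f * g := m.2.2.2.2.2 f g

/-- Constructor for multipliers. -/
def mk (L R : A →ₗ[ℂ] A) (hL : BddLin L) (hR : BddLin R) (h1 : ∀ f g, L (f * g) = L f * g)
    (h2 : ∀ f g, R (f * g) = f * R g) (h3 : ∀ f g, f * L g = R f * g) : Multiplier A :=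
  Subtype.mk (p := (· ∈ multiplierSubmodule A)) (L, R) ⟨hL, hR, h1, h2, h3⟩

/-- Multiplication of multipliers: `(m n) g = m (n g)` and `g (m n) = (g m) n`. -/
instance : Mul (Multiplier A) where
  mul m n := mk (m.L ∘ₗ n.L) (n.R ∘ₗ m.R) (m.bddLin_L.comp n.bddLin_L)
    (n.bddLin_R.comp m.bddLin_R) (fun f g => by simp [L_mul]) (fun f g => by simp [R_mul])
    (fun f g => by simp [mul_L])

instance : One (Multiplier A) where
  one := mk LinearMap.id LinearMap.id BddLin.id BddLin.id (fun _ _ => rfl) (fun _ _ => rfl)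
    (fun _ _ => rfl)

/-- A set of multipliers is small if the corresponding sets of left and right multipliers are
equibounded. -/
instance : Bornology (Multiplier A) :=
  Bornology.ofBounded {M | ∀ S : Set A, IsBounded S →
      IsBounded {x | ∃ m ∈ M, ∃ a ∈ S, m.L a = x} ∧ IsBounded {x | ∃ m ∈ M, ∃ a ∈ S, m.R a = x}}
    (by
      intro S _
      simp)
    (by
      intro M hM M' h S hS
      refine ⟨(hM S hS).1.subset ?_, (hM S hS).2.subset ?_⟩
      · rintro _ ⟨m, hm, a, ha, rfl⟩
        exact ⟨m, h hm, a, ha, rfl⟩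
      · rintro _ ⟨m, hm, a, ha, rfl⟩
        exact ⟨m, h hm, a, ha, rfl⟩)
    (by
      intro M hM M' hM' S hS
      refine ⟨((hM S hS).1.union (hM' S hS).1).subset ?_,
        ((hM S hS).2.union (hM' S hS).2).subset ?_⟩
      · rintro _ ⟨m, hm | hm, a, ha, rfl⟩
        · exact Or.inl ⟨m, hm, a, ha, rfl⟩
        · exact Or.inr ⟨m, hm, a, ha, rfl⟩
      · rintro _ ⟨m, hm | hm, a, ha, rfl⟩
        · exact Or.inl ⟨m, hm, a, ha, rfl⟩
        · exact Or.inr ⟨m, hm, a, ha, rfl⟩)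
    (by
      intro m S hS
      refine ⟨(m.bddLin_L S hS).subset ?_, (m.bddLin_R S hS).subset ?_⟩
      · rintro _ ⟨_, rfl, a, ha, rfl⟩
        exact ⟨a, ha, rfl⟩
      · rintro _ ⟨_, rfl, a, ha, rfl⟩
        exact ⟨a, ha, rfl⟩)

variable (A) in
/-- The canonical map `A → M(A)`. -/
noncomputable def incl : A →ₗ[ℂ] Multiplier A where
  toFun a := mk (LinearMap.mul ℂ A a) ((LinearMap.mul ℂ A).flip a) (bddBilin_mul.left a)
    (bddBilin_mul.right a) (fun f g => by simp [mul_assoc]) (fun f g => by simp [mul_assoc])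
    (fun f g => by simp [mul_assoc])
  map_add' a b := Subtype.ext (Prod.ext (map_add _ a b) (map_add _ a b))
  map_smul' c a := Subtype.ext (Prod.ext (map_smul _ c a) (map_smul _ c a))

/-- The multiplier `m ⊗ n` of a tensor product. -/
noncomputable def tensor (m : Multiplier A) (n : Multiplier B) : Multiplier (CTensor A B) :=
  mk (tmap m.L n.L m.bddLin_L n.bddLin_L) (tmap m.R n.R m.bddLin_R n.bddLin_R)
    (bddLin_tmap _ _ _ _) (bddLin_tmap _ _ _ _)
    (fun f g => by
      have h := bddBilin_tensorMul (A := A) (B := B)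
      have h1 : ∀ a b, tmap m.L n.L m.bddLin_L n.bddLin_L ∘ₗ tensorMul A B (tm a b) =
          tensorMul A B (tmap m.L n.L m.bddLin_L n.bddLin_L (tm a b)) := fun a b => by
        refine BTensor.ext ((bddLin_tmap _ _ _ _).comp (h.left _)) (h.left _) fun a' b' => ?_
        simp [tensorMul_tm, L_mul]
      have h2 : tmap m.L n.L m.bddLin_L n.bddLin_L ∘ₗ (tensorMul A B).flip g =
          (tensorMul A B).flip g ∘ₗ tmap m.L n.L m.bddLin_L n.bddLin_L := by
        refine BTensor.ext ((bddLin_tmap _ _ _ _).comp (h.right _))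
          ((h.right _).comp (bddLin_tmap _ _ _ _)) fun a b => ?_
        exact LinearMap.congr_fun (h1 a b) g
      exact LinearMap.congr_fun h2 f)
    (fun f g => by
      have h := bddBilin_tensorMul (A := A) (B := B)
      have h1 : ∀ a b, tmap m.R n.R m.bddLin_R n.bddLin_R ∘ₗ tensorMul A B (tm a b) =
          tensorMul A B (tm a b) ∘ₗ tmap m.R n.R m.bddLin_R n.bddLin_R := fun a b => by
        refine BTensor.ext ((bddLin_tmap _ _ _ _).comp (h.left _))
          ((h.left _).comp (bddLin_tmap _ _ _ _)) fun a' b' => ?_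
        simp [tensorMul_tm, R_mul]
      have h2 : tmap m.R n.R m.bddLin_R n.bddLin_R ∘ₗ (tensorMul A B).flip g =
          (tensorMul A B).flip (tmap m.R n.R m.bddLin_R n.bddLin_R g) := by
        refine BTensor.ext ((bddLin_tmap _ _ _ _).comp (h.right _)) (h.right _) fun a b => ?_
        exact LinearMap.congr_fun (h1 a b) g
      exact LinearMap.congr_fun h2 f)
    (fun f g => by
      have h := bddBilin_tensorMul (A := A) (B := B)
      have h1 : ∀ a b, tensorMul A B (tm a b) ∘ₗ tmap m.L n.L m.bddLin_L n.bddLin_L =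
          tensorMul A B (tmap m.R n.R m.bddLin_R n.bddLin_R (tm a b)) := fun a b => by
        refine BTensor.ext ((h.left _).comp (bddLin_tmap _ _ _ _)) (h.left _) fun a' b' => ?_
        simp [tensorMul_tm, mul_L]
      have h2 : (tensorMul A B).flip (tmap m.L n.L m.bddLin_L n.bddLin_L g) =
          (tensorMul A B).flip g ∘ₗ tmap m.R n.R m.bddLin_R n.bddLin_R := by
        refine BTensor.ext (h.right _) ((h.right _).comp (bddLin_tmap _ _ _ _)) fun a b => ?_
        exact LinearMap.congr_fun (h1 a b) g
      exact LinearMap.congr_fun h2 f)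

end Multiplier

end Algebras

section Approximation

variable (V : Type u) [AddCommGroup V] [Module ℂ V] [Bornology V]

variable {V} in
/-- A subset is compact if it is a compact subset of the Banach space spanned by some small
completant disk; compactness in a normed space is expressed by sequences. -/
def IsBornCompact (S : Set V) : Prop :=
  ∃ T : Set V, IsBounded T ∧ IsCompletant T ∧ S ⊆ Submodule.span ℂ T ∧
    ∀ u : ℕ → V, (∀ n, u n ∈ S) → ∃ x ∈ S, ∃ k : ℕ → ℕ, StrictMono k ∧
      Tendsto (fun n => gauge T (u (k n) - x)) atTop (𝓝 0)

variable {V} in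
/-- Operators of the form `x ↦ ∑ φᵢ x • vᵢ`, a finite sum with bounded linear functionals `φᵢ`. -/
def IsFiniteRank (f : V →ₗ[ℂ] V) : Prop :=
  ∃ (n : ℕ) (φ : Fin n → V →ₗ[ℂ] ℂ) (v : Fin n → V), (∀ i, BddLin (φ i)) ∧
    ∀ x, f x = ∑ i, φ i x • v i

/-- The approximation property: for every compact disk `S` there is a sequence of finite rank
operators converging to the identity in `Hom(⟨S⟩, V)`, that is, uniformly on `S` with respect to
the norm of some small disk `T`. -/
def ApproximationProperty : Prop :=
  ∀ S : Set V, IsDisk S → IsBornCompact S → ∃ f : ℕ → V →ₗ[ℂ] V, (∀ n, IsFiniteRank (f n)) ∧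
    ∃ T : Set V, IsBounded T ∧ IsDisk T ∧ ∃ ε : ℕ → ℝ, Tendsto ε atTop (𝓝 0) ∧
      ∀ n, ∀ x ∈ S, f n x - x ∈ ε n • T

end Approximation

section QuantumGroups

open Multiplier

variable {H K : Type u} [NonUnitalRing H] [Module ℂ H] [Bornology H] [BornAlgebra H]
  [NonUnitalRing K] [Module ℂ K] [Bornology K] [BornAlgebra K]

variable (H) in
/-- A nonzero bornological algebra `H` is essential if the multiplication induces a bornological
isomorphism `H ⊗_H H ≅ H`. Here `H ⊗_H H` is the quotient of the completed tensor product by the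
closed subspace generated by `a b ⊗ c - a ⊗ b c`. -/
def IsEssentialAlgebra : Prop :=
  Nontrivial H ∧ ∃ e : BTensor H H {r | ∃ a b c : H, r = ((a * b, c), (a, b * c))} ≃ₗ[ℂ] H,
    IsBornIso e ∧ ∀ a b, e (BTensor.tmul _ a b) = a * b

/-- A homomorphism of bornological algebras `H → M(K)`. -/
structure IsHom (f : H →ₗ[ℂ] Multiplier K) : Prop where
  bdd : BddLin f
  map_mul : ∀ a b, f (a * b) = f a * f b

/-- A homomorphism `f : H → M(K)` is essential if it turns `K` into an essential left and right
`H`-module, that is, `H ⊗_H K ≅ K` and `K ⊗_H H ≅ K` via the module structures. -/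
structure IsEssentialHom (f : H →ₗ[ℂ] Multiplier K) : Prop extends IsHom f where
  left : ∃ e : BTensor H K {r | ∃ (a b : H) (k : K), r = ((a * b, k), (a, (f b).L k))} ≃ₗ[ℂ] K,
    IsBornIso e ∧ ∀ a k, e (BTensor.tmul _ a k) = (f a).L k
  right : ∃ e : BTensor K H {r | ∃ (k : K) (a b : H), r = (((f a).R k, b), (k, a * b))} ≃ₗ[ℂ] K,
    IsBornIso e ∧ ∀ k a, e (BTensor.tmul _ k a) = (f a).R k

/-- `F` is a unital homomorphism `M(H) → M(K)`. -/
structure IsUnitalHom (F : Multiplier H →ₗ[ℂ] Multiplier K) : Prop where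
  bdd : BddLin F
  map_one : F 1 = 1
  map_mul : ∀ m n, F (m * n) = F m * F n

/-- Coassociativity `(Δ ⊗ id) Δ = (id ⊗ Δ) Δ`. Here `E₁` and `E₂` are the (unique) unital
homomorphisms on `M(H ⊗ H)` extending the homomorphisms `Δ ⊗ id` and `id ⊗ Δ` on `H ⊗ H`, and
multipliers of `(H ⊗ H) ⊗ H` and `H ⊗ (H ⊗ H)` are compared by the associativity isomorphism. -/
def IsCoassociative (Δ : H →ₗ[ℂ] Multiplier (CTensor H H)) : Prop :=
  ∃ (E₁ : Multiplier (CTensor H H) →ₗ[ℂ] Multiplier (CTensor (CTensor H H) H))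
    (E₂ : Multiplier (CTensor H H) →ₗ[ℂ] Multiplier (CTensor H (CTensor H H))),
    IsUnitalHom E₁ ∧ IsUnitalHom E₂ ∧
    (∀ a b, E₁ (incl _ (tm a b)) = (Δ a).tensor (incl H b)) ∧
    (∀ a b, E₂ (incl _ (tm a b)) = (incl H a).tensor (Δ b)) ∧
    ∀ f, (assocMap H H H) ∘ₗ (E₁ (Δ f)).L = (E₂ (Δ f)).L ∘ₗ (assocMap H H H) ∧
      (assocMap H H H) ∘ₗ (E₁ (Δ f)).R = (E₂ (Δ f)).R ∘ₗ (assocMap H H H)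

/-- A comultiplication is a coassociative essential homomorphism `H → M(H ⊗ H)`. -/
structure IsComultiplication (Δ : H →ₗ[ℂ] Multiplier (CTensor H H)) : Prop
    extends IsEssentialHom Δ where
  coassoc : IsCoassociative Δ

/-- The statement that the Galois maps
`γ_l (f ⊗ g) = Δ(f) (g ⊗ 1)`, `γ_r (f ⊗ g) = Δ(f) (1 ⊗ g)`,
`ρ_l (f ⊗ g) = (f ⊗ 1) Δ(g)`, `ρ_r (f ⊗ g) = (1 ⊗ f) Δ(g)`
are bornological isomorphisms of `H ⊗ H` onto itself. -/
structure GaloisIsos (Δ : H →ₗ[ℂ] Multiplier (CTensor H H)) where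
  gammaL : CTensor H H ≃ₗ[ℂ] CTensor H H
  gammaR : CTensor H H ≃ₗ[ℂ] CTensor H H
  rhoL : CTensor H H ≃ₗ[ℂ] CTensor H H
  rhoR : CTensor H H ≃ₗ[ℂ] CTensor H H
  gammaL_iso : IsBornIso gammaL
  gammaR_iso : IsBornIso gammaR
  rhoL_iso : IsBornIso rhoL
  rhoR_iso : IsBornIso rhoR
  gammaL_tm : ∀ f g, incl _ (gammaL (tm f g)) = Δ f * (incl H g).tensor 1
  gammaR_tm : ∀ f g, incl _ (gammaR (tm f g)) = Δ f * Multiplier.tensor 1 (incl H g)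
  rhoL_tm : ∀ f g, incl _ (rhoL (tm f g)) = (incl H f).tensor 1 * Δ g
  rhoR_tm : ∀ f g, incl _ (rhoR (tm f g)) = Multiplier.tensor 1 (incl H f) * Δ g

/-- A bounded linear functional `ω` is faithful if `ω(fg) = 0` for all `g` implies `f = 0`, and
`ω(fg) = 0` for all `f` implies `g = 0`. -/
structure IsFaithful (ω : H →ₗ[ℂ] ℂ) : Prop where
  bdd : BddLin ω
  left : ∀ f, (∀ g, ω (f * g) = 0) → f = 0
  right : ∀ g, (∀ f, ω (f * g) = 0) → g = 0

/-- Left invariance `(id ⊗ φ) Δ(f) = φ(f) 1` of a bounded linear functional, as an equality of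
multipliers: `(id ⊗ φ)(Δ(f) (g ⊗ 1)) = φ(f) g` and `(id ⊗ φ)((g ⊗ 1) Δ(f)) = φ(f) g`. -/
structure IsLeftInvariant {Δ : H →ₗ[ℂ] Multiplier (CTensor H H)} (G : GaloisIsos Δ)
    (φ : H →ₗ[ℂ] ℂ) : Prop where
  bdd : BddLin φ
  left : ∀ f g, sliceRight φ bdd (G.gammaL (tm f g)) = φ f • g
  right : ∀ f g, sliceRight φ bdd (G.rhoL (tm g f)) = φ f • g

/-- Right invariance `(ψ ⊗ id) Δ(f) = ψ(f) 1` of a bounded linear functional, as an equality of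
multipliers: `(ψ ⊗ id)(Δ(f) (1 ⊗ g)) = ψ(f) g` and `(ψ ⊗ id)((1 ⊗ g) Δ(f)) = ψ(f) g`. -/
structure IsRightInvariant {Δ : H →ₗ[ℂ] Multiplier (CTensor H H)} (G : GaloisIsos Δ)
    (ψ : H →ₗ[ℂ] ℂ) : Prop where
  bdd : BddLin ψ
  left : ∀ f g, sliceLeft ψ bdd (G.gammaR (tm f g)) = ψ f • g
  right : ∀ f g, sliceLeft ψ bdd (G.rhoR (tm g f)) = ψ f • g

variable (H) in
/-- A bornological quantum group: an essential bornological algebra with the approximation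
property, a comultiplication all of whose Galois maps are isomorphisms, and a faithful left
invariant functional, the left Haar functional. -/
structure BornQuantumGroup where
  essential : IsEssentialAlgebra H
  approximation : ApproximationProperty H
  comul : H →ₗ[ℂ] Multiplier (CTensor H H)
  isComultiplication : IsComultiplication comul
  galois : GaloisIsos comul
  haar : H →ₗ[ℂ] ℂ
  haar_faithful : IsFaithful haar
  haar_leftInvariant : IsLeftInvariant galois haar

end QuantumGroups

end BornQG

/-!
By the approximation property, an element of `H ⊗ H` is determined by its slices. Let `φ` be the
left Haar functional. Comparing slices and using coassociativity and left invariance, one finds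
explicit `γ_r`-preimages of the tensors `(id ⊗ φ)(Δ(f) (1 ⊗ g)) ⊗ q`. They show that
`(id ⊗ φ) ρ_r γ_r⁻¹` factors through `id ⊗ φ`; the factor is the antipode `S`, and `φ ∘ S` is a
nonzero right invariant functional.

For `φ` left invariant and `ψ` right invariant, compute `(ψ ⊗ φ)(Δ(x) w)` for the tensor
`w = γ_r(f ⊗ g) = γ_l(v)`. The first form of `w` gives `φ(g) ψ(x f)`, the second gives
`φ(x (id ⊗ ψ)(v))`, so `ν(f) = (id ⊗ ψ) γ_l⁻¹ γ_r (f ⊗ g)` satisfies `φ(x ν(f)) = φ(g) ψ(x f)`. As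
`ν` does not depend on `φ`, every left invariant functional is proportional to the left Haar
functional. Exchanging the roles of `γ_l` and `γ_r` gives the inverse of `ν`.
-/

namespace BornQG

open Filter Topology Bornology Pointwise

section Weights

variable {ι : Type*} {a : ι → ℝ}

theorem div_sqrt_add_le {s b : ℝ} (hs : 0 ≤ s) (hb : 0 ≤ b) :
    b / √(s + b) ≤ 2 * (√(s + b) - √s) := by
  have hle : √s ≤ √(s + b) := Real.sqrt_le_sqrt (by linarith)
  refine div_le_of_le_mul₀ (Real.sqrt_nonneg _) (by linarith) ?_
  nlinarith [Real.sq_sqrt hs, Real.sq_sqrt (add_nonneg hs hb), Real.sqrt_nonneg s]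

/-- The sum of all the terms of `a` which are at most as large as `a i`: the tail of the series
starting at `i` once its terms are put in decreasing order. -/
noncomputable def decreasingTail (a : ι → ℝ) (i : ι) : ℝ :=
  ∑' j, {j | a j ≤ a i}.indicator a j

theorem sum_le_decreasingTail (ha0 : 0 ≤ a) (ha : Summable a) {s : Finset ι} {i : ι}
    (h : ∀ j ∈ s, a j ≤ a i) : ∑ j ∈ s, a j ≤ decreasingTail a i :=
  calc ∑ j ∈ s, a j = ∑ j ∈ s, {j | a j ≤ a i}.indicator a j :=
        Finset.sum_congr rfl fun j hj =>
          (Set.indicator_of_mem (s := {j | a j ≤ a i}) (h j hj) a).symm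
    _ ≤ decreasingTail a i :=
        (ha.indicator _).sum_le_tsum s fun j _ => Set.indicator_nonneg (fun j _ => ha0 j) j

theorem tendsto_decreasingTail (ha0 : 0 ≤ a) (ha : Summable a) :
    Tendsto (decreasingTail a) cofinite (𝓝 0) := by
  have h : Tendsto (decreasingTail a) cofinite (𝓝 (∑' _ : ι, 0)) :=
    tendsto_tsum_of_dominated_convergence ha
      (fun j => squeeze_zero (fun i => Set.indicator_nonneg (fun j _ => ha0 j) j)
        (fun i => Set.indicator_apply_le' (fun hj => hj) fun _ => ha0 i)
        ha.tendsto_cofinite_zero)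
      (.of_forall fun i j => (norm_indicator_le_norm_self a j).trans_eq
        (Real.norm_of_nonneg (ha0 j)))
  rwa [tsum_zero] at h

theorem sum_div_sqrt_decreasingTail_le (ha0 : 0 ≤ a) (ha : Summable a) (s : Finset ι) :
    ∑ i ∈ s, a i / √(decreasingTail a i) ≤ 2 * √(∑ i ∈ s, a i) := by
  classical
  induction s using Finset.induction_on_max_value a with
  | empty => simp
  | insert i s hi hmax ih =>
    have hs : 0 ≤ ∑ j ∈ s, a j := Finset.sum_nonneg fun j _ => ha0 j
    have htail : ∑ j ∈ s, a j + a i ≤ decreasingTail a i := by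
      rw [add_comm, ← Finset.sum_insert hi]
      exact sum_le_decreasingTail ha0 ha (by simpa using hmax)
    have hterm : a i / √(decreasingTail a i) ≤ a i / √(∑ j ∈ s, a j + a i) := by
      obtain h | h := (ha0 i).eq_or_lt
      · simp [← h]
      · have : 0 < ∑ j ∈ s, a j + a i := add_pos_of_nonneg_of_pos hs h
        exact div_le_div_of_nonneg_left h.le (Real.sqrt_pos.2 this) (Real.sqrt_le_sqrt htail)
    have := div_sqrt_add_le hs (ha0 i)
    rw [Finset.sum_insert hi, Finset.sum_insert hi, add_comm (a i)]
    linarith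

theorem exists_tendsto_zero_summable_div (ha0 : 0 ≤ a) (ha : Summable a) :
    ∃ t : ι → ℝ, 0 ≤ t ∧ (∀ i, a i ≠ 0 → 0 < t i) ∧ Tendsto t cofinite (𝓝 0) ∧
      Summable fun i => a i / t i := by
  refine ⟨fun i => √(decreasingTail a i), fun i => Real.sqrt_nonneg _,
    fun i hi => Real.sqrt_pos.2 ?_, ?_, ?_⟩
  · have : ∑ j ∈ {i}, a j ≤ decreasingTail a i := sum_le_decreasingTail ha0 ha (by simp)
    rw [Finset.sum_singleton] at this
    exact ((ha0 i).lt_of_ne' hi).trans_le this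
  · simpa using (tendsto_decreasingTail ha0 ha).sqrt
  · exact summable_of_sum_le (fun i => div_nonneg (ha0 i) (Real.sqrt_nonneg _)) fun s =>
      (sum_div_sqrt_decreasingTail_le ha0 ha s).trans
        (mul_le_mul_of_nonneg_left (Real.sqrt_le_sqrt (ha.sum_le_tsum s fun i _ => ha0 i))
          zero_le_two)

end Weights

section Compactness

theorem balanced_convexHull_real {E : Type*} [AddCommGroup E] [Module ℂ E] {s : Set E}
    (hs : Balanced ℂ s) : Balanced ℂ (convexHull ℝ s) := fun c hc =>
  ((DistribSMul.toLinearMap ℝ E c).image_convexHull s).trans_le (convexHull_mono (hs c hc))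

theorem exists_isDisk_isCompact_superset {E : Type u} [NormedAddCommGroup E] [NormedSpace ℂ E]
    [CompleteSpace E] {N : Set E} (hN : IsCompact N) :
    ∃ K, N ⊆ K ∧ IsDisk K ∧ IsCompact K := by
  let M : Set E := Metric.closedBall (0 : ℂ) 1 • N
  have hM : IsCompact M := (ProperSpace.isCompact_closedBall 0 1).smul_set hN
  have hMb : Balanced ℂ M := by
    rintro c hc _ ⟨_, ⟨d, hd, e, he, rfl⟩, rfl⟩
    refine ⟨c * d, ?_, e, he, (smul_smul c d e).symm⟩
    rw [mem_closedBall_zero_iff] at hd ⊢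
    rw [norm_mul]
    exact mul_le_one₀ hc (norm_nonneg _) hd
  refine ⟨closure (convexHull ℝ M), fun e he => subset_closure (subset_convexHull ℝ _ ?_),
    ⟨(balanced_convexHull_real hMb).closure, (convex_convexHull ℝ M).closure⟩,
    hM.totallyBounded.convexHull.closure.isCompact_of_isClosed isClosed_closure⟩
  exact ⟨1, by simp, e, he, one_smul _ _⟩

variable {V : Type u} [AddCommGroup V] [Module ℂ V]

theorem IsCompletant.exists_banach {S : Set V} (hS : IsCompletant S) (hne : S.Nonempty) :
    ∃ (E : Type u) (_ : NormedAddCommGroup E) (_ : NormedSpace ℂ E) (_ : CompleteSpace E)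
      (j : E →ₗ[ℂ] V), LinearMap.range j = Submodule.span ℂ S ∧ ∀ e, gauge S (j e) = ‖e‖ := by
  let N : AddGroupNorm (Submodule.span ℂ S) :=
    { toFun := fun x => gauge S (x : V)
      map_zero' := gauge_zero
      add_le' := fun x y => hS.toIsDisk.gauge_add_le hne x.2 y.2
      neg' := fun x => hS.toIsDisk.gauge_neg x
      eq_zero_of_map_eq_zero' := fun x hx => Subtype.ext (hS.eq_zero x x.2 hx) }
  let _ : NormedAddCommGroup (Submodule.span ℂ S) := N.toNormedAddCommGroup
  let _ : NormedSpace ℂ (Submodule.span ℂ S) :=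
    { norm_smul_le := fun c x => (hS.toIsDisk.gauge_smul c (x : V)).le }
  have hcomplete : CompleteSpace (Submodule.span ℂ S) := by
    refine Metric.complete_of_cauchySeq_tendsto fun x hx => ?_
    obtain ⟨y, hyS, hxy⟩ := hS.complete (fun n => x n) (fun n => (x n).2) fun ε hε => by
      simp only [Metric.cauchySeq_iff, dist_eq_norm] at hx
      exact hx ε hε
    exact ⟨⟨y, hyS⟩, tendsto_iff_norm_sub_tendsto_zero.2 hxy⟩
  exact ⟨Submodule.span ℂ S, inferInstance, inferInstance, hcomplete,
    (Submodule.span ℂ S).subtype, Submodule.range_subtype _, fun _ => rfl⟩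

theorem exists_isBornCompact_disk [Bornology V] {D : Set V} (hD : IsBounded D) (hDn : D.Nonempty)
    (hDc : IsCompletant D) {ι : Type*} {x : ι → V} (hx : ∀ i, x i ∈ Submodule.span ℂ D)
    (h0 : Tendsto (fun i => gauge D (x i)) cofinite (𝓝 0)) :
    ∃ K : Set V, IsDisk K ∧ IsBornCompact K ∧ ∀ i, x i ∈ K := by
  obtain ⟨E, _, _, _, j, hrange, hgauge⟩ := hDc.exists_banach hDn
  rw [← hrange] at hx
  choose e he using hx
  have he0 : Tendsto e cofinite (𝓝 0) := by
    simpa only [← he, hgauge, ← tendsto_zero_iff_norm_tendsto_zero] using h0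
  obtain ⟨K, heK, hKd, hKc⟩ :=
    exists_isDisk_isCompact_superset he0.isCompact_insert_range_of_cofinite
  refine ⟨j '' K, hKd.image j, ⟨D, hD, hDc, ?_, fun u hu => ?_⟩,
    fun i => ⟨e i, heK (Or.inr ⟨i, rfl⟩), he i⟩⟩
  · rintro _ ⟨k, _, rfl⟩
    exact hrange.le ⟨k, rfl⟩
  · choose v hvK hvu using hu
    obtain ⟨y, hyK, k, hk, hlim⟩ := hKc.isSeqCompact hvK
    refine ⟨j y, ⟨y, hyK, rfl⟩, k, hk, ?_⟩
    simpa only [← hvu, ← map_sub, hgauge, Function.comp_apply] using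
      tendsto_iff_norm_sub_tendsto_zero.1 hlim

end Compactness

theorem sub_id_mem_div_smul {V : Type*} [AddCommGroup V] [Module ℂ V] {f : V →ₗ[ℂ] V} {x : V}
    {U : Set V} {t ε : ℝ} (ht : t ≠ 0) (h : f (t • x) - t • x ∈ ε • U) :
    (f - LinearMap.id : V →ₗ[ℂ] V) x ∈ (ε / t) • U := by
  rwa [div_eq_inv_mul, mul_smul, Set.mem_inv_smul_set_iff₀ ht, LinearMap.sub_apply, smul_sub,
    LinearMap.id_apply, ← f.map_smul_of_tower]

section BoundedMaps

theorem bddLin_zero {V W : Type*} [AddCommGroup V] [Module ℂ V] [Bornology V] [AddCommGroup W]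
    [Module ℂ W] [Bornology W] : BddLin (0 : V →ₗ[ℂ] W) := fun _ _ =>
  (isBounded_singleton (x := (0 : W))).subset (Set.image_subset_iff.2 fun _ _ => rfl)

variable {V W X : Type u} [AddCommGroup V] [Module ℂ V] [Bornology V]
  [AddCommGroup W] [Module ℂ W] [Bornology W] [AddCommGroup X] [Module ℂ X] [Bornology X]

theorem BddLin.functional_comp {φ : W →ₗ[ℂ] ℂ} {f : V →ₗ[ℂ] W} (hφ : BddLin φ)
    (hf : BddLin f) : BddLin (φ ∘ₗ f) := fun S hS => by
  rw [LinearMap.coe_comp, Set.image_comp]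
  exact hφ _ (hf _ hS)

theorem bddLin_sliceLeft [CompleteBornSpace W] {ω : V →ₗ[ℂ] ℂ} (hω : BddLin ω) :
    BddLin (sliceLeft (B := W) ω hω) := BTensor.bddLin_lift _ _

theorem bddLin_sliceRight [CompleteBornSpace V] {ω : W →ₗ[ℂ] ℂ} (hω : BddLin ω) :
    BddLin (sliceRight (A := V) ω hω) := BTensor.bddLin_lift _ _

variable [CompleteBornSpace X]

theorem BddLin.sub {f g : V →ₗ[ℂ] X} (hf : BddLin f) (hg : BddLin g) : BddLin (f - g) := by
  rw [sub_eq_add_neg, ← neg_one_smul ℂ]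
  exact hf.add (hg.smul _)

theorem bddLin_sum {ι : Type*} {f : ι → V →ₗ[ℂ] X} (s : Finset ι) (h : ∀ i, BddLin (f i)) :
    BddLin (∑ i ∈ s, f i) :=
  Finset.sum_induction f BddLin (fun _ _ => BddLin.add) bddLin_zero fun i _ => h i

theorem bddLin_smulRight {φ : V →ₗ[ℂ] ℂ} (hφ : BddLin φ) (x : X) : BddLin (φ.smulRight x) :=
  (bddBilin_smul_right hφ).left x

theorem IsFiniteRank.bddLin [CompleteBornSpace V] {f : V →ₗ[ℂ] V} (hf : IsFiniteRank f) :
    BddLin f := by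
  obtain ⟨n, φ, v, hφ, hfv⟩ := hf
  have : f = ∑ i, (φ i).smulRight (v i) := LinearMap.ext fun x => by simp [hfv]
  exact this ▸ bddLin_sum _ fun i => bddLin_smulRight (hφ i) _

end BoundedMaps

section Separation

variable {V W X : Type u} [AddCommGroup V] [Module ℂ V] [Bornology V]
  [AddCommGroup W] [Module ℂ W] [Bornology W]
  [AddCommGroup X] [Module ℂ X] [Bornology X] [CompleteBornSpace X]

theorem gauge_preLift_le {b : V →ₗ[ℂ] W →ₗ[ℂ] X} (hb : BddBilin b) {a : Series V W} {F : Set X}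
    (hF : IsBounded F) (hFn : F.Nonempty) (hFc : IsCompletant F) {r : V × W → ℝ}
    (hr : ∀ p, a.1 p ≠ 0 → b p.1 p.2 ∈ r p • F) (hs : Summable fun p => ‖a.1 p‖ * |r p|) :
    gauge F (preLift b hb a) ≤ ∑' p, ‖a.1 p‖ * |r p| := by
  have hspan : ∀ p, a.1 p ≠ 0 → b p.1 p.2 ∈ Submodule.span ℂ F := fun p hp =>
    mem_span_of_mem_smul (hr p hp)
  choose! d hdF hdb using hr
  have hterm : ∀ p, (a.1 p * (r p : ℂ)) • d p = a.1 p • b p.1 p.2 := fun p => by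
    by_cases hp : a.1 p = 0
    · simp [hp]
    · rw [mul_smul, Complex.coe_smul]
      exact congrArg _ (hdb p hp)
  have hnorm : ∀ p, ‖a.1 p * (r p : ℂ)‖ = ‖a.1 p‖ * |r p| := fun p => by
    rw [norm_mul, Complex.norm_real, Real.norm_eq_abs]
  obtain ⟨x, hx, hxle, hlim⟩ := hFc.exists_sum hFn (fun p => a.1 p * (r p : ℂ)) d
    (fun p hp => hdF p (left_ne_zero_of_mul hp)) (by simpa only [hnorm] using hs)
  simp only [hterm, hnorm] at hlim hxle
  rwa [preLift_eq hb ⟨F, hF, hFn, hFc, hx, hspan, hlim⟩]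

theorem Series.exists_smul_mem_isBornCompact [CompleteBornSpace V] (a : Series V W) :
    ∃ (t : V × W → ℝ) (K : Set V), IsDisk K ∧ IsBornCompact K ∧
      (∀ p, a.1 p ≠ 0 → 0 < t p ∧ t p • p.1 ∈ K) ∧ Summable fun p => ‖a.1 p‖ / t p := by
  obtain ⟨S, T, hS, -, ha⟩ := a.exists_suppIn
  obtain ⟨D, hSD, hDn, hD, hDc⟩ := CompleteBornSpace.exists_completant' hS
  obtain ⟨t, ht0, ht, htend, hsum⟩ := exists_tendsto_zero_summable_div
    (a := fun p => ‖a.1 p‖) (fun _ => _root_.norm_nonneg _) a.summable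
  have hmem : ∀ p : {p // a.1 p ≠ 0}, p.1.1 ∈ D := fun p => hSD (ha p.1 p.2).1
  have hgauge : Tendsto (fun p : {p // a.1 p ≠ 0} => gauge D (t p.1 • p.1.1)) cofinite (𝓝 0) :=
    squeeze_zero (fun _ => gauge_nonneg _)
      (fun p => by
        rw [gauge_smul_of_nonneg (ht0 p.1), smul_eq_mul]
        exact mul_le_of_le_one_right (ht0 p.1) (gauge_le_one_of_mem (hmem p)))
      (htend.comp Subtype.val_injective.tendsto_cofinite)
  obtain ⟨K, hKd, hKc, hK⟩ := exists_isBornCompact_disk hD hDn hDc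
    (fun p => mem_span_of_mem_smul (Set.smul_mem_smul_set (hmem p))) hgauge
  exact ⟨t, K, hKd, hKc, fun p hp => ⟨ht p (norm_ne_zero_iff.2 hp), hK ⟨p, hp⟩⟩, hsum⟩

variable [CompleteBornSpace V] [CompleteBornSpace W]

theorem tmap_eq_zero_of_isFiniteRank {f : V →ₗ[ℂ] V} (hf : IsFiniteRank f) {z : CTensor V W}
    (hz : ∀ (ω : V →ₗ[ℂ] ℂ) (hω : BddLin ω), sliceLeft ω hω z = 0) :
    tmap f LinearMap.id hf.bddLin BddLin.id z = 0 := by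
  obtain ⟨n, φ, v, hφ, hfv⟩ := id hf
  have : tmap f LinearMap.id hf.bddLin BddLin.id =
      ∑ i, BTensor.tmul ∅ (v i) ∘ₗ sliceLeft (B := W) (φ i) (hφ i) :=
    BTensor.ext (bddLin_tmap _ _ _ _)
      (bddLin_sum _ fun i => (BTensor.bddBilin_tmul.left _).comp (bddLin_sliceLeft _))
      fun x w => by simp [tm, hfv, LinearMap.sum_apply]
  simp [this, LinearMap.sum_apply, hz]

theorem tmap_sub_id_of_isFiniteRank {f : V →ₗ[ℂ] V} (hf : IsFiniteRank f) {z : CTensor V W}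
    (hz : ∀ (ω : V →ₗ[ℂ] ℂ) (hω : BddLin ω), sliceLeft ω hω z = 0) :
    tmap (f - LinearMap.id) LinearMap.id (hf.bddLin.sub BddLin.id) BddLin.id z = -z := by
  have : tmap (f - LinearMap.id) (LinearMap.id : W →ₗ[ℂ] W) (hf.bddLin.sub BddLin.id) BddLin.id =
      tmap f LinearMap.id hf.bddLin BddLin.id - LinearMap.id :=
    BTensor.ext (bddLin_tmap _ _ _ _) ((bddLin_tmap _ _ _ _).sub BddLin.id)
      fun v w => by simp [tm]
  rw [this, LinearMap.sub_apply, tmap_eq_zero_of_isFiniteRank hf hz, LinearMap.id_apply, zero_sub]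

/-- Rescaling the first legs of a series for `z` makes them run through a compact disk, on which
finite rank operators `f n` approximate the identity; then `(f n ⊗ id) z = 0` converges to `z`. -/
theorem eq_zero_of_sliceLeft (hV : ApproximationProperty V) {z : CTensor V W}
    (hz : ∀ (ω : V →ₗ[ℂ] ℂ) (hω : BddLin ω), sliceLeft ω hω z = 0) : z = 0 := by
  obtain ⟨a, rfl⟩ := BTensor.mk_surjective z
  obtain ⟨S, T, -, hT, ha⟩ := a.exists_suppIn
  obtain ⟨t, K, hKd, hKc, htK, hsum⟩ := a.exists_smul_mem_isBornCompact
  obtain ⟨f, hf, U, hU, -, ε, hε, hfK⟩ := hV K hKd hKc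
  obtain ⟨F, hF, hFn, hFb, hFc⟩ := CompleteBornSpace.exists_completant'
    ((BTensor.bddBilin_tmul (R := ∅) U T hU hT).union
      (isBounded_singleton (x := BTensor.mk ∅ a)))
  have hmem : ∀ n p, a.1 p ≠ 0 →
      tm ((f n - LinearMap.id : V →ₗ[ℂ] V) p.1) p.2 ∈ (ε n / t p) • F := by
    intro n p hp
    obtain ⟨y, hy, hyp⟩ := sub_id_mem_div_smul (htK p hp).1.ne' (hfK n _ (htK p hp).2)
    refine ⟨tm y p.2, hF (Or.inl ⟨y, hy, p.2, (ha p hp).2, rfl⟩), ?_⟩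
    rw [← hyp]
    simp only [← Complex.coe_smul]
    exact (LinearMap.map_smul₂ (BTensor.tmul ∅) _ y p.2).symm
  have hterm : ∀ n p, ‖a.1 p‖ * |ε n / t p| = |ε n| * (‖a.1 p‖ / t p) := fun n p => by
    by_cases hp : a.1 p = 0
    · simp [hp]
    · rw [abs_div, abs_of_pos (htK p hp).1]
      ring
  have hle : ∀ n, gauge F (BTensor.mk ∅ a) ≤ |ε n| * ∑' p, ‖a.1 p‖ / t p := by
    intro n
    rw [← hFc.toIsDisk.gauge_neg, ← tmap_sub_id_of_isFiniteRank (hf n) hz, ← tsum_mul_left]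
    have := gauge_preLift_le (a := a)
      (BTensor.bddBilin_tmul.compl ((hf n).bddLin.sub BddLin.id) BddLin.id) hFb hFn hFc (hmem n)
      (by simpa only [hterm] using hsum.mul_left |ε n|)
    simp only [hterm] at this
    exact this
  refine hFc.eq_zero _ (Submodule.subset_span (hF (Or.inr rfl))) (le_antisymm ?_ (gauge_nonneg _))
  exact ge_of_tendsto' (by simpa using hε.abs.mul_const _) hle

/-- The bounded functionals separate the points of `V`. -/
def IsSeparated (V : Type u) [AddCommGroup V] [Module ℂ V] [Bornology V] : Prop :=
  ∀ v : V, (∀ ω : V →ₗ[ℂ] ℂ, BddLin ω → ω v = 0) → v = 0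

theorem IsSeparated.tensor (hV : ApproximationProperty V) (hW : IsSeparated W) :
    IsSeparated (CTensor V W) := fun _ hz =>
  eq_zero_of_sliceLeft hV fun _ hω => hW _ fun _ hω' =>
    hz _ (hω'.functional_comp (bddLin_sliceLeft hω))

end Separation

section Totality

variable {V W X : Type u} [AddCommGroup V] [Module ℂ V] [Bornology V]
  [AddCommGroup W] [Module ℂ W] [Bornology W] [AddCommGroup X] [Module ℂ X] [Bornology X]

/-- A subset is total if bounded linear maps into complete spaces are determined by their values
on it; this replaces the density of its linear span. -/
def IsTotal (S : Set V) : Prop :=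
  ∀ ⦃X : Type u⦄ [AddCommGroup X] [Module ℂ X] [Bornology X] [CompleteBornSpace X]
    ⦃f g : V →ₗ[ℂ] X⦄, BddLin f → BddLin g → Set.EqOn f g S → f = g

theorem isTotal_univ : IsTotal (Set.univ : Set V) := fun _ _ _ _ _ _ _ _ _ h =>
  LinearMap.ext fun v => h (Set.mem_univ v)

theorem IsTotal.image {S : Set V} (hS : IsTotal S) {p : V →ₗ[ℂ] W} (hp : BddLin p)
    (hsurj : Function.Surjective p) : IsTotal (p '' S) := by
  intro X _ _ _ _ f g hf hg h
  have hcomp : f ∘ₗ p = g ∘ₗ p :=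
    hS (hf.comp hp) (hg.comp hp) fun x hx => h (Set.mem_image_of_mem p hx)
  exact (LinearMap.cancel_right hsurj).1 hcomp

theorem IsTotal.tmul {R : Set ((V × W) × (V × W))} {S : Set V} {T : Set W} (hS : IsTotal S)
    (hT : IsTotal T) : IsTotal (Set.image2 (BTensor.tmul R · ·) S T) := by
  intro X _ _ _ _ f g hf hg h
  have hleft : ∀ v w, w ∈ T → f (BTensor.tmul R v w) = g (BTensor.tmul R v w) := fun v w hw =>
    LinearMap.congr_fun (hS (hf.comp (BTensor.bddBilin_tmul.right w))
      (hg.comp (BTensor.bddBilin_tmul.right w)) fun x hx => h ⟨x, hx, w, hw, rfl⟩) v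
  exact BTensor.ext hf hg fun v w =>
    LinearMap.congr_fun (hT (hf.comp (BTensor.bddBilin_tmul.left v))
      (hg.comp (BTensor.bddBilin_tmul.left v)) fun y hy => hleft v y hy) w

theorem isTotal_image2_apply_tmul {R : Set ((V × W) × (V × W))} {p : BTensor V W R →ₗ[ℂ] X}
    (hp : BddLin p) (hsurj : Function.Surjective p) :
    IsTotal (Set.image2 (fun v w => p (BTensor.tmul R v w)) Set.univ Set.univ) := by
  rw [← Set.image_image2]
  exact (isTotal_univ.tmul isTotal_univ).image hp hsurj

theorem IsTotal.functional_ext [CompleteBornSpace V] {S : Set V} (hS : IsTotal S)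
    {f g : V →ₗ[ℂ] ℂ} (hf : BddLin f) (hg : BddLin g) (h : Set.EqOn f g S) : f = g := by
  ext v
  obtain rfl | hv := eq_or_ne v 0
  · simp
  have hfg : f.smulRight v = g.smulRight v :=
    hS (bddLin_smulRight hf v) (bddLin_smulRight hg v) fun x hx => by simp [h hx]
  exact smul_left_injective ℂ hv (LinearMap.congr_fun hfg v)

end Totality

section Slices

variable {A B C D X : Type u} [AddCommGroup A] [Module ℂ A] [Bornology A]
  [AddCommGroup B] [Module ℂ B] [Bornology B] [AddCommGroup C] [Module ℂ C] [Bornology C]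
  [AddCommGroup D] [Module ℂ D] [Bornology D]

theorem BTensor.ext_tm_tm_left [AddCommGroup X] [Module ℂ X] [Bornology X] [CompleteBornSpace X]
    {f g : CTensor (CTensor A B) C →ₗ[ℂ] X} (hf : BddLin f) (hg : BddLin g)
    (h : ∀ a b c, f (tm (tm a b) c) = g (tm (tm a b) c)) : f = g :=
  ((isTotal_univ.tmul isTotal_univ).tmul isTotal_univ) hf hg <| by
    rintro _ ⟨_, ⟨a, -, b, -, rfl⟩, c, -, rfl⟩
    exact h a b c

theorem BTensor.ext_tm_tm_right [AddCommGroup X] [Module ℂ X] [Bornology X] [CompleteBornSpace X]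
    {f g : CTensor A (CTensor B C) →ₗ[ℂ] X} (hf : BddLin f) (hg : BddLin g)
    (h : ∀ a b c, f (tm a (tm b c)) = g (tm a (tm b c))) : f = g :=
  (isTotal_univ.tmul (isTotal_univ.tmul isTotal_univ)) hf hg <| by
    rintro _ ⟨a, -, _, ⟨b, -, c, -, rfl⟩, rfl⟩
    exact h a b c

theorem bddLin_assocMap : BddLin (assocMap A B C) := BTensor.bddLin_lift _ _

theorem tmap_tmap_left {f : B →ₗ[ℂ] C} (hf : BddLin f) {g : A →ₗ[ℂ] B} (hg : BddLin g)
    (w : CTensor A D) :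
    tmap f LinearMap.id hf BddLin.id (tmap g LinearMap.id hg BddLin.id w) =
      tmap (f ∘ₗ g) (LinearMap.id : D →ₗ[ℂ] D) (hf.comp hg) BddLin.id w :=
  LinearMap.congr_fun (BTensor.ext
    ((bddLin_tmap f _ hf BddLin.id).comp (bddLin_tmap g _ hg BddLin.id))
    (bddLin_tmap _ _ (hf.comp hg) BddLin.id) fun a b => by simp) w

theorem tmap_tmap_right {f : B →ₗ[ℂ] C} (hf : BddLin f) {g : A →ₗ[ℂ] B} (hg : BddLin g)
    (w : CTensor D A) :
    tmap LinearMap.id f BddLin.id hf (tmap LinearMap.id g BddLin.id hg w) =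
      tmap (LinearMap.id : D →ₗ[ℂ] D) (f ∘ₗ g) BddLin.id (hf.comp hg) w :=
  LinearMap.congr_fun (BTensor.ext
    ((bddLin_tmap _ f BddLin.id hf).comp (bddLin_tmap _ g BddLin.id hg))
    (bddLin_tmap _ _ BddLin.id (hf.comp hg)) fun a b => by simp) w

theorem sliceLeft_tmap [CompleteBornSpace B] [CompleteBornSpace C] {ω : A →ₗ[ℂ] ℂ}
    (hω : BddLin ω) {g : B →ₗ[ℂ] C} (hg : BddLin g) (w : CTensor A B) :
    sliceLeft ω hω (tmap LinearMap.id g BddLin.id hg w) = g (sliceLeft ω hω w) :=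
  LinearMap.congr_fun (BTensor.ext ((bddLin_sliceLeft hω).comp (bddLin_tmap _ _ _ _))
    (hg.comp (bddLin_sliceLeft hω)) fun a b => by simp) w

theorem sliceRight_tmap [CompleteBornSpace A] [CompleteBornSpace C] {ω : B →ₗ[ℂ] ℂ}
    (hω : BddLin ω) {g : A →ₗ[ℂ] C} (hg : BddLin g) (w : CTensor A B) :
    sliceRight ω hω (tmap g LinearMap.id hg BddLin.id w) = g (sliceRight ω hω w) :=
  LinearMap.congr_fun (BTensor.ext ((bddLin_sliceRight hω).comp (bddLin_tmap _ _ _ _))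
    (hg.comp (bddLin_sliceRight hω)) fun a b => by simp) w

theorem sliceLeft_assocMap [CompleteBornSpace B] {ω : A →ₗ[ℂ] ℂ} (hω : BddLin ω)
    (w : CTensor (CTensor A B) C) :
    sliceLeft ω hω (assocMap A B C w) =
      tmap (sliceLeft ω hω) LinearMap.id (bddLin_sliceLeft hω) BddLin.id w :=
  LinearMap.congr_fun (BTensor.ext_tm_tm_left ((bddLin_sliceLeft hω).comp bddLin_assocMap)
    (bddLin_tmap _ _ _ _) fun a b c => by simp [tm]) w

theorem tmap_sliceRight_assocMap [CompleteBornSpace B] {ω : C →ₗ[ℂ] ℂ} (hω : BddLin ω)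
    (w : CTensor (CTensor A B) C) :
    tmap LinearMap.id (sliceRight ω hω) BddLin.id (bddLin_sliceRight hω) (assocMap A B C w) =
      sliceRight ω hω w :=
  LinearMap.congr_fun (BTensor.ext_tm_tm_left
    ((bddLin_tmap _ _ BddLin.id (bddLin_sliceRight hω)).comp bddLin_assocMap)
    (bddLin_sliceRight hω) fun a b c => by simp [tm]) w

theorem apply_sliceLeft [CompleteBornSpace A] [CompleteBornSpace B] {φ : A →ₗ[ℂ] ℂ}
    {ω : B →ₗ[ℂ] ℂ} (hφ : BddLin φ) (hω : BddLin ω) (z : CTensor A B) :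
    ω (sliceLeft φ hφ z) = φ (sliceRight ω hω z) := by
  have : ω ∘ₗ sliceLeft φ hφ = φ ∘ₗ sliceRight ω hω :=
    (isTotal_univ.tmul isTotal_univ).functional_ext
      (hω.functional_comp (bddLin_sliceLeft hφ)) (hφ.functional_comp (bddLin_sliceRight hω)) <| by
        rintro _ ⟨a, -, b, -, rfl⟩
        simp [mul_comm]
  exact LinearMap.congr_fun this z

theorem exists_eq_one_of_ne_zero {V : Type*} [AddCommGroup V] [Module ℂ V]
    {φ : V →ₗ[ℂ] ℂ} (h : φ ≠ 0) : ∃ a, φ a = 1 := by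
  obtain ⟨a, ha⟩ := DFunLike.ne_iff.1 h
  exact ⟨(φ a)⁻¹ • a, by rw [map_smul, smul_eq_mul]; exact inv_mul_cancel₀ ha⟩

theorem sliceLeft_surjective [CompleteBornSpace B] {ω : A →ₗ[ℂ] ℂ} (hω : BddLin ω) (h : ω ≠ 0) :
    Function.Surjective (sliceLeft ω hω : CTensor A B →ₗ[ℂ] B) := fun b => by
  obtain ⟨a, ha⟩ := exists_eq_one_of_ne_zero h
  exact ⟨tm a b, by rw [sliceLeft_tm, ha, one_smul]⟩

theorem sliceRight_surjective [CompleteBornSpace A] {ω : B →ₗ[ℂ] ℂ} (hω : BddLin ω) (h : ω ≠ 0) :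
    Function.Surjective (sliceRight ω hω : CTensor A B →ₗ[ℂ] A) := fun a => by
  obtain ⟨b, hb⟩ := exists_eq_one_of_ne_zero h
  exact ⟨tm a b, by rw [sliceRight_tm, hb, one_smul]⟩

end Slices

section Algebras

/-- Only zero annihilates the whole algebra by multiplication from the left. -/
def IsNondegenerate (A : Type u) [NonUnitalRing A] : Prop := ∀ z : A, (∀ y, z * y = 0) → z = 0

theorem IsNondegenerate.eq_of_mul_eq {A : Type u} [NonUnitalRing A] (hA : IsNondegenerate A)
    {z w : A} (h : ∀ y, z * y = w * y) : z = w :=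
  sub_eq_zero.1 (hA _ fun y => by rw [sub_mul, h, sub_self])

variable {A B : Type u} [NonUnitalRing A] [Module ℂ A] [Bornology A]
  [NonUnitalRing B] [Module ℂ B] [Bornology B] [BornAlgebra B]

theorem IsFaithful.isNondegenerate {φ : A →ₗ[ℂ] ℂ} (h : IsFaithful φ) : IsNondegenerate A :=
  fun f hf => h.left f fun g => by rw [hf, map_zero]

theorem IsFaithful.eq_of_mul_left {φ : A →ₗ[ℂ] ℂ} (h : IsFaithful φ) {f g : A}
    (hfg : ∀ x, φ (x * f) = φ (x * g)) : f = g :=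
  sub_eq_zero.1 (h.right _ fun x => by rw [mul_sub, map_sub, hfg, sub_self])

theorem IsFaithful.ne_zero [Nontrivial A] {φ : A →ₗ[ℂ] ℂ} (h : IsFaithful φ) : φ ≠ 0 := by
  rintro rfl
  obtain ⟨a, ha⟩ := exists_ne (0 : A)
  exact ha (h.left a fun _ => rfl)

theorem IsEssentialAlgebra.isTotal_mul (hA : IsEssentialAlgebra A) :
    IsTotal (Set.image2 (· * ·) Set.univ Set.univ : Set A) := by
  obtain ⟨-, e, he, hmul⟩ := hA
  simpa only [LinearEquiv.coe_coe, hmul] using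
    isTotal_image2_apply_tmul (p := e.toLinearMap) he.1 e.surjective

theorem IsEssentialHom.isTotal_L {f : A →ₗ[ℂ] Multiplier B} (hf : IsEssentialHom f) :
    IsTotal (Set.image2 (fun a b => (f a).L b) Set.univ Set.univ) := by
  obtain ⟨e, he, hmul⟩ := hf.left
  simpa only [LinearEquiv.coe_coe, hmul] using
    isTotal_image2_apply_tmul (p := e.toLinearMap) he.1 e.surjective

variable [BornAlgebra A]

theorem bddLin_mulLeft (a : A) : BddLin (LinearMap.mul ℂ A a) := bddBilin_mul.left a

theorem bddLin_mulRight (a : A) : BddLin ((LinearMap.mul ℂ A).flip a) := bddBilin_mul.right a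

theorem BddLin.comp_mulLeft {ω : A →ₗ[ℂ] ℂ} (hω : BddLin ω) (a : A) :
    BddLin (ω ∘ₗ LinearMap.mul ℂ A a) := hω.functional_comp (bddLin_mulLeft a)

theorem BddLin.comp_mulRight {ω : A →ₗ[ℂ] ℂ} (hω : BddLin ω) (a : A) :
    BddLin (ω ∘ₗ (LinearMap.mul ℂ A).flip a) := hω.functional_comp (bddLin_mulRight a)

theorem IsFaithful.isSeparated {φ : A →ₗ[ℂ] ℂ} (h : IsFaithful φ) : IsSeparated A := fun v hv =>
  h.left v fun g => hv _ (h.bdd.comp_mulRight g)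

theorem IsFaithful.eq_of_sliceLeft_mulLeft {V : Type u} [AddCommGroup V] [Module ℂ V] [Bornology V]
    [CompleteBornSpace V] {φ : A →ₗ[ℂ] ℂ} (h : IsFaithful φ) (hA : ApproximationProperty A)
    (hV : IsSeparated V) {z w : CTensor A V}
    (hzw : ∀ a, sliceLeft (φ ∘ₗ LinearMap.mul ℂ A a) (h.bdd.comp_mulLeft a) z =
      sliceLeft (φ ∘ₗ LinearMap.mul ℂ A a) (h.bdd.comp_mulLeft a) w) : z = w := by
  have hright : ∀ (ω : V →ₗ[ℂ] ℂ) (hω : BddLin ω), sliceRight ω hω z = sliceRight ω hω w :=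
    fun ω hω => h.eq_of_mul_left fun a => by
      have hz := apply_sliceLeft (h.bdd.comp_mulLeft a) hω z
      rw [hzw, apply_sliceLeft] at hz
      exact hz.symm
  refine sub_eq_zero.1 (eq_zero_of_sliceLeft hA fun ω hω => hV _ fun ω' hω' => ?_)
  rw [apply_sliceLeft hω hω', map_sub, hright, sub_self, map_zero]

theorem sliceLeft_mul_tm {ω : A →ₗ[ℂ] ℂ} (hω : BddLin ω) (z : CTensor A B) (a : A) (b : B) :
    sliceLeft ω hω (z * tm a b) =
      sliceLeft (ω ∘ₗ (LinearMap.mul ℂ A).flip a) (hω.comp_mulRight a) z * b := by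
  have : sliceLeft ω hω ∘ₗ (LinearMap.mul ℂ (CTensor A B)).flip (tm a b) =
      (LinearMap.mul ℂ B).flip b ∘ₗ
        sliceLeft (ω ∘ₗ (LinearMap.mul ℂ A).flip a) (hω.comp_mulRight a) :=
    BTensor.ext ((bddLin_sliceLeft _).comp (bddLin_mulRight _))
      ((bddLin_mulRight _).comp (bddLin_sliceLeft _)) fun a b => by simp
  exact LinearMap.congr_fun this z

theorem eq_zero_of_mul_tm (hAP : ApproximationProperty A) (hA : IsSeparated A)
    (hA' : IsNondegenerate A) (hB : IsSeparated B) (hB' : IsNondegenerate B) {z : CTensor A B}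
    (hz : ∀ a b, z * tm a b = 0) : z = 0 := by
  have hleft : ∀ (ω : A →ₗ[ℂ] ℂ) (hω : BddLin ω) (a : A),
      sliceLeft (ω ∘ₗ (LinearMap.mul ℂ A).flip a) (hω.comp_mulRight a) z = 0 := fun ω hω a =>
    hB' _ fun b => by rw [← sliceLeft_mul_tm hω, hz, map_zero]
  have hright : ∀ (ω' : B →ₗ[ℂ] ℂ) (hω' : BddLin ω'), sliceRight ω' hω' z = 0 := fun ω' hω' =>
    hA' _ fun a => hA _ fun ω hω => by
      have h := apply_sliceLeft (hω.comp_mulRight a) hω' z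
      rw [hleft ω hω, map_zero] at h
      exact h.symm
  refine eq_zero_of_sliceLeft hAP fun ω hω => hB _ fun ω' hω' => ?_
  rw [apply_sliceLeft hω hω', hright, map_zero]

theorem IsNondegenerate.tensor (hAP : ApproximationProperty A) (hA : IsSeparated A)
    (hA' : IsNondegenerate A) (hB : IsSeparated B) (hB' : IsNondegenerate B) :
    IsNondegenerate (CTensor A B) :=
  fun _ hz => eq_zero_of_mul_tm hAP hA hA' hB hB' fun _ _ => hz _

end Algebras

namespace Multiplier

variable {A B C : Type u} [NonUnitalRing A] [Module ℂ A] [Bornology A] [BornAlgebra A]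
  [NonUnitalRing B] [Module ℂ B] [Bornology B] [BornAlgebra B]
  [NonUnitalRing C] [Module ℂ C] [Bornology C] [BornAlgebra C]

@[simp]
theorem incl_L (a x : A) : (incl A a).L x = a * x := rfl

@[simp]
theorem incl_R (a x : A) : (incl A a).R x = x * a := rfl

@[simp]
theorem mul_L_apply (m n : Multiplier A) (x : A) : (m * n).L x = m.L (n.L x) := rfl

@[simp]
theorem one_L (x : A) : (1 : Multiplier A).L x = x := rfl

@[simp]
theorem one_R (x : A) : (1 : Multiplier A).R x = x := rfl

@[simp]
theorem tensor_L_tm (m : Multiplier A) (n : Multiplier B) (a : A) (b : B) :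
    (m.tensor n).L (tm a b) = tm (m.L a) (n.L b) :=
  tmap_tm _ _ m.bddLin_L n.bddLin_L _ _

@[simp]
theorem tensor_R_tm (m : Multiplier A) (n : Multiplier B) (a : A) (b : B) :
    (m.tensor n).R (tm a b) = tm (m.R a) (n.R b) :=
  tmap_tm _ _ m.bddLin_R n.bddLin_R _ _

theorem ext {m n : Multiplier A} (hL : m.L = n.L) (hR : m.R = n.R) : m = n :=
  Subtype.ext (Prod.ext hL hR)

theorem mul_incl (m : Multiplier A) (x : A) : m * incl A x = incl A (m.L x) :=
  ext (LinearMap.ext (m.L_mul x)) (LinearMap.ext fun z => (m.mul_L z x).symm)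

theorem isBounded_iff {M : Set (Multiplier A)} : IsBounded M ↔ ∀ S : Set A, IsBounded S →
    IsBounded {x | ∃ m ∈ M, ∃ a ∈ S, m.L a = x} ∧ IsBounded {x | ∃ m ∈ M, ∃ a ∈ S, m.R a = x} :=
  Bornology.isBounded_ofBounded_iff _

theorem bddLin_incl : BddLin (incl A) := by
  refine fun S hS => isBounded_iff.2 fun T hT =>
    ⟨(BornAlgebra.isBounded_mul S T hS hT).subset ?_,
      (BornAlgebra.isBounded_mul T S hT hS).subset ?_⟩
  · rintro _ ⟨_, ⟨a, ha, rfl⟩, b, hb, rfl⟩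
    exact Set.mul_mem_mul ha hb
  · rintro _ ⟨_, ⟨a, ha, rfl⟩, b, hb, rfl⟩
    exact Set.mul_mem_mul hb ha

/-- Evaluation `m ↦ m x` of left multipliers at `x`, as a linear map on `M(A)`. -/
def evalL (x : A) : Multiplier A →ₗ[ℂ] A where
  toFun m := m.L x
  map_add' _ _ := rfl
  map_smul' _ _ := rfl

theorem bddLin_evalL (x : A) : BddLin (evalL x) := fun M hM =>
  (isBounded_iff.1 hM {x} isBounded_singleton).1.subset <| by
    rintro _ ⟨m, hm, rfl⟩
    exact ⟨m, hm, x, rfl, rfl⟩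

theorem assocMap_mul (x y : CTensor (CTensor A B) C) :
    assocMap A B C (x * y) = assocMap A B C x * assocMap A B C y := by
  have htm : ∀ a b c, assocMap A B C ∘ₗ LinearMap.mul ℂ _ (tm (tm a b) c) =
      LinearMap.mul ℂ _ (tm a (tm b c)) ∘ₗ assocMap A B C := fun a b c =>
    BTensor.ext_tm_tm_left (bddLin_assocMap.comp (bddLin_mulLeft _))
      ((bddLin_mulLeft _).comp bddLin_assocMap) fun a' b' c' => by simp
  have hmul : assocMap A B C ∘ₗ (LinearMap.mul ℂ _).flip y =
      (LinearMap.mul ℂ _).flip (assocMap A B C y) ∘ₗ assocMap A B C :=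
    BTensor.ext_tm_tm_left (bddLin_assocMap.comp (bddLin_mulRight _))
      ((bddLin_mulRight _).comp bddLin_assocMap) fun a b c => by
        simpa using LinearMap.congr_fun (htm a b c) y
  exact LinearMap.congr_fun hmul x

theorem assocMap_tensor_L (l : Multiplier A) (m : Multiplier B) (n : Multiplier C)
    (x : CTensor (CTensor A B) C) :
    assocMap A B C (((l.tensor m).tensor n).L x) =
      (l.tensor (m.tensor n)).L (assocMap A B C x) := by
  have : assocMap A B C ∘ₗ ((l.tensor m).tensor n).L =
      (l.tensor (m.tensor n)).L ∘ₗ assocMap A B C :=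
    BTensor.ext_tm_tm_left (bddLin_assocMap.comp (bddLin_L _)) ((bddLin_L _).comp bddLin_assocMap)
      fun a b c => by simp
  exact LinearMap.congr_fun this x

theorem one_tensor_one : (1 : Multiplier A).tensor (1 : Multiplier B) = 1 :=
  ext (BTensor.ext (bddLin_L _) (bddLin_L _) fun a b => by simp)
    (BTensor.ext (bddLin_R _) (bddLin_R _) fun a b => by simp)

theorem sliceLeft_tensor_one_L {ω : A →ₗ[ℂ] ℂ} (hω : BddLin ω) (a : A) (z : CTensor A B) :
    sliceLeft ω hω (((incl A a).tensor 1).L z) =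
      sliceLeft (ω ∘ₗ LinearMap.mul ℂ A a) (hω.comp_mulLeft a) z := by
  have : sliceLeft ω hω ∘ₗ ((incl A a).tensor (1 : Multiplier B)).L =
      sliceLeft (ω ∘ₗ LinearMap.mul ℂ A a) (hω.comp_mulLeft a) :=
    BTensor.ext ((bddLin_sliceLeft _).comp (bddLin_L _)) (bddLin_sliceLeft _) fun x y => by simp
  exact LinearMap.congr_fun this z

theorem sliceLeft_one_tensor_R {ω : A →ₗ[ℂ] ℂ} (hω : BddLin ω) (b : B) (z : CTensor A B) :
    sliceLeft ω hω ((tensor 1 (incl B b)).R z) = sliceLeft ω hω z * b := by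
  have : sliceLeft ω hω ∘ₗ ((1 : Multiplier A).tensor (incl B b)).R =
      (LinearMap.mul ℂ B).flip b ∘ₗ sliceLeft ω hω :=
    BTensor.ext ((bddLin_sliceLeft _).comp (bddLin_R _))
      ((bddLin_mulRight _).comp (bddLin_sliceLeft _)) fun x y => by simp
  exact LinearMap.congr_fun this z

theorem sliceRight_tensor_one_R {ω : B →ₗ[ℂ] ℂ} (hω : BddLin ω) (a : A) (z : CTensor A B) :
    sliceRight ω hω (((incl A a).tensor 1).R z) = sliceRight ω hω z * a := by
  have : sliceRight ω hω ∘ₗ ((incl A a).tensor (1 : Multiplier B)).R =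
      (LinearMap.mul ℂ A).flip a ∘ₗ sliceRight ω hω :=
    BTensor.ext ((bddLin_sliceRight _).comp (bddLin_R _))
      ((bddLin_mulRight _).comp (bddLin_sliceRight _)) fun x y => by simp
  exact LinearMap.congr_fun this z

end Multiplier

section Extensions

open Multiplier

variable {A B C D : Type u} [NonUnitalRing A] [Module ℂ A] [Bornology A] [BornAlgebra A]
  [NonUnitalRing B] [Module ℂ B] [Bornology B] [BornAlgebra B]
  [NonUnitalRing C] [Module ℂ C] [Bornology C] [BornAlgebra C]
  [NonUnitalRing D] [Module ℂ D] [Bornology D] [BornAlgebra D]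

theorem IsUnitalHom.one_tensor_L {f : A →ₗ[ℂ] Multiplier B} (hf : IsEssentialHom f)
    (hC : IsEssentialAlgebra C) {E : Multiplier (CTensor A C) →ₗ[ℂ] Multiplier (CTensor B C)}
    (hE : IsUnitalHom E) (h : ∀ a c, E (incl _ (tm a c)) = (f a).tensor (incl C c)) (y : C) :
    (E (tensor 1 (incl C y))).L = (tensor (1 : Multiplier B) (incl C y)).L := by
  refine hf.isTotal_L.tmul hC.isTotal_mul (bddLin_L _) (bddLin_L _) ?_
  rintro _ ⟨_, ⟨a, -, b, -, rfl⟩, _, ⟨c, -, d, -, rfl⟩, rfl⟩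
  have hmul : E (tensor 1 (incl C y)) * (f a).tensor (incl C c) =
      (f a).tensor (incl C (y * c)) := by
    rw [← h, ← hE.map_mul, mul_incl, tensor_L_tm, one_L, incl_L, h]
  simpa [mul_assoc] using congrArg (fun m : Multiplier (CTensor B C) => m.L (tm b d)) hmul

theorem IsUnitalHom.tensor_one_L {f : A →ₗ[ℂ] Multiplier B} (hf : IsEssentialHom f)
    (hC : IsEssentialAlgebra C) {E : Multiplier (CTensor C A) →ₗ[ℂ] Multiplier (CTensor C B)}
    (hE : IsUnitalHom E) (h : ∀ c a, E (incl _ (tm c a)) = (incl C c).tensor (f a)) (y : C) :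
    (E ((incl C y).tensor 1)).L = ((incl C y).tensor (1 : Multiplier B)).L := by
  refine hC.isTotal_mul.tmul hf.isTotal_L (bddLin_L _) (bddLin_L _) ?_
  rintro _ ⟨_, ⟨c, -, d, -, rfl⟩, _, ⟨a, -, b, -, rfl⟩, rfl⟩
  have hmul : E ((incl C y).tensor 1) * (incl C c).tensor (f a) =
      (incl C (y * c)).tensor (f a) := by
    rw [← h, ← hE.map_mul, mul_incl, tensor_L_tm, one_L, incl_L, h]
  simpa [mul_assoc] using congrArg (fun m : Multiplier (CTensor C B) => m.L (tm d b)) hmul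

theorem IsUnitalHom.L_incl_eq_mul {E : Multiplier (CTensor A B) →ₗ[ℂ] Multiplier (CTensor C D)}
    (hE : IsUnitalHom E) {l r : Multiplier (CTensor C D)} {T : CTensor A B →ₗ[ℂ] CTensor C D}
    (hT : BddLin T)
    (h : ∀ a b c d, l.L ((E (incl _ (tm a b))).L (r.L (tm c d))) = T (tm a b) * tm c d)
    (w : CTensor A B) (x : CTensor C D) : l.L ((E (incl _ w)).L (r.L x)) = T w * x := by
  have htm : ∀ a b, l.L ∘ₗ (E (incl _ (tm a b))).L ∘ₗ r.L = LinearMap.mul ℂ _ (T (tm a b)) :=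
    fun a b => BTensor.ext ((bddLin_L l).comp ((bddLin_L _).comp (bddLin_L r)))
      (bddLin_mulLeft _) (h a b)
  have hw : l.L ∘ₗ evalL (r.L x) ∘ₗ E ∘ₗ incl _ = (LinearMap.mul ℂ _).flip x ∘ₗ T :=
    BTensor.ext ((bddLin_L l).comp ((bddLin_evalL _).comp (hE.bdd.comp bddLin_incl)))
      ((bddLin_mulRight x).comp hT) fun a b => LinearMap.congr_fun (htm a b) x
  exact LinearMap.congr_fun hw w

end Extensions

namespace BornQuantumGroup

open Multiplier

variable {H : Type u} [NonUnitalRing H] [Module ℂ H] [Bornology H] [BornAlgebra H]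
  (Q : BornQuantumGroup H) {ω : H →ₗ[ℂ] ℂ}

theorem nontrivial (Q : BornQuantumGroup H) : Nontrivial H := Q.essential.1

theorem bddLin_haar : BddLin Q.haar := Q.haar_leftInvariant.bdd

theorem haar_ne_zero : Q.haar ≠ 0 :=
  have := Q.nontrivial
  Q.haar_faithful.ne_zero

theorem isSeparated (Q : BornQuantumGroup H) : IsSeparated H := Q.haar_faithful.isSeparated

theorem isNondegenerate (Q : BornQuantumGroup H) : IsNondegenerate H :=
  Q.haar_faithful.isNondegenerate

theorem isSeparated_tensor (Q : BornQuantumGroup H) : IsSeparated (CTensor H H) :=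
  .tensor Q.approximation Q.isSeparated

theorem isNondegenerate_tensor (Q : BornQuantumGroup H) : IsNondegenerate (CTensor H H) :=
  .tensor Q.approximation Q.isSeparated Q.isNondegenerate Q.isSeparated Q.isNondegenerate

section Galois

/-- The partial Galois map `f ↦ γ_l(f ⊗ g) = Δ(f) (g ⊗ 1)`. -/
noncomputable def gammaLAt (g : H) : H →ₗ[ℂ] CTensor H H :=
  Q.galois.gammaL.toLinearMap ∘ₗ (BTensor.tmul ∅).flip g

/-- The partial Galois map `f ↦ γ_r(f ⊗ g) = Δ(f) (1 ⊗ g)`. -/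
noncomputable def gammaRAt (g : H) : H →ₗ[ℂ] CTensor H H :=
  Q.galois.gammaR.toLinearMap ∘ₗ (BTensor.tmul ∅).flip g

/-- The partial Galois map `f ↦ ρ_l(a ⊗ f) = (a ⊗ 1) Δ(f)`. -/
noncomputable def rhoLAt (a : H) : H →ₗ[ℂ] CTensor H H :=
  Q.galois.rhoL.toLinearMap ∘ₗ BTensor.tmul ∅ a

/-- The partial Galois map `f ↦ ρ_r(a ⊗ f) = (1 ⊗ a) Δ(f)`. -/
noncomputable def rhoRAt (a : H) : H →ₗ[ℂ] CTensor H H :=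
  Q.galois.rhoR.toLinearMap ∘ₗ BTensor.tmul ∅ a

theorem bddLin_gammaLAt (g : H) : BddLin (Q.gammaLAt g) :=
  BddLin.comp Q.galois.gammaL_iso.1 (BTensor.bddBilin_tmul.right g)

theorem bddLin_gammaRAt (g : H) : BddLin (Q.gammaRAt g) :=
  BddLin.comp Q.galois.gammaR_iso.1 (BTensor.bddBilin_tmul.right g)

theorem bddLin_rhoLAt (a : H) : BddLin (Q.rhoLAt a) :=
  BddLin.comp Q.galois.rhoL_iso.1 (BTensor.bddBilin_tmul.left a)

theorem bddLin_rhoRAt (a : H) : BddLin (Q.rhoRAt a) :=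
  BddLin.comp Q.galois.rhoR_iso.1 (BTensor.bddBilin_tmul.left a)

theorem galois_gammaL_tm (f g : H) : Q.galois.gammaL (tm f g) = Q.gammaLAt g f := rfl

theorem galois_gammaR_tm (f g : H) : Q.galois.gammaR (tm f g) = Q.gammaRAt g f := rfl

theorem incl_gammaLAt (f g : H) : incl _ (Q.gammaLAt g f) = Q.comul f * (incl H g).tensor 1 :=
  Q.galois.gammaL_tm f g

theorem incl_gammaRAt (f g : H) : incl _ (Q.gammaRAt g f) = Q.comul f * tensor 1 (incl H g) :=
  Q.galois.gammaR_tm f g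

theorem incl_rhoLAt (a f : H) : incl _ (Q.rhoLAt a f) = (incl H a).tensor 1 * Q.comul f :=
  Q.galois.rhoL_tm a f

theorem incl_rhoRAt (a f : H) : incl _ (Q.rhoRAt a f) = tensor 1 (incl H a) * Q.comul f :=
  Q.galois.rhoR_tm a f

theorem gammaLAt_mul_right (f g : H) (u : CTensor H H) :
    Q.gammaLAt g f * u = (Q.comul f).L (((incl H g).tensor 1).L u) := by
  rw [← incl_L, incl_gammaLAt, mul_L_apply]

theorem gammaRAt_mul_right (f g : H) (u : CTensor H H) :
    Q.gammaRAt g f * u = (Q.comul f).L ((tensor 1 (incl H g)).L u) := by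
  rw [← incl_L, incl_gammaRAt, mul_L_apply]

theorem rhoLAt_mul_right (a f : H) (u : CTensor H H) :
    Q.rhoLAt a f * u = ((incl H a).tensor 1).L ((Q.comul f).L u) := by
  rw [← incl_L, incl_rhoLAt, mul_L_apply]

theorem rhoRAt_mul_right (a f : H) (u : CTensor H H) :
    Q.rhoRAt a f * u = (tensor 1 (incl H a)).L ((Q.comul f).L u) := by
  rw [← incl_L, incl_rhoRAt, mul_L_apply]

theorem comul_mul_L (x y : H) (u : CTensor H H) :
    (Q.comul (x * y)).L u = (Q.comul x).L ((Q.comul y).L u) := by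
  rw [Q.isComultiplication.map_mul, mul_L_apply]

theorem gammaLAt_mul (x f g : H) : Q.gammaLAt g (x * f) = (Q.comul x).L (Q.gammaLAt g f) :=
  Q.isNondegenerate_tensor.eq_of_mul_eq fun u => by
    rw [← Multiplier.L_mul, gammaLAt_mul_right, gammaLAt_mul_right, comul_mul_L]

theorem gammaRAt_mul (x f g : H) : Q.gammaRAt g (x * f) = (Q.comul x).L (Q.gammaRAt g f) :=
  Q.isNondegenerate_tensor.eq_of_mul_eq fun u => by
    rw [← Multiplier.L_mul, gammaRAt_mul_right, gammaRAt_mul_right, comul_mul_L]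

theorem tensor_one_L_gammaRAt (a y f : H) :
    ((incl H a).tensor 1).L (Q.gammaRAt y f) = (tensor 1 (incl H y)).R (Q.rhoLAt a f) :=
  Q.isNondegenerate_tensor.eq_of_mul_eq fun u => by
    rw [← Multiplier.L_mul, gammaRAt_mul_right, ← Multiplier.mul_L, rhoLAt_mul_right]

theorem one_tensor_L_gammaLAt (c q g : H) :
    (tensor 1 (incl H c)).L (Q.gammaLAt q g) = ((incl H q).tensor 1).R (Q.rhoRAt c g) :=
  Q.isNondegenerate_tensor.eq_of_mul_eq fun u => by
    rw [← Multiplier.L_mul, gammaLAt_mul_right, ← Multiplier.mul_L, rhoRAt_mul_right]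

theorem tensor_one_R_gammaRAt (x y f : H) :
    ((incl H x).tensor 1).R (Q.gammaRAt y f) = (Q.comul f).L (tm x y) := by
  have htm : (tensor 1 (incl H y)).L ∘ₗ ((incl H x).tensor 1).L = LinearMap.mul ℂ _ (tm x y) :=
    BTensor.ext ((bddLin_L _).comp (bddLin_L _)) (bddLin_mulLeft _) fun a b => by simp
  refine Q.isNondegenerate_tensor.eq_of_mul_eq fun u => ?_
  rw [← Multiplier.mul_L, gammaRAt_mul_right, ← Multiplier.L_mul]
  exact congrArg (Q.comul f).L (LinearMap.congr_fun htm u)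

end Galois

section Coassociativity

theorem eq_of_mul_assocMap_eq (Q : BornQuantumGroup H) {z w : CTensor H (CTensor H H)}
    (h : ∀ x, z * assocMap H H H x = w * assocMap H H H x) : z = w := by
  refine (IsNondegenerate.tensor Q.approximation Q.isSeparated Q.isNondegenerate
    Q.isSeparated_tensor Q.isNondegenerate_tensor).eq_of_mul_eq fun y => ?_
  have : LinearMap.mul ℂ _ z = LinearMap.mul ℂ _ w :=
    BTensor.ext_tm_tm_right (bddLin_mulLeft z) (bddLin_mulLeft w) fun a b c => by
      simpa using h (tm (tm a b) c)
  exact LinearMap.congr_fun this y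

variable {E₁ : Multiplier (CTensor H H) →ₗ[ℂ] Multiplier (CTensor (CTensor H H) H)}
  {E₂ : Multiplier (CTensor H H) →ₗ[ℂ] Multiplier (CTensor H (CTensor H H))}

theorem tensor_one_L_comulTensor (hE : IsUnitalHom E₁)
    (h : ∀ a b, E₁ (incl _ (tm a b)) = (Q.comul a).tensor (incl H b)) (a : H) (w : CTensor H H)
    (x : CTensor (CTensor H H) H) :
    (((incl H a).tensor 1).tensor 1).L ((E₁ (incl _ w)).L x) =
      tmap (Q.rhoLAt a) LinearMap.id (Q.bddLin_rhoLAt a) BddLin.id w * x :=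
  hE.L_incl_eq_mul (r := 1) (bddLin_tmap _ _ _ _)
    (fun p q u v => by simp [h, rhoLAt_mul_right]) w x

theorem comulTensor_L_tensor_one (hE : IsUnitalHom E₁)
    (h : ∀ a b, E₁ (incl _ (tm a b)) = (Q.comul a).tensor (incl H b)) (a : H) (w : CTensor H H)
    (x : CTensor (CTensor H H) H) :
    (E₁ (incl _ w)).L ((((incl H a).tensor 1).tensor 1).L x) =
      tmap (Q.gammaLAt a) LinearMap.id (Q.bddLin_gammaLAt a) BddLin.id w * x :=
  hE.L_incl_eq_mul (l := 1) (bddLin_tmap _ _ _ _)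
    (fun p q u v => by simp [h, gammaLAt_mul_right]) w x

theorem one_tensor_L_tensorComul (hE : IsUnitalHom E₂)
    (h : ∀ a b, E₂ (incl _ (tm a b)) = (incl H a).tensor (Q.comul b)) (a : H) (w : CTensor H H)
    (x : CTensor H (CTensor H H)) :
    (tensor 1 (tensor 1 (incl H a))).L ((E₂ (incl _ w)).L x) =
      tmap LinearMap.id (Q.rhoRAt a) BddLin.id (Q.bddLin_rhoRAt a) w * x :=
  hE.L_incl_eq_mul (r := 1) (bddLin_tmap _ _ _ _)
    (fun p q u v => by simp [h, rhoRAt_mul_right]) w x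

theorem tensorComul_L_one_tensor (hE : IsUnitalHom E₂)
    (h : ∀ a b, E₂ (incl _ (tm a b)) = (incl H a).tensor (Q.comul b)) (a : H) (w : CTensor H H)
    (x : CTensor H (CTensor H H)) :
    (E₂ (incl _ w)).L ((tensor 1 (tensor 1 (incl H a))).L x) =
      tmap LinearMap.id (Q.gammaRAt a) BddLin.id (Q.bddLin_gammaRAt a) w * x :=
  hE.L_incl_eq_mul (l := 1) (bddLin_tmap _ _ _ _)
    (fun p q u v => by simp [h, gammaRAt_mul_right]) w x

/-- Both sides are `(a ⊗ 1 ⊗ 1) Δ²(f) (1 ⊗ 1 ⊗ y)`, where `Δ² = (Δ ⊗ id) Δ = (id ⊗ Δ) Δ`. -/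
theorem assocMap_rhoLAt_gammaRAt (a f y : H) :
    assocMap H H H (tmap (Q.rhoLAt a) LinearMap.id (Q.bddLin_rhoLAt a) BddLin.id
      (Q.gammaRAt y f)) =
      tmap LinearMap.id (Q.gammaRAt y) BddLin.id (Q.bddLin_gammaRAt y) (Q.rhoLAt a f) := by
  obtain ⟨E₁, E₂, hE₁, hE₂, h₁, h₂, hcoassoc⟩ := Q.isComultiplication.coassoc
  have hΔ := Q.isComultiplication.toIsEssentialHom
  refine Q.eq_of_mul_assocMap_eq fun x => ?_
  rw [← assocMap_mul, ← Q.tensor_one_L_comulTensor hE₁ h₁, ← Q.tensorComul_L_one_tensor hE₂ h₂,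
    incl_gammaRAt, incl_rhoLAt, hE₁.map_mul, hE₂.map_mul, mul_L_apply, mul_L_apply,
    hE₁.one_tensor_L hΔ Q.essential h₁, hE₂.tensor_one_L hΔ Q.essential h₂, assocMap_tensor_L,
    one_tensor_one, ← assocMap_tensor_L, one_tensor_one]
  exact congrArg _ (LinearMap.congr_fun (hcoassoc f).1 _)

/-- Both sides are `(1 ⊗ 1 ⊗ c) Δ²(f) (q ⊗ 1 ⊗ 1)`, where `Δ² = (Δ ⊗ id) Δ = (id ⊗ Δ) Δ`. -/
theorem assocMap_gammaLAt_rhoRAt (q f c : H) :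
    assocMap H H H (tmap (Q.gammaLAt q) LinearMap.id (Q.bddLin_gammaLAt q) BddLin.id
      (Q.rhoRAt c f)) =
      tmap LinearMap.id (Q.rhoRAt c) BddLin.id (Q.bddLin_rhoRAt c) (Q.gammaLAt q f) := by
  obtain ⟨E₁, E₂, hE₁, hE₂, h₁, h₂, hcoassoc⟩ := Q.isComultiplication.coassoc
  have hΔ := Q.isComultiplication.toIsEssentialHom
  refine Q.eq_of_mul_assocMap_eq fun x => ?_
  rw [← assocMap_mul, ← Q.comulTensor_L_tensor_one hE₁ h₁, ← Q.one_tensor_L_tensorComul hE₂ h₂,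
    incl_rhoRAt, incl_gammaLAt, hE₁.map_mul, hE₂.map_mul, mul_L_apply, mul_L_apply,
    hE₁.one_tensor_L hΔ Q.essential h₁, hE₂.tensor_one_L hΔ Q.essential h₂]
  have hq := assocMap_tensor_L (incl H q) 1 1 x
  rw [one_tensor_one] at hq
  rw [← hq, ← one_tensor_one, assocMap_tensor_L]
  exact congrArg _ (LinearMap.congr_fun (hcoassoc f).1 _)

end Coassociativity

end BornQuantumGroup

namespace BornQuantumGroup

open Multiplier

variable {H : Type u} [NonUnitalRing H] [Module ℂ H] [Bornology H] [BornAlgebra H]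
  (Q : BornQuantumGroup H) {ω : H →ₗ[ℂ] ℂ}

section Convolution

/-- The convolution `f ↦ (ω ⊗ id)((a ⊗ 1) Δ(f))` of `f` with the functional `ω(a ·)`. -/
noncomputable def convL (a : H) (hω : BddLin ω) : H →ₗ[ℂ] H := sliceLeft ω hω ∘ₗ Q.rhoLAt a

/-- The convolution `f ↦ (id ⊗ ω)((1 ⊗ c) Δ(f))` of `f` with the functional `ω(c ·)`. -/
noncomputable def convR (c : H) (hω : BddLin ω) : H →ₗ[ℂ] H := sliceRight ω hω ∘ₗ Q.rhoRAt c

theorem bddLin_convL (a : H) (hω : BddLin ω) : BddLin (Q.convL a hω) :=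
  (bddLin_sliceLeft _).comp (Q.bddLin_rhoLAt a)

theorem bddLin_convR (c : H) (hω : BddLin ω) : BddLin (Q.convR c hω) :=
  (bddLin_sliceRight _).comp (Q.bddLin_rhoRAt c)

theorem tmap_convL_gammaRAt (a f y : H) (hω : BddLin ω) :
    tmap (Q.convL a hω) LinearMap.id (Q.bddLin_convL a hω) BddLin.id (Q.gammaRAt y f) =
      Q.gammaRAt y (Q.convL a hω f) := by
  have h := congrArg (sliceLeft ω hω) (Q.assocMap_rhoLAt_gammaRAt a f y)
  rwa [sliceLeft_assocMap, tmap_tmap_left, sliceLeft_tmap] at h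

theorem gammaLAt_convR (q f c : H) (hω : BddLin ω) :
    Q.gammaLAt q (Q.convR c hω f) =
      tmap LinearMap.id (Q.convR c hω) BddLin.id (Q.bddLin_convR c hω) (Q.gammaLAt q f) := by
  have h := congrArg (tmap LinearMap.id (sliceRight ω hω) BddLin.id (bddLin_sliceRight hω))
    (Q.assocMap_gammaLAt_rhoRAt q f c)
  rwa [tmap_sliceRight_assocMap, tmap_tmap_right, sliceRight_tmap] at h

/-- The map `y ↦ (id ⊗ φ)(Δ(f) (1 ⊗ y))`, where `φ` is the left Haar functional. -/
noncomputable def haarConv (f : H) : H →ₗ[ℂ] H :=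
  sliceRight Q.haar Q.bddLin_haar ∘ₗ Q.galois.gammaR.toLinearMap ∘ₗ BTensor.tmul ∅ f

theorem bddLin_haarConv (f : H) : BddLin (Q.haarConv f) :=
  (bddLin_sliceRight _).comp
    (BddLin.comp Q.galois.gammaR_iso.1 (BTensor.bddBilin_tmul.left f))

theorem haarConv_apply (f y : H) :
    Q.haarConv f y = sliceRight Q.haar Q.bddLin_haar (Q.gammaRAt y f) := rfl

theorem apply_mul_haarConv (a f y : H) (hω : BddLin ω) :
    ω (a * Q.haarConv f y) = Q.haar (Q.convL a hω f * y) := by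
  rw [haarConv_apply, convL, LinearMap.comp_apply, ← sliceLeft_one_tensor_R,
    ← tensor_one_L_gammaRAt, sliceLeft_tensor_one_L, apply_sliceLeft _ Q.bddLin_haar]
  rfl

theorem convL_haarConv (a f y : H) (hω : BddLin ω) :
    Q.convL a hω (Q.haarConv f y) = Q.haarConv (Q.convL a hω f) y := by
  rw [haarConv_apply, haarConv_apply, ← tmap_convL_gammaRAt, sliceRight_tmap]

theorem sliceRight_haar_gammaLAt (f q : H) :
    sliceRight Q.haar Q.bddLin_haar (Q.gammaLAt q f) = Q.haar f • q :=
  Q.haar_leftInvariant.left f q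

theorem isTotal_gammaRAt (Q : BornQuantumGroup H) :
    IsTotal (Set.image2 (fun f g => Q.gammaRAt g f) Set.univ Set.univ) :=
  isTotal_image2_apply_tmul Q.galois.gammaR_iso.1 Q.galois.gammaR.surjective

theorem isTotal_convL :
    IsTotal (Set.image2 (fun a f => Q.convL a Q.bddLin_haar f) Set.univ Set.univ) :=
  isTotal_image2_apply_tmul ((bddLin_sliceLeft Q.bddLin_haar).comp Q.galois.rhoL_iso.1)
    ((sliceLeft_surjective Q.bddLin_haar Q.haar_ne_zero).comp Q.galois.rhoL.surjective)

theorem isTotal_convR :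
    IsTotal (Set.image2 (fun c f => Q.convR c Q.bddLin_haar f) Set.univ Set.univ) :=
  isTotal_image2_apply_tmul ((bddLin_sliceRight Q.bddLin_haar).comp Q.galois.rhoR_iso.1)
    ((sliceRight_surjective Q.bddLin_haar Q.haar_ne_zero).comp Q.galois.rhoR.surjective)

theorem isTotal_haarConv :
    IsTotal (Set.image2 (fun f y => Q.haarConv f y) Set.univ Set.univ) :=
  isTotal_image2_apply_tmul ((bddLin_sliceRight Q.bddLin_haar).comp Q.galois.gammaR_iso.1)
    ((sliceRight_surjective Q.bddLin_haar Q.haar_ne_zero).comp Q.galois.gammaR.surjective)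

end Convolution

section GaloisInverse

/-- The map `x ⊗ y ↦ (id ⊗ φ)(Δ(f) (1 ⊗ y)) ⊗ x`, where `φ` is the left Haar functional. Applied
to `γ_l(g ⊗ q)`, it yields a preimage under `γ_r`. -/
noncomputable def haarConvSwap (f : H) : CTensor H H →ₗ[ℂ] CTensor H H :=
  BTensor.lift ((BTensor.tmul ∅).compl₁₂ (Q.haarConv f) LinearMap.id).flip
    (BTensor.bddBilin_tmul.compl (Q.bddLin_haarConv f) BddLin.id).flip (fun _ _ h => h.elim)

theorem bddLin_haarConvSwap (f : H) : BddLin (Q.haarConvSwap f) := BTensor.bddLin_lift _ _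

@[simp]
theorem haarConvSwap_tm (f x y : H) : Q.haarConvSwap f (tm x y) = tm (Q.haarConv f y) x :=
  BTensor.lift_tmul _ _ _ _

theorem sliceLeft_tensor_one_L_gammaR_haarConvSwap (a f : H) (hω : BddLin ω) (w : CTensor H H) :
    sliceLeft ω hω (((incl H a).tensor 1).L (Q.galois.gammaR (Q.haarConvSwap f w))) =
      sliceRight Q.haar Q.bddLin_haar ((Q.comul (Q.convL a hω f)).L w) := by
  have h : sliceLeft ω hω ∘ₗ ((incl H a).tensor (1 : Multiplier H)).L ∘ₗ
      Q.galois.gammaR.toLinearMap ∘ₗ Q.haarConvSwap f =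
        sliceRight Q.haar Q.bddLin_haar ∘ₗ (Q.comul (Q.convL a hω f)).L := by
    refine BTensor.ext ((bddLin_sliceLeft _).comp ((bddLin_L _).comp
      (BddLin.comp Q.galois.gammaR_iso.1 (Q.bddLin_haarConvSwap f))))
      ((bddLin_sliceRight _).comp (bddLin_L _)) fun x y => ?_
    simp only [LinearMap.comp_apply, LinearEquiv.coe_coe, haarConvSwap_tm, galois_gammaR_tm]
    rw [tensor_one_L_gammaRAt, sliceLeft_one_tensor_R, ← tensor_one_R_gammaRAt,
      sliceRight_tensor_one_R, ← haarConv_apply, ← convL_haarConv]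
    rfl
  exact LinearMap.congr_fun h w

theorem gammaR_haarConvSwap_gammaLAt (f g q : H) :
    Q.galois.gammaR (Q.haarConvSwap f (Q.gammaLAt q g)) = tm (Q.haarConv f g) q := by
  refine Q.haar_faithful.eq_of_sliceLeft_mulLeft Q.approximation Q.isSeparated fun a => ?_
  rw [← sliceLeft_tensor_one_L Q.bddLin_haar, sliceLeft_tensor_one_L_gammaR_haarConvSwap,
    ← gammaLAt_mul, sliceRight_haar_gammaLAt, ← apply_mul_haarConv, sliceLeft_tm]
  rfl

theorem gammaR_symm_tm_haarConv (f g q : H) :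
    Q.galois.gammaR.symm (tm (Q.haarConv f g) q) = Q.haarConvSwap f (Q.gammaLAt q g) := by
  rw [← gammaR_haarConvSwap_gammaLAt, LinearEquiv.symm_apply_apply]

theorem sliceLeft_tensor_one_L_haarConvSwap_gammaLAt (a f g q : H) (hω : BddLin ω) :
    sliceLeft ω hω (((incl H a).tensor 1).L (Q.haarConvSwap f (Q.gammaLAt q g))) =
      Q.convR (Q.convL a hω f) Q.bddLin_haar g * q := by
  have h : sliceLeft ω hω ∘ₗ ((incl H a).tensor (1 : Multiplier H)).L ∘ₗ Q.haarConvSwap f =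
      sliceRight Q.haar Q.bddLin_haar ∘ₗ (tensor (1 : Multiplier H)
        (incl H (Q.convL a hω f))).L :=
    BTensor.ext ((bddLin_sliceLeft _).comp ((bddLin_L _).comp (Q.bddLin_haarConvSwap f)))
      ((bddLin_sliceRight _).comp (bddLin_L _)) fun x y => by
        simp [Q.apply_mul_haarConv a f y hω]
  refine (LinearMap.congr_fun h (Q.gammaLAt q g)).trans ?_
  rw [LinearMap.comp_apply, one_tensor_L_gammaLAt, sliceRight_tensor_one_R]
  rfl

end GaloisInverse

section Antipode

/-- The map `(id ⊗ φ) ρ_r γ_r⁻¹`, where `φ` is the left Haar functional. It factors through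
`id ⊗ φ`, and the factor is the antipode. -/
noncomputable def preAntipode : CTensor H H →ₗ[ℂ] H :=
  sliceRight Q.haar Q.bddLin_haar ∘ₗ Q.galois.rhoR.toLinearMap ∘ₗ
    Q.galois.gammaR.symm.toLinearMap

theorem bddLin_preAntipode : BddLin Q.preAntipode :=
  (bddLin_sliceRight _).comp (BddLin.comp Q.galois.rhoR_iso.1 Q.galois.gammaR_iso.2)

theorem preAntipode_gammaRAt (f g : H) :
    Q.preAntipode (Q.gammaRAt g f) = Q.convR f Q.bddLin_haar g := by
  rw [← galois_gammaR_tm, preAntipode, LinearMap.comp_apply, LinearMap.comp_apply,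
    LinearEquiv.coe_coe, LinearEquiv.coe_coe, LinearEquiv.symm_apply_apply]
  rfl

theorem preAntipode_tmap_convL_mul (a q : H) (hω : BddLin ω) (w : CTensor H H) :
    Q.preAntipode (tmap (Q.convL a hω) LinearMap.id (Q.bddLin_convL a hω) BddLin.id w) * q =
      sliceLeft ω hω (((incl H a).tensor 1).L
        (Q.galois.gammaR.symm (tm (sliceRight Q.haar Q.bddLin_haar w) q))) := by
  have h : (LinearMap.mul ℂ H).flip q ∘ₗ Q.preAntipode ∘ₗ
      tmap (Q.convL a hω) LinearMap.id (Q.bddLin_convL a hω) BddLin.id =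
      sliceLeft ω hω ∘ₗ ((incl H a).tensor (1 : Multiplier H)).L ∘ₗ
        Q.galois.gammaR.symm.toLinearMap ∘ₗ (BTensor.tmul ∅).flip q ∘ₗ
          sliceRight Q.haar Q.bddLin_haar := by
    refine Q.isTotal_gammaRAt
      ((bddLin_mulRight q).comp (Q.bddLin_preAntipode.comp (bddLin_tmap _ _ _ _)))
      ((bddLin_sliceLeft _).comp ((bddLin_L _).comp (BddLin.comp Q.galois.gammaR_iso.2
        ((BTensor.bddBilin_tmul.right q).comp (bddLin_sliceRight _))))) ?_
    rintro _ ⟨f, -, g, -, rfl⟩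
    change Q.preAntipode (tmap (Q.convL a hω) LinearMap.id _ BddLin.id (Q.gammaRAt g f)) * q =
      sliceLeft ω hω (((incl H a).tensor 1).L (Q.galois.gammaR.symm (tm (Q.haarConv f g) q)))
    rw [gammaR_symm_tm_haarConv, tmap_convL_gammaRAt, preAntipode_gammaRAt,
      sliceLeft_tensor_one_L_haarConvSwap_gammaLAt]
  exact LinearMap.congr_fun h w

theorem exists_preAntipode_eq_comp_sliceRight :
    ∃ S : H →ₗ[ℂ] H, BddLin S ∧ Q.preAntipode = S ∘ₗ sliceRight Q.haar Q.bddLin_haar := by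
  obtain ⟨b₀, hb₀⟩ := exists_eq_one_of_ne_zero Q.haar_ne_zero
  have hS : BddLin (Q.preAntipode ∘ₗ (BTensor.tmul ∅).flip b₀) :=
    Q.bddLin_preAntipode.comp (BTensor.bddBilin_tmul.right b₀)
  refine ⟨_, hS, (Q.isTotal_convL.tmul isTotal_univ) Q.bddLin_preAntipode
    (hS.comp (bddLin_sliceRight _)) ?_⟩
  rintro _ ⟨_, ⟨a, -, p, -, rfl⟩, b, -, rfl⟩
  have hsmul : ∀ (c : ℂ) (x y : H), tm (c • x) y = c • tm x y :=
    LinearMap.map_smul₂ (BTensor.tmul ∅)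
  have hmul : ∀ c q, Q.preAntipode (tm (Q.convL a Q.bddLin_haar p) c) * q =
      Q.haar c • sliceLeft Q.haar Q.bddLin_haar (((incl H a).tensor 1).L
        (Q.galois.gammaR.symm (tm p q))) := fun c q => by
    have h := Q.preAntipode_tmap_convL_mul a q Q.bddLin_haar (tm p c)
    rwa [tmap_tm, sliceRight_tm, hsmul, map_smul, map_smul, map_smul] at h
  change Q.preAntipode (tm (Q.convL a Q.bddLin_haar p) b) = Q.preAntipode
    (tm (sliceRight Q.haar Q.bddLin_haar (tm (Q.convL a Q.bddLin_haar p) b)) b₀)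
  rw [sliceRight_tm, hsmul, map_smul]
  refine Q.isNondegenerate.eq_of_mul_eq fun q => ?_
  rw [smul_mul_assoc, hmul, hmul, hb₀, one_smul]

/-- `S` is the antipode: with `φ` the left Haar functional, it satisfies
`S((id ⊗ φ)(Δ(f) (1 ⊗ g))) = (id ⊗ φ)((1 ⊗ f) Δ(g))`. -/
theorem exists_antipode : ∃ S : H →ₗ[ℂ] H, BddLin S ∧
    ∀ f g, S (Q.haarConv f g) = Q.convR f Q.bddLin_haar g := by
  obtain ⟨S, hS, h⟩ := Q.exists_preAntipode_eq_comp_sliceRight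
  exact ⟨S, hS, fun f g => by rw [← preAntipode_gammaRAt, h, LinearMap.comp_apply, haarConv_apply]⟩

variable {S : H →ₗ[ℂ] H}

theorem haar_comp_antipode_ne_zero
    (h : ∀ f g, S (Q.haarConv f g) = Q.convR f Q.bddLin_haar g) : Q.haar ∘ₗ S ≠ 0 := fun h0 => by
  refine Q.haar_ne_zero (Q.isTotal_convR.functional_ext Q.bddLin_haar bddLin_zero ?_)
  rintro _ ⟨f, -, g, -, rfl⟩
  change Q.haar (Q.convR f Q.bddLin_haar g) = 0
  rw [← h]
  exact LinearMap.congr_fun h0 _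

theorem sliceLeft_haar_comp_antipode_gammaR_symm (hS : BddLin S)
    (h : ∀ f g, S (Q.haarConv f g) = Q.convR f Q.bddLin_haar g) :
    sliceLeft (Q.haar ∘ₗ S) (Q.bddLin_haar.functional_comp hS) ∘ₗ
        Q.galois.gammaR.symm.toLinearMap =
      sliceLeft (Q.haar ∘ₗ S) (Q.bddLin_haar.functional_comp hS) := by
  have hψ := Q.bddLin_haar.functional_comp hS
  have hswap : ∀ f, sliceLeft (Q.haar ∘ₗ S) hψ ∘ₗ Q.haarConvSwap f =
      sliceRight Q.haar Q.bddLin_haar ∘ₗ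
        tmap LinearMap.id (Q.convR f Q.bddLin_haar) BddLin.id (Q.bddLin_convR f _) := fun f =>
    BTensor.ext ((bddLin_sliceLeft _).comp (Q.bddLin_haarConvSwap f))
      ((bddLin_sliceRight _).comp (bddLin_tmap _ _ _ _)) fun x y => by simp [h]
  refine (Q.isTotal_haarConv.tmul isTotal_univ)
    ((bddLin_sliceLeft _).comp Q.galois.gammaR_iso.2) (bddLin_sliceLeft _) ?_
  rintro _ ⟨_, ⟨f, -, g, -, rfl⟩, q, -, rfl⟩
  calc sliceLeft (Q.haar ∘ₗ S) hψ (Q.galois.gammaR.symm (tm (Q.haarConv f g) q))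
      = sliceRight Q.haar Q.bddLin_haar (tmap LinearMap.id (Q.convR f Q.bddLin_haar) BddLin.id
          (Q.bddLin_convR f _) (Q.gammaLAt q g)) := by
        rw [gammaR_symm_tm_haarConv]
        exact LinearMap.congr_fun (hswap f) _
    _ = Q.haar (S (Q.haarConv f g)) • q := by
        rw [← gammaLAt_convR, sliceRight_haar_gammaLAt, h]
    _ = sliceLeft (Q.haar ∘ₗ S) hψ (tm (Q.haarConv f g) q) := (sliceLeft_tm _ hψ _ _).symm

theorem exists_rightInvariant : ∃ (ψ : H →ₗ[ℂ] ℂ) (hψ : BddLin ψ), ψ ≠ 0 ∧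
    ∀ f g, sliceLeft ψ hψ (Q.gammaRAt g f) = ψ f • g := by
  obtain ⟨S, hS, h⟩ := Q.exists_antipode
  refine ⟨Q.haar ∘ₗ S, Q.bddLin_haar.functional_comp hS, Q.haar_comp_antipode_ne_zero h,
    fun f g => ?_⟩
  rw [← Q.sliceLeft_haar_comp_antipode_gammaR_symm hS h, ← galois_gammaR_tm, LinearMap.comp_apply,
    LinearEquiv.coe_coe, LinearEquiv.symm_apply_apply, sliceLeft_tm]

end Antipode

end BornQuantumGroup

namespace BornQuantumGroup

variable {H : Type u} [NonUnitalRing H] [Module ℂ H] [Bornology H] [BornAlgebra H]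
  (Q : BornQuantumGroup H) {φ ψ : H →ₗ[ℂ] ℂ}

theorem apply_sliceLeft_comul_L_gammaR (hφ : BddLin φ) (hψ : BddLin ψ)
    (h : ∀ f g, sliceLeft ψ hψ (Q.gammaRAt g f) = ψ f • g) (x : H) (w : CTensor H H) :
    φ (sliceLeft ψ hψ ((Q.comul x).L (Q.galois.gammaR w))) = ψ (x * sliceRight φ hφ w) := by
  have hslice : sliceLeft ψ hψ ∘ₗ (Q.comul x).L ∘ₗ Q.galois.gammaR.toLinearMap =
      sliceLeft (ψ ∘ₗ LinearMap.mul ℂ H x) (hψ.comp_mulLeft x) :=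
    BTensor.ext
      ((bddLin_sliceLeft _).comp ((Multiplier.bddLin_L _).comp Q.galois.gammaR_iso.1))
      (bddLin_sliceLeft _) fun f g => by
        simp only [LinearMap.comp_apply, LinearEquiv.coe_coe, galois_gammaR_tm, ← gammaRAt_mul, h,
          sliceLeft_tm, LinearMap.mul_apply']
  exact (congrArg φ (LinearMap.congr_fun hslice w)).trans (apply_sliceLeft _ hφ w)

theorem apply_sliceLeft_comul_L_gammaL (hφ : IsLeftInvariant Q.galois φ) (hψ : BddLin ψ)
    (x : H) (w : CTensor H H) :
    φ (sliceLeft ψ hψ ((Q.comul x).L (Q.galois.gammaL w))) = φ (x * sliceRight ψ hψ w) := by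
  have hslice : sliceRight φ hφ.bdd ∘ₗ (Q.comul x).L ∘ₗ Q.galois.gammaL.toLinearMap =
      sliceLeft (φ ∘ₗ LinearMap.mul ℂ H x) (hφ.bdd.comp_mulLeft x) :=
    BTensor.ext
      ((bddLin_sliceRight _).comp ((Multiplier.bddLin_L _).comp Q.galois.gammaL_iso.1))
      (bddLin_sliceLeft _) fun f g => by
        simp only [LinearMap.comp_apply, LinearEquiv.coe_coe, galois_gammaL_tm, ← gammaLAt_mul,
          sliceLeft_tm, LinearMap.mul_apply']
        exact hφ.left _ _
  rw [apply_sliceLeft hψ hφ.bdd]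
  exact (congrArg ψ (LinearMap.congr_fun hslice w)).trans (apply_sliceLeft _ hψ w)

/-- The map `f ↦ (id ⊗ ψ) γ_l⁻¹ γ_r (f ⊗ g)`. If `ψ` is right invariant, it turns `ψ` into any left
invariant `φ` with `φ(g) = 1`. -/
noncomputable def modularMap (hψ : BddLin ψ) (g : H) : H →ₗ[ℂ] H :=
  sliceRight ψ hψ ∘ₗ Q.galois.gammaL.symm.toLinearMap ∘ₗ Q.gammaRAt g

/-- The map `f ↦ (id ⊗ φ) γ_r⁻¹ γ_l (f ⊗ g)`. If `φ` is left invariant, it turns `φ` into any right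
invariant `ψ` with `ψ(g) = 1`, and so inverts `modularMap`. -/
noncomputable def modularMapInv (hφ : BddLin φ) (g : H) : H →ₗ[ℂ] H :=
  sliceRight φ hφ ∘ₗ Q.galois.gammaR.symm.toLinearMap ∘ₗ Q.gammaLAt g

theorem bddLin_modularMap (hψ : BddLin ψ) (g : H) : BddLin (Q.modularMap hψ g) :=
  (bddLin_sliceRight _).comp (BddLin.comp Q.galois.gammaL_iso.2 (Q.bddLin_gammaRAt g))

theorem bddLin_modularMapInv (hφ : BddLin φ) (g : H) : BddLin (Q.modularMapInv hφ g) :=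
  (bddLin_sliceRight _).comp (BddLin.comp Q.galois.gammaR_iso.2 (Q.bddLin_gammaLAt g))

theorem apply_mul_modularMap (hφ : IsLeftInvariant Q.galois φ) (hψ : BddLin ψ)
    (h : ∀ f g, sliceLeft ψ hψ (Q.gammaRAt g f) = ψ f • g) (x f g : H) :
    φ (x * Q.modularMap hψ g f) = φ g * ψ (x * f) :=
  calc φ (x * Q.modularMap hψ g f)
      = φ (sliceLeft ψ hψ ((Q.comul x).L (Q.galois.gammaR (tm f g)))) := by
        have hw := Q.apply_sliceLeft_comul_L_gammaL hφ hψ x (Q.galois.gammaL.symm (Q.gammaRAt g f))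
        rw [LinearEquiv.apply_symm_apply] at hw
        exact hw.symm
    _ = φ g * ψ (x * f) := by
        rw [Q.apply_sliceLeft_comul_L_gammaR hφ.bdd hψ h, sliceRight_tm, mul_smul_comm, map_smul,
          smul_eq_mul]

theorem apply_mul_modularMapInv (hφ : IsLeftInvariant Q.galois φ) (hψ : BddLin ψ)
    (h : ∀ f g, sliceLeft ψ hψ (Q.gammaRAt g f) = ψ f • g) (x f g : H) :
    ψ (x * Q.modularMapInv hφ.bdd g f) = ψ g * φ (x * f) :=
  calc ψ (x * Q.modularMapInv hφ.bdd g f)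
      = φ (sliceLeft ψ hψ ((Q.comul x).L (Q.galois.gammaL (tm f g)))) := by
        have hw := Q.apply_sliceLeft_comul_L_gammaR hφ.bdd hψ h x
          (Q.galois.gammaR.symm (Q.gammaLAt g f))
        rw [LinearEquiv.apply_symm_apply] at hw
        exact hw.symm
    _ = ψ g * φ (x * f) := by
        rw [Q.apply_sliceLeft_comul_L_gammaL hφ hψ, sliceRight_tm, mul_smul_comm, map_smul,
          smul_eq_mul]

theorem modularMap_modularMapInv (hφ : IsFaithful φ) (hφl : IsLeftInvariant Q.galois φ)
    (hψ : BddLin ψ) (h : ∀ f g, sliceLeft ψ hψ (Q.gammaRAt g f) = ψ f • g) {a b : H}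
    (ha : φ a = 1) (hb : ψ b = 1) (f : H) :
    Q.modularMap hψ a (Q.modularMapInv hφl.bdd b f) = f :=
  hφ.eq_of_mul_left fun x => by
    rw [Q.apply_mul_modularMap hφl hψ h, Q.apply_mul_modularMapInv hφl hψ h, ha, hb, one_mul,
      one_mul]

theorem modularMapInv_modularMap (hφ : IsLeftInvariant Q.galois φ) (hψ : IsFaithful ψ)
    (h : ∀ f g, sliceLeft ψ hψ.bdd (Q.gammaRAt g f) = ψ f • g) {a b : H}
    (ha : φ a = 1) (hb : ψ b = 1) (f : H) :
    Q.modularMapInv hφ.bdd b (Q.modularMap hψ.bdd a f) = f :=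
  hψ.eq_of_mul_left fun x => by
    rw [Q.apply_mul_modularMapInv hφ hψ.bdd h, Q.apply_mul_modularMap hφ hψ.bdd h, ha, hb, one_mul,
      one_mul]

theorem exists_modular_iso (hφ : IsFaithful φ) (hφl : IsLeftInvariant Q.galois φ)
    (hψ : IsFaithful ψ) (hψr : IsRightInvariant Q.galois ψ) :
    ∃ ν : H ≃ₗ[ℂ] H, IsBornIso ν ∧ ∀ f h, ψ (h * f) = φ (h * ν f) := by
  have := Q.nontrivial
  obtain ⟨a, ha⟩ := exists_eq_one_of_ne_zero hφ.ne_zero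
  obtain ⟨b, hb⟩ := exists_eq_one_of_ne_zero hψ.ne_zero
  refine ⟨LinearEquiv.ofLinearMap (Q.modularMap hψ.bdd a) (Q.modularMapInv hφl.bdd b)
    (LinearMap.ext (Q.modularMap_modularMapInv hφ hφl hψ.bdd hψr.left ha hb))
    (LinearMap.ext (Q.modularMapInv_modularMap hφl hψ hψr.left ha hb)),
    ⟨Q.bddLin_modularMap hψ.bdd a, Q.bddLin_modularMapInv hφl.bdd b⟩, fun f h => ?_⟩
  change ψ (h * f) = φ (h * Q.modularMap hψ.bdd a f)
  rw [Q.apply_mul_modularMap hφl hψ.bdd hψr.left, ha, one_mul]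

theorem eq_smul_haar_of_rightInvariant (hψ : BddLin ψ) (h0 : ψ ≠ 0)
    (h : ∀ f g, sliceLeft ψ hψ (Q.gammaRAt g f) = ψ f • g) (hφ : IsLeftInvariant Q.galois φ) :
    ∃ c : ℂ, φ = c • Q.haar := by
  obtain ⟨a, ha⟩ := exists_eq_one_of_ne_zero Q.haar_ne_zero
  obtain ⟨b, hb⟩ := exists_eq_one_of_ne_zero h0
  have hbdd : BddLin (φ a • Q.haar) := by
    simpa only [LinearMap.comp_smul, LinearMap.comp_id] using
      Q.bddLin_haar.functional_comp (BddLin.id.smul (φ a))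
  refine ⟨φ a, Q.essential.isTotal_mul.functional_ext hφ.bdd hbdd ?_⟩
  rintro _ ⟨x, -, y, -, rfl⟩
  have hy := Q.modularMap_modularMapInv Q.haar_faithful Q.haar_leftInvariant hψ h ha hb y
  change φ (x * y) = φ a * Q.haar (x * y)
  rw [← hy, Q.apply_mul_modularMap hφ hψ h, Q.apply_mul_modularMap Q.haar_leftInvariant hψ h, ha,
    one_mul]

end BornQuantumGroup

end BornQG

theorem mainTheorem7 {H : Type u} [NonUnitalRing H] [Module ℂ H] [Bornology H]
    [BornQG.BornAlgebra H] (Q : BornQG.BornQuantumGroup H) :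
    (∀ φ' : H →ₗ[ℂ] ℂ, BornQG.IsLeftInvariant Q.galois φ' →
      ∃ c : ℂ, φ' = c • Q.haar ∧ (BornQG.IsFaithful φ' → c ≠ 0)) ∧
    (∀ φ ψ : H →ₗ[ℂ] ℂ, BornQG.IsFaithful φ → BornQG.IsLeftInvariant Q.galois φ →
      BornQG.IsFaithful ψ → BornQG.IsRightInvariant Q.galois ψ →
      ∃ ν : H ≃ₗ[ℂ] H, BornQG.IsBornIso ν ∧ ∀ f h, ψ (h * f) = φ (h * ν f)) := by
  refine ⟨fun φ' hφ' => ?_, fun φ ψ hφ hφl hψ hψr => Q.exists_modular_iso hφ hφl hψ hψr⟩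
  obtain ⟨ψ, hψ, h0, h⟩ := Q.exists_rightInvariant
  obtain ⟨c, hc⟩ := Q.eq_smul_haar_of_rightInvariant hψ h0 h hφ'
  refine ⟨c, hc, fun hf hc0 => ?_⟩
  have := Q.nontrivial
  exact hf.ne_zero (by rw [hc, hc0, zero_smul])
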